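/- Let $\tilde M^{2m+1}(c)$ be a cosymplectic space form, that is, a smooth manifold with an almost contact metric structure $(\varphi,\xi,\eta,g)$ satisfying $\tilde\nabla\varphi=0$ for the Levi-Civita connection $\tilde\nabla$ of $g$, and having constant $\varphi$-sectional curvature $c$ (every plane spanned by $X$ and $\varphi X$, with $0\neq X\perp\xi$, has sectional curvature $c$). Let $N_T$ and $N_\perp$ be Riemannian manifolds of dimensions $n_1$ and $n_2$, let $f:N_T\to(0,\infty)$ be smooth, and let $F:M^n=N_T\times_f N_\perp\to\tilde M^{2m+1}(c)$ be an isometric immersion of the warped product, with metric $g_T+f^2g_\perp$, as a contact CR-warped product submanifold with $\xi$ tangent to $N_T$: for all $p\in N_T$, $q\in N_\perp$, along the leaf $N_T\times\{q\}$ the field $\xi$ is tangent to the leaf and $\varphi$ maps the tangent spaces of the leaf into themselves, while $\varphi$ maps the tangent spaces of the leaf $\{p\}\times N_\perp$ into the normal spaces of $M^n$. Let $h$ be the second fundamental form of $M^n$ in $\tilde M^{2m+1}(c)$, let $\|h\|^2=\sum_{i,j}g(h(e_i,e_j),h(e_i,e_j))$ for an orthonormal frame $(e_i)$ of $M^n$,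 let $\nabla(\ln f)$ be the gradient of $\ln f$ on $N_T$, and let $\Delta(\ln f)=-\operatorname{div}\nabla(\ln f)$ be the (nonnegative) Laplacian of $\ln f$ on $N_T$. Then: (i) at every point of $M^n$, $$\|h\|^2\ \ge\ 2n_2\Bigl(\|\nabla(\ln f)\|^2-\Delta(\ln f)+(n_1-1)\frac{c}{4}\Bigr);$$ (ii) equality holds in (i) at every point of $M^n$ if and only if all leaves $N_T\times\{q\}$ are totally geodesic in $\tilde M^{2m+1}(c)$, all leaves $\{p\}\times N_\perp$ are totally umbilical in $\tilde M^{2m+1}(c)$, and $M^n$ is minimal in $\tilde M^{2m+1}(c)$. -/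

import Mathlib

open Bundle
open scoped Manifold ContDiff

noncomputable section

namespace CRWarped

/-! ## Metric linear algebra -/

section LinearAlgebra

variable {V W : Type*} [AddCommGroup V] [Module ℝ V] [AddCommGroup W] [Module ℝ W]

/-- `b` is an orthonormal basis for the bilinear form `B`. -/
def IsOrthonormalBasis {ι : Type*} [DecidableEq ι] (B : V → V → ℝ) (b : Module.Basis ι ℝ V) :
    Prop :=
  ∀ i j, B (b i) (b j) = if i = j then 1 else 0

open Classical in
/-- The trace `∑ᵢ T(eᵢ, eᵢ)` of a bilinear map `T` over a `B`-orthonormal basis `(eᵢ)`, where `B`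
is an inner product on a finite-dimensional space (the sum does not depend on the basis). -/
def metricTrace (B : V → V → ℝ) (T : V → V → W) : W :=
  if h : ∃ b : Module.Basis (Fin (Module.finrank ℝ V)) ℝ V, IsOrthonormalBasis B b then
    ∑ i, T (h.choose i) (h.choose i)
  else 0

end LinearAlgebra

/-! ## Levi-Civita connection and curvature of a metric on an open subset of a vector space -/

section Local

variable {E : Type*} [NormedAddCommGroup E] [NormedSpace ℝ E]

/-- The Levi-Civita connection of the metric `G` in coordinates: `christoffel G y u v` is the
vector `Γ(u, v)` at `y`, i.e. the solution of
`G(Γ(u, v), w) = (∂_u G(v, w) + ∂_v G(u, w) - ∂_w G(u, v)) / 2` for all `w`. -/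
def christoffel (G : E → E →L[ℝ] E →L[ℝ] ℝ) (y u v : E) : E :=
  (G y).inverse ((1 / 2 : ℝ) •
    (fderiv ℝ G y u v + fderiv ℝ G y v u - ((fderiv ℝ G y).flip u).flip v))

/-- The curvature tensor `R(u, v) w`, with the convention
`R(X, Y) Z = ∇_X ∇_Y Z - ∇_Y ∇_X Z - ∇_[X, Y] Z`. -/
def localCurvature (G : E → E →L[ℝ] E →L[ℝ] ℝ) (y u v w : E) : E :=
  fderiv ℝ (fun z => christoffel G z v w) y u - fderiv ℝ (fun z => christoffel G z u w) y v
    + christoffel G y u (christoffel G y v w) - christoffel G y v (christoffel G y u w)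

end Local

/-! ## Riemannian manifolds (all manifolds below are without boundary) -/

section Manifold

variable {E : Type*} [NormedAddCommGroup E] [NormedSpace ℝ E]
  {H : Type*} [TopologicalSpace H] {I : ModelWithCorners ℝ E H}
  {M : Type*} [TopologicalSpace M] [ChartedSpace H M] [IsManifold I ∞ M]

variable (I M) in
/-- Smooth Riemannian metrics on the manifold `M`. -/
abbrev Metric := ContMDiffRiemannianMetric I ∞ E (fun x : M => TangentSpace I x)

/-- The differential at the coordinate point `y` of the inverse of the preferred chart at `x₀`. -/
def chartSymmDeriv (x₀ : M) (y : E) :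
    E →L[ℝ] TangentSpace I ((extChartAt I x₀).symm y) :=
  mfderiv 𝓘(ℝ, E) I (extChartAt I x₀).symm y

/-- The metric `g` in the coordinates of the preferred chart at `x₀`: at the coordinate point `y` it
is `g(A ·, A ·)` with `A` the differential of the inverse chart at `y` (every tangent space of `M`
is the model space `E` as a vector space). -/
def chartMetric (g : Metric I M) (x₀ : M) (y : E) : E →L[ℝ] E →L[ℝ] ℝ :=
  let B : E →L[ℝ] E →L[ℝ] ℝ := g.inner ((extChartAt I x₀).symm y)
  let A : E →L[ℝ] E := chartSymmDeriv (I := I) x₀ y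
  B.bilinearComp A A

/-- The Riemann curvature tensor at `x`, computed in the preferred chart at `x`; the tangent space
at `x` is identified with `E` through this very chart. -/
def curvature (g : Metric I M) (x : M) (u v w : TangentSpace I x) : TangentSpace I x :=
  localCurvature (E := E) (chartMetric g x) (extChartAt I x x) u v w

/-- The sectional curvature of the plane spanned by `u` and `v`. -/
def sectionalCurvature (g : Metric I M) (x : M) (u v : TangentSpace I x) : ℝ :=
  g.inner x (curvature g x u v v) u /
    (g.inner x u u * g.inner x v v - g.inner x u v ^ 2)

/-- The gradient of `ψ`: `g(∇ψ, ·) = dψ`. -/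
def gradient (g : Metric I M) (ψ : M → ℝ) (x : M) : TangentSpace I x :=
  (g.inner x).inverse (mfderiv I 𝓘(ℝ, ℝ) ψ x)

/-- The squared norm of the gradient of `ψ`. -/
def gradNormSq (g : Metric I M) (ψ : M → ℝ) (x : M) : ℝ :=
  g.inner x (gradient g ψ x) (gradient g ψ x)

/-- The Hessian `∇dψ` of `ψ` at `x`, in the preferred chart at `x`. -/
def hessian (g : Metric I M) (ψ : M → ℝ) (x : M) (u v : TangentSpace I x) : ℝ :=
  fderiv ℝ (fderiv ℝ (ψ ∘ (extChartAt I x).symm)) (extChartAt I x x) u v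
    - fderiv ℝ (ψ ∘ (extChartAt I x).symm) (extChartAt I x x)
        (christoffel (chartMetric g x) (extChartAt I x x) u v)

/-- The Laplacian with the sign `Δψ = ∑ᵢ ((∇_{eᵢ} eᵢ) ψ - eᵢ (eᵢ ψ)) = - div ∇ψ`. -/
def laplacian (g : Metric I M) (ψ : M → ℝ) (x : M) : ℝ :=
  -metricTrace (fun u v => g.inner x u v) (hessian g ψ x)

end Manifold

/-! ## Immersions into a Riemannian manifold -/

section Immersion

variable {E : Type*} [NormedAddCommGroup E] [NormedSpace ℝ E]
  {H : Type*} [TopologicalSpace H] {I : ModelWithCorners ℝ E H}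
  {M : Type*} [TopologicalSpace M] [ChartedSpace H M]
  {E' : Type*} [NormedAddCommGroup E'] [NormedSpace ℝ E']
  {H' : Type*} [TopologicalSpace H'] {J : ModelWithCorners ℝ E' H'}
  {N : Type*} [TopologicalSpace N] [ChartedSpace H' N] [IsManifold J ∞ N]

variable (I)

/-- The metric induced on `M` by `F : M → N` from the metric `g` of `N`. -/
def inducedMetric (g : Metric J N) (F : M → N) (x : M) (u v : TangentSpace I x) : ℝ :=
  g.inner (F x) (mfderiv I J F x u) (mfderiv I J F x v)

/-- The induced metric in the coordinates of the preferred charts at `x` and `F x`. -/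
def chartInducedMetric (g : Metric J N) (F : M → N) (x : M) (y : E) : E →L[ℝ] E →L[ℝ] ℝ :=
  (chartMetric g (F x) (writtenInExtChartAt I J x F y)).bilinearComp
    (fderiv ℝ (writtenInExtChartAt I J x F) y) (fderiv ℝ (writtenInExtChartAt I J x F) y)

/-- The second fundamental form of the immersion `F : M → N`, given by the Gauss formula
`h(X, Y) = ∇ᴺ_X dF(Y) - dF(∇ᴹ_X Y)`, where `∇ᴺ` is the Levi-Civita connection of the ambient metric
and `∇ᴹ` that of the induced metric, in the preferred charts at `x` and `F x`. -/
def secondFundamentalForm (g : Metric J N) (F : M → N) (x : M) (u v : TangentSpace I x) :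
    TangentSpace J (F x) :=
  let ψ : E → E' := writtenInExtChartAt I J x F
  let a : E := extChartAt I x x
  fderiv ℝ (fderiv ℝ ψ) a u v
    + christoffel (chartMetric g (F x)) (ψ a) (fderiv ℝ ψ a u) (fderiv ℝ ψ a v)
    - fderiv ℝ ψ a (christoffel (chartInducedMetric I g F x) a u v)

/-- `‖h‖² = ∑ᵢⱼ g(h(eᵢ, eⱼ), h(eᵢ, eⱼ))` over an orthonormal basis of the tangent space. -/
def secondFundamentalFormNormSq (g : Metric J N) (F : M → N) (x : M) : ℝ :=
  metricTrace (inducedMetric I g F x) fun u u' =>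
    metricTrace (inducedMetric I g F x) fun v v' =>
      g.inner (F x) (secondFundamentalForm I g F x u v) (secondFundamentalForm I g F x u' v')

/-- The mean curvature vector `(1 / n) ∑ᵢ h(eᵢ, eᵢ)`, where `n` is the dimension of `M`. -/
def meanCurvature (g : Metric J N) (F : M → N) (x : M) : TangentSpace J (F x) :=
  ((Module.finrank ℝ E : ℝ)⁻¹) •
    metricTrace (inducedMetric I g F x) (secondFundamentalForm I g F x)

/-- The immersion is totally geodesic: `h = 0`. -/
def IsTotallyGeodesic (g : Metric J N) (F : M → N) : Prop :=
  ∀ (x : M) (u v : TangentSpace I x), secondFundamentalForm I g F x u v = 0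

/-- The immersion is totally umbilical: `h(X, Y) = ⟨X, Y⟩ · (mean curvature vector)`. -/
def IsTotallyUmbilical (g : Metric J N) (F : M → N) : Prop :=
  ∀ (x : M) (u v : TangentSpace I x),
    secondFundamentalForm I g F x u v = inducedMetric I g F x u v • meanCurvature I g F x

/-- The immersion is minimal: the mean curvature vector vanishes. -/
def IsMinimal (g : Metric J N) (F : M → N) : Prop :=
  ∀ x : M, meanCurvature I g F x = 0

end Immersion

/-! ## Cosymplectic space forms -/

section Contact

variable {E : Type*} [NormedAddCommGroup E] [NormedSpace ℝ E]
  {H : Type*} [TopologicalSpace H] {I : ModelWithCorners ℝ E H}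
  {M : Type*} [TopologicalSpace M] [ChartedSpace H M] [IsManifold I ∞ M]

variable (I M) in
/-- An almost contact metric structure `(φ, ξ, η, g)`. -/
structure AlmostContactMetricStructure where
  /-- the Riemannian metric -/
  g : Metric I M
  /-- the `(1,1)`-tensor field `φ` -/
  phi : ∀ x : M, TangentSpace I x →L[ℝ] TangentSpace I x
  /-- the characteristic vector field -/
  xi : ∀ x : M, TangentSpace I x
  /-- the contact form -/
  eta : ∀ x : M, TangentSpace I x →L[ℝ] ℝ
  phi_smooth : ContMDiff I (I.prod 𝓘(ℝ, E →L[ℝ] E)) ∞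
    (fun x => TotalSpace.mk' (E →L[ℝ] E)
      (E := fun x : M => TangentSpace I x →L[ℝ] TangentSpace I x) x (phi x))
  xi_smooth : ContMDiff I (I.prod 𝓘(ℝ, E)) ∞
    (fun x => TotalSpace.mk' E (E := fun x : M => TangentSpace I x) x (xi x))
  eta_smooth : ContMDiff I (I.prod 𝓘(ℝ, E →L[ℝ] ℝ)) ∞
    (fun x => TotalSpace.mk' (E →L[ℝ] ℝ)
      (E := fun x : M => TangentSpace I x →L[ℝ] ℝ) x (eta x))
  phi_phi : ∀ x u, phi x (phi x u) = -u + eta x u • xi x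
  eta_xi : ∀ x, eta x (xi x) = 1
  g_phi_phi : ∀ x u v, g.inner x (phi x u) (phi x v) = g.inner x u v - eta x u * eta x v

/-- The tensor field `φ` in the coordinates of the preferred chart at `x₀`. -/
def AlmostContactMetricStructure.chartPhi (S : AlmostContactMetricStructure I M) (x₀ : M) (y : E) :
    E →L[ℝ] E :=
  (show TangentSpace I ((extChartAt I x₀).symm y) →L[ℝ] E from
      mfderiv I 𝓘(ℝ, E) (extChartAt I x₀) ((extChartAt I x₀).symm y)) ∘L
    (S.phi ((extChartAt I x₀).symm y)) ∘L (chartSymmDeriv (I := I) x₀ y)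

/-- The structure is cosymplectic: `∇φ = 0`, that is
`(∇_u φ) v = (∂_u φ) v + Γ(u, φ v) - φ Γ(u, v) = 0` in every preferred chart. -/
def AlmostContactMetricStructure.IsCosymplectic (S : AlmostContactMetricStructure I M) : Prop :=
  ∀ (x₀ : M), ∀ y ∈ (extChartAt I x₀).target, ∀ u v : E,
    fderiv ℝ (S.chartPhi x₀) y u v
      + christoffel (chartMetric S.g x₀) y u (S.chartPhi x₀ y v)
      - S.chartPhi x₀ y (christoffel (chartMetric S.g x₀) y u v) = 0

/-- The structure is a cosymplectic space form of constant `φ`-sectional curvature `c`: it is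
cosymplectic and every plane spanned by `X` and `φ X`, with `X ≠ 0` orthogonal to `ξ`, has sectional
curvature `c`. -/
def AlmostContactMetricStructure.IsCosymplecticSpaceForm
    (S : AlmostContactMetricStructure I M) (c : ℝ) : Prop :=
  S.IsCosymplectic ∧
    ∀ (x : M) (u : TangentSpace I x), u ≠ 0 → S.g.inner x u (S.xi x) = 0 →
      sectionalCurvature S.g x u (S.phi x u) = c

end Contact

/-! ## Contact CR-warped product submanifolds -/

section Warped

variable {E₁ : Type*} [NormedAddCommGroup E₁] [NormedSpace ℝ E₁]
  {H₁ : Type*} [TopologicalSpace H₁] {I₁ : ModelWithCorners ℝ E₁ H₁}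
  {N₁ : Type*} [TopologicalSpace N₁] [ChartedSpace H₁ N₁] [IsManifold I₁ ∞ N₁]
  {E₂ : Type*} [NormedAddCommGroup E₂] [NormedSpace ℝ E₂]
  {H₂ : Type*} [TopologicalSpace H₂] {I₂ : ModelWithCorners ℝ E₂ H₂}
  {N₂ : Type*} [TopologicalSpace N₂] [ChartedSpace H₂ N₂] [IsManifold I₂ ∞ N₂]
  {E : Type*} [NormedAddCommGroup E] [NormedSpace ℝ E]
  {H : Type*} [TopologicalSpace H] {I : ModelWithCorners ℝ E H}
  {M : Type*} [TopologicalSpace M] [ChartedSpace H M] [IsManifold I ∞ M]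

/-- The warped product metric `π₁^* g₁ + (f ∘ π₁)² π₂^* g₂` on `N₁ × N₂`. -/
def warpedMetric (g₁ : Metric I₁ N₁) (g₂ : Metric I₂ N₂) (f : N₁ → ℝ) (x : N₁ × N₂)
    (u v : TangentSpace (I₁.prod I₂) x) : ℝ :=
  g₁.inner x.1 (mfderiv (I₁.prod I₂) I₁ Prod.fst x u) (mfderiv (I₁.prod I₂) I₁ Prod.fst x v)
    + f x.1 ^ 2 *
      g₂.inner x.2 (mfderiv (I₁.prod I₂) I₂ Prod.snd x u) (mfderiv (I₁.prod I₂) I₂ Prod.snd x v)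

/-- `F : N₁ ×_f N₂ → M` is an isometric immersion of a contact CR-warped product submanifold (with
`N₁` the factor `N_T` and `N₂` the factor `N_⊥`) into the almost contact metric manifold `(M, S)`,
with `ξ` tangent to `N_T`. -/
structure IsContactCRWarpedProduct (S : AlmostContactMetricStructure I M)
    (g₁ : Metric I₁ N₁) (g₂ : Metric I₂ N₂) (f : N₁ → ℝ) (F : N₁ × N₂ → M) : Prop where
  warping_smooth : ContMDiff I₁ 𝓘(ℝ, ℝ) ∞ f
  warping_pos : ∀ p, 0 < f p
  smooth : ContMDiff (I₁.prod I₂) I ∞ F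
  isometric : ∀ (x : N₁ × N₂) (u v : TangentSpace (I₁.prod I₂) x),
    inducedMetric (I₁.prod I₂) S.g F x u v = warpedMetric g₁ g₂ f x u v
  /-- `ξ` is tangent to `N_T` -/
  xi_tangent : ∀ p q, ∃ u : TangentSpace I₁ p,
    mfderiv I₁ I (fun p' => F (p', q)) p u = S.xi (F (p, q))
  /-- `N_T` is invariant: `φ (T N_T) ⊆ T N_T` -/
  invariant : ∀ p q, ∀ u : TangentSpace I₁ p, ∃ u' : TangentSpace I₁ p,
    mfderiv I₁ I (fun p' => F (p', q)) p u' =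
      S.phi (F (p, q)) (mfderiv I₁ I (fun p' => F (p', q)) p u)
  /-- `N_⊥` is anti-invariant: `φ (T N_⊥)` is orthogonal to the submanifold -/
  antiInvariant : ∀ p q, ∀ (v : TangentSpace I₂ q) (w : TangentSpace (I₁.prod I₂) (p, q)),
    S.g.inner (F (p, q)) (S.phi (F (p, q)) (mfderiv I₂ I (fun q' => F (p, q')) q v))
      (mfderiv (I₁.prod I₂) I F (p, q) w) = 0

end Warped

end CRWarped

end

/-!
# The second fundamental form of contact CR-warped products in cosymplectic space forms

Everything is computed in charts. There the ambient space is an open set with a metric `G` and a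
parallel endomorphism field `Φ`, and the submanifold is a map `ψ` of a product of two open sets that
pulls `G` back to a warped product metric `G₁ + ρ G₂` with `ρ = f²` (`IsLocalCRWarped`). Write `X`,
`Y` for vectors tangent to the first factor, `Z`, `W` for vectors tangent to the second one, and
`∇` for the ambient connection along `ψ` (`covDeriv`, `covHess`).

The squared norm `‖h‖²` is the sum of the contributions of the `h(X, Y)`, of the `h(Z, W)`, and
twice that of the `h(X, Z)` (`sffNormSq_eq`). The last contribution is determined by `f` and `c`,
and it is the right-hand side of the inequality. Indeed, the tangential part of `∇_X Z` is
`X(ln f) Z`, so `|h(X, Z)|² = |∇_X Z|² - X(ln f)² |Z|²`, and `|∇_X Z|²` is found from a curvature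
component. As `φ` is parallel, so is its restriction `P` to the first factor, and
`∇_{PX} Z = φ ∇_X Z`. Hence `⟨∇_X Z, φ Z⟩` is a derivative of the warping function, and by
differentiating it once more (`inner_covDeriv_covHess`), `⟨R(X, φX) Z, φZ⟩` is expressed by the
Hessian of `ρ` at `(X, X)` and `(PX, PX)` and by `|∇_X Z|²`
(`IsLocalCRWarped.inner_localCurvature`). On the other hand, the curvature of a cosymplectic
structure has Kähler symmetries, so constancy of the `φ`-sectional curvature gives, by polarization,
`⟨R(X, φX) Z, φZ⟩ = -(c / 2) |X|² |Z|²` for `X` orthogonal to `ξ`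
(`IsLocalCosymplectic.inner_localCurvature`). Since `f` is constant along `ξ` and `P` is parallel,
the Hessian of `ρ` and its transform by `P` have equal traces, and the sum over orthonormal bases
is `n₂ (‖∇ ln f‖² - Δ ln f + (n₁ - 1) c / 4)` (`sum_inner_sff_fst_snd`).

Equality therefore means `h(X, Y) = 0` and `h(Z, W) = 0`. The first factor is totally geodesic in a
warped product, so the former says that its leaves are totally geodesic in the ambient space. The
second fundamental form of a leaf of the second factor is `h(Z, W) - ⟨Z, W⟩ ∇ ln f`; this is
umbilical if and only if `h` is, on the second factor, a vector times the metric, and minimality of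
the submanifold then forces this vector to vanish (`sff_eq_zero_iff`).
-/

-- instances on spaces of iterated continuous linear maps are nested deeply
set_option maxSynthPendingDepth 3
set_option linter.unusedSectionVars false

noncomputable section

namespace CRWarped

/-! ### Traces over orthonormal bases -/

section Trace

variable {V W ι : Type*} [AddCommGroup V] [Module ℝ V] [AddCommGroup W] [Module ℝ W]
  [DecidableEq ι]

theorem IsOrthonormalBasis.apply_eq {B : V →ₗ[ℝ] V →ₗ[ℝ] ℝ} {b : Module.Basis ι ℝ V}
    (hb : IsOrthonormalBasis (fun u v => B u v) b) (i j : ι) :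
    B (b i) (b j) = if i = j then 1 else 0 := hb i j

section Sum

variable [Fintype ι]

theorem IsOrthonormalBasis.sum_smul_eq {B : V →ₗ[ℝ] V →ₗ[ℝ] ℝ} {b : Module.Basis ι ℝ V}
    (hb : IsOrthonormalBasis (fun u v => B u v) b) (v : V) : ∑ i, B (b i) v • b i = v := by
  have h : ∀ i, B (b i) v = b.repr v i := fun i => by
    have := congrArg (B (b i)) (b.sum_repr v)
    simpa [hb.apply_eq, -Module.Basis.sum_repr] using this.symm
  simp [h, b.sum_repr]

theorem IsOrthonormalBasis.apply_eq_sum {B : V →ₗ[ℝ] V →ₗ[ℝ] ℝ} {b : Module.Basis ι ℝ V}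
    (hb : IsOrthonormalBasis (fun u v => B u v) b) (T : V →ₗ[ℝ] W) (v : V) :
    T v = ∑ i, B (b i) v • T (b i) := by
  have := congrArg T (hb.sum_smul_eq v)
  simpa using this.symm

theorem IsOrthonormalBasis.symm {B : V →ₗ[ℝ] V →ₗ[ℝ] ℝ} {b : Module.Basis ι ℝ V}
    (hb : IsOrthonormalBasis (fun u v => B u v) b) (u v : V) : B u v = B v u := by
  have h : ∀ u i, B u (b i) = B (b i) u := fun u i => by
    have := hb.apply_eq_sum (B.flip (b i)) u
    simpa [hb.apply_eq] using this
  rw [hb.apply_eq_sum (B u) v, hb.apply_eq_sum (B v) u]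
  simp [h, mul_comm]

/-- The sum `∑ᵢ T(eᵢ, eᵢ)` is the same for all orthonormal bases. -/
theorem IsOrthonormalBasis.sum_eq_sum {κ : Type*} [Fintype κ] [DecidableEq κ]
    {B : V →ₗ[ℝ] V →ₗ[ℝ] ℝ} {b : Module.Basis ι ℝ V}
    (hb : IsOrthonormalBasis (fun u v => B u v) b) {c : Module.Basis κ ℝ V}
    (hc : IsOrthonormalBasis (fun u v => B u v) c) (T : V →ₗ[ℝ] V →ₗ[ℝ] W) :
    ∑ i, T (b i) (b i) = ∑ j, T (c j) (c j) := by
  have key : ∀ i, T (b i) (b i) = ∑ j, B (c j) (b i) • T (b i) (c j) :=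
    fun i => hc.apply_eq_sum (T (b i)) (b i)
  have key' : ∀ j, T (c j) (c j) = ∑ i, B (b i) (c j) • T (b i) (c j) :=
    fun j => hb.apply_eq_sum (T.flip (c j)) (c j)
  simp only [key, key']
  rw [Finset.sum_comm]
  simp only [hb.symm]

/-- `metricTrace` chooses a basis indexed by `Fin (finrank ℝ V)`; any orthonormal basis gives the
same value. -/
theorem metricTrace_eq_sum {B : V →ₗ[ℝ] V →ₗ[ℝ] ℝ} {b : Module.Basis ι ℝ V}
    (hb : IsOrthonormalBasis (fun u v => B u v) b) (T : V →ₗ[ℝ] V →ₗ[ℝ] W) :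
    metricTrace (fun u v => B u v) (fun u v => T u v) = ∑ i, T (b i) (b i) := by
  have e : ∃ c : Module.Basis (Fin (Module.finrank ℝ V)) ℝ V,
      IsOrthonormalBasis (fun u v => B u v) c := by
    refine ⟨b.reindex (Fintype.equivFinOfCardEq (Module.finrank_eq_card_basis b).symm), ?_⟩
    intro i j
    simp [hb.apply_eq]
  classical
  rw [metricTrace, dif_pos (by convert e)]
  · convert (hb.sum_eq_sum (c := e.choose) e.choose_spec T).symm

end Sum

/-- A positive definite symmetric form on a finite-dimensional space has an orthonormal basis. -/
theorem exists_isOrthonormalBasis [FiniteDimensional ℝ V] (B : V →ₗ[ℝ] V →ₗ[ℝ] ℝ)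
    (hs : ∀ u v, B u v = B v u) (hp : ∀ v, v ≠ 0 → 0 < B v v) :
    ∃ b : Module.Basis (Fin (Module.finrank ℝ V)) ℝ V, IsOrthonormalBasis (fun u v => B u v) b := by
  obtain ⟨v, hv⟩ := LinearMap.BilinForm.exists_orthogonal_basis (B := B) ⟨fun u w => hs u w⟩
  have hpos : ∀ i, 0 < B (v i) (v i) := fun i => hp _ (v.ne_zero i)
  refine ⟨v.isUnitSMul (w := fun i => (Real.sqrt (B (v i) (v i)))⁻¹) (fun i => ?_), ?_⟩
  · exact (inv_ne_zero (Real.sqrt_ne_zero'.2 (hpos i))).isUnit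
  · intro i j
    simp only [Module.Basis.isUnitSMul_apply, map_smul, LinearMap.smul_apply, smul_eq_mul]
    split_ifs with h
    · subst h
      have := Real.mul_self_sqrt (hpos i).le
      have h0 := Real.sqrt_ne_zero'.2 (hpos i)
      field_simp
      nlinarith
    · have : B (v i) (v j) = 0 := hv h
      simp [this]

/-- Orthonormal bases of two orthogonal factors form an orthonormal basis of the product. -/
theorem IsOrthonormalBasis.prod {V₂ κ : Type*} [AddCommGroup V₂] [Module ℝ V₂]
    [DecidableEq κ] {B₁ : V → V → ℝ} {B₂ : V₂ → V₂ → ℝ}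
    {b : Module.Basis ι ℝ V} {c : Module.Basis κ ℝ V₂}
    (hb : IsOrthonormalBasis B₁ b) (hc : IsOrthonormalBasis B₂ c) {B : V × V₂ → V × V₂ → ℝ}
    (h₁ : ∀ u v, B (u, 0) (v, 0) = B₁ u v) (h₂ : ∀ u v, B (0, u) (0, v) = B₂ u v)
    (h₃ : ∀ u v, B (u, 0) (0, v) = 0) (h₄ : ∀ u v, B (0, v) (u, 0) = 0) :
    IsOrthonormalBasis B (b.prod c) := by
  rintro (i | i) (j | j)
  · have := hb i j
    simp_all [Module.Basis.prod_apply]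
  · simp_all [Module.Basis.prod_apply]
  · simp_all [Module.Basis.prod_apply]
  · have := hc i j
    simp_all [Module.Basis.prod_apply]

end Trace

/-! ### The Levi-Civita connection of a metric on an open set -/

section LocalMetric

variable {V : Type*} [NormedAddCommGroup V] [NormedSpace ℝ V]

/-- `G` is a smooth Riemannian metric on the open set `U`. -/
structure IsLocalMetric (G : V → V →L[ℝ] V →L[ℝ] ℝ) (U : Set V) : Prop where
  isOpen : IsOpen U
  contDiffOn : ContDiffOn ℝ ∞ G U
  symm : ∀ y ∈ U, ∀ u v, G y u v = G y v u
  pos : ∀ y ∈ U, ∀ v, v ≠ 0 → 0 < G y v v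

theorem isInvertible_of_pos [FiniteDimensional ℝ V] {B : V →L[ℝ] V →L[ℝ] ℝ}
    (hB : ∀ v, v ≠ 0 → 0 < B v v) : B.IsInvertible := by
  have hinj : Function.Injective (B : V →ₗ[ℝ] (V →L[ℝ] ℝ)) := by
    rw [← LinearMap.ker_eq_bot, LinearMap.ker_eq_bot']
    intro v hv
    by_contra h
    have h1 := hB v h
    have h2 : B v = 0 := hv
    simp [h2] at h1
  have hd : Module.finrank ℝ V = Module.finrank ℝ (V →L[ℝ] ℝ) := by
    rw [← (LinearMap.toContinuousLinearMap : (V →ₗ[ℝ] ℝ) ≃ₗ[ℝ] (V →L[ℝ] ℝ)).finrank_eq]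
    exact Subspace.dual_finrank_eq.symm
  refine ⟨(LinearEquiv.ofInjectiveOfFinrankEq (B : V →ₗ[ℝ] (V →L[ℝ] ℝ)) hinj
    hd).toContinuousLinearEquiv, ?_⟩
  ext v w
  rfl

theorem apply_inverse_of_pos [FiniteDimensional ℝ V] {B : V →L[ℝ] V →L[ℝ] ℝ}
    (hB : ∀ v, v ≠ 0 → 0 < B v v) (l : V →L[ℝ] ℝ) : B (B.inverse l) = l :=
  (((isInvertible_of_pos hB).inverse_apply_eq).1 rfl).symm

theorem eq_of_apply_eq {B : V →L[ℝ] V →L[ℝ] ℝ} (hB : ∀ v, v ≠ 0 → 0 < B v v) {u v : V}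
    (h : ∀ w, B u w = B v w) : u = v := by
  by_contra hne
  have := hB (u - v) (sub_ne_zero.2 hne)
  simp [h] at this

theorem eq_zero_of_apply_self {B : V →L[ℝ] V →L[ℝ] ℝ} (hB : ∀ v, v ≠ 0 → 0 < B v v) {u : V}
    (h : B u u = 0) : u = 0 := by
  by_contra hne
  exact (hB u hne).ne' h

theorem apply_self_nonneg {B : V →L[ℝ] V →L[ℝ] ℝ} (hB : ∀ v, v ≠ 0 → 0 < B v v) (u : V) :
    0 ≤ B u u := by
  rcases eq_or_ne u 0 with rfl | h
  · simp
  · exact (hB u h).le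

/-- The right-hand side of Koszul's formula, as a bilinear map with values in the dual space. -/
def koszulForm (D : V →L[ℝ] V →L[ℝ] V →L[ℝ] ℝ) : V →L[ℝ] V →L[ℝ] V →L[ℝ] ℝ :=
  (1 / 2 : ℝ) • (D + D.flip -
    (ContinuousLinearMap.flipₗᵢ ℝ V V ℝ : (V →L[ℝ] V →L[ℝ] ℝ) →L[ℝ] (V →L[ℝ] V →L[ℝ] ℝ)) ∘L D.flip)

/-- The Christoffel symbols as a continuous bilinear map. -/
def christoffelL (G : V → V →L[ℝ] V →L[ℝ] ℝ) (y : V) : V →L[ℝ] V →L[ℝ] V :=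
  (ContinuousLinearMap.compL ℝ V (V →L[ℝ] ℝ) V (G y).inverse) ∘L koszulForm (fderiv ℝ G y)

theorem christoffelL_apply (G : V → V →L[ℝ] V →L[ℝ] ℝ) (y u v : V) :
    christoffelL G y u v = christoffel G y u v := by
  simp [christoffelL, koszulForm, christoffel]

@[simp]
theorem christoffel_zero_left (G : V → V →L[ℝ] V →L[ℝ] ℝ) (y v : V) : christoffel G y 0 v = 0 := by
  simp [← christoffelL_apply]

@[simp]
theorem christoffel_zero_right (G : V → V →L[ℝ] V →L[ℝ] ℝ) (y u : V) :
    christoffel G y u 0 = 0 := by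
  simp [← christoffelL_apply]

namespace IsLocalMetric

variable {G : V → V →L[ℝ] V →L[ℝ] ℝ} {U : Set V}

theorem contDiffAt (hG : IsLocalMetric G U) {y : V} (hy : y ∈ U) : ContDiffAt ℝ ∞ G y :=
  hG.contDiffOn.contDiffAt (hG.isOpen.mem_nhds hy)

theorem differentiableAt (hG : IsLocalMetric G U) {y : V} (hy : y ∈ U) : DifferentiableAt ℝ G y :=
  (hG.contDiffAt hy).differentiableAt (by simp)

theorem fderiv_symm (hG : IsLocalMetric G U) {y : V} (hy : y ∈ U) (u v w : V) :
    fderiv ℝ G y u v w = fderiv ℝ G y u w v := by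
  have h1 : ∀ v w, HasFDerivAt (fun z => G z v w)
      (((ContinuousLinearMap.apply ℝ ℝ w).comp (ContinuousLinearMap.apply ℝ _ v)).comp
        (fderiv ℝ G y)) y := fun v w =>
    ((ContinuousLinearMap.apply ℝ ℝ w).comp
      (ContinuousLinearMap.apply ℝ (V →L[ℝ] ℝ) v)).hasFDerivAt.comp y
        (hG.differentiableAt hy).hasFDerivAt
  have h2 : (fun z => G z v w) =ᶠ[nhds y] fun z => G z w v :=
    Filter.eventually_of_mem (hG.isOpen.mem_nhds hy) fun z hz => hG.symm z hz v w
  have := ((h1 v w).congr_of_eventuallyEq h2.symm).unique (h1 w v)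
  exact DFunLike.congr_fun this u

variable [FiniteDimensional ℝ V]

theorem contDiffOn_christoffelL (hG : IsLocalMetric G U) :
    ContDiffOn ℝ ∞ (christoffelL G) U := by
  intro y hy
  apply ContDiffAt.contDiffWithinAt
  have h1 : ContDiffAt ℝ ∞ (fun y => (G y).inverse) y :=
    ((isInvertible_of_pos (hG.pos y hy)).contDiffAt_map_inverse).comp y (hG.contDiffAt hy)
  have h2 : ContDiffAt ℝ ∞ (fderiv ℝ G) y := (hG.contDiffAt hy).fderiv_right (m := ∞) (by simp)
  have h3 : ContDiffAt ℝ ∞ (fun y => (fderiv ℝ G y).flip) y :=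
    (ContinuousLinearMap.flipₗᵢ ℝ V V (V →L[ℝ] ℝ)).contDiff.contDiffAt.comp y h2
  have h5 : ContDiffAt ℝ ∞ (fun y => (ContinuousLinearMap.flipₗᵢ ℝ V V ℝ :
      (V →L[ℝ] V →L[ℝ] ℝ) →L[ℝ] (V →L[ℝ] V →L[ℝ] ℝ)) ∘L (fderiv ℝ G y).flip) y :=
    contDiffAt_const.clm_comp h3
  have h4 : ContDiffAt ℝ ∞ (fun y => koszulForm (fderiv ℝ G y)) y :=
    ((h2.add h3).sub h5).const_smul (1 / 2 : ℝ)
  unfold christoffelL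
  exact ((ContinuousLinearMap.compL ℝ V (V →L[ℝ] ℝ) V).contDiff.contDiffAt.comp y h1).clm_comp h4

/-- Koszul's formula. -/
theorem inner_christoffel (hG : IsLocalMetric G U) {y : V} (hy : y ∈ U) (u v w : V) :
    G y (christoffel G y u v) w =
      (fderiv ℝ G y u v w + fderiv ℝ G y v u w - fderiv ℝ G y w u v) / 2 := by
  rw [christoffel, apply_inverse_of_pos (hG.pos y hy)]
  simp
  ring

theorem christoffel_symm (hG : IsLocalMetric G U) {y : V} (hy : y ∈ U) (u v : V) :
    christoffel G y u v = christoffel G y v u := by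
  apply eq_of_apply_eq (hG.pos y hy)
  intro w
  rw [hG.inner_christoffel hy, hG.inner_christoffel hy, hG.fderiv_symm hy w u v]
  ring

/-- The Levi-Civita connection is metric. -/
theorem fderiv_eq (hG : IsLocalMetric G U) {y : V} (hy : y ∈ U) (u v w : V) :
    fderiv ℝ G y u v w = G y (christoffel G y u v) w + G y v (christoffel G y u w) := by
  rw [hG.symm y hy v, hG.inner_christoffel hy, hG.inner_christoffel hy, hG.fderiv_symm hy w u v,
    hG.fderiv_symm hy u w v, hG.fderiv_symm hy v u w]
  ring

end IsLocalMetric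

end LocalMetric

section Along

variable {E V : Type*} [NormedAddCommGroup E] [NormedSpace ℝ E]
  [NormedAddCommGroup V] [NormedSpace ℝ V]

/-- The covariant derivative at `y` in the direction `u` of the vector field `W` along the map `ψ`,
for the Levi-Civita connection of the metric `G` on the target of `ψ`. -/
def covDeriv (G : V → V →L[ℝ] V →L[ℝ] ℝ) (ψ W : E → V) (y u : E) : V :=
  fderiv ℝ W y u + christoffel G (ψ y) (fderiv ℝ ψ y u) (W y)

/-- The covariant second derivative of `ψ`: the covariant derivative in the direction `u` of the
vector field `dψ(v)` along `ψ`. -/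
def covHess (G : V → V →L[ℝ] V →L[ℝ] ℝ) (ψ : E → V) (y u v : E) : V :=
  fderiv ℝ (fderiv ℝ ψ) y u v + christoffel G (ψ y) (fderiv ℝ ψ y u) (fderiv ℝ ψ y v)

variable {G : V → V →L[ℝ] V →L[ℝ] ℝ} {U : Set V} {ψ : E → V} {y : E}

theorem covDeriv_congr {W W' : E → V} (h : W =ᶠ[nhds y] W') (u : E) :
    covDeriv G ψ W y u = covDeriv G ψ W' y u := by
  rw [covDeriv, covDeriv, h.fderiv_eq, h.eq_of_nhds]

theorem fderiv_apply_const {F : Type*} [NormedAddCommGroup F] [NormedSpace ℝ F]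
    {A : E → F →L[ℝ] V} (hA : DifferentiableAt ℝ A y) (v : F) (u : E) :
    fderiv ℝ (fun z => A z v) y u = fderiv ℝ A y u v := by
  have := hA.hasFDerivAt.clm_apply (hasFDerivAt_const v y)
  rw [this.fderiv]
  simp

theorem contDiffAt_fderiv (hψ : ContDiffAt ℝ ∞ ψ y) : ContDiffAt ℝ ∞ (fderiv ℝ ψ) y :=
  hψ.fderiv_right (m := ∞) (by simp)

theorem contDiffAt_fderiv_apply (hψ : ContDiffAt ℝ ∞ ψ y) (v : E) :
    ContDiffAt ℝ ∞ (fun z => fderiv ℝ ψ z v) y :=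
  (contDiffAt_fderiv hψ).clm_apply contDiffAt_const

theorem fderiv_fderiv_symm (hψ : ContDiffAt ℝ ∞ ψ y) (u v : E) :
    fderiv ℝ (fderiv ℝ ψ) y u v = fderiv ℝ (fderiv ℝ ψ) y v u :=
  (hψ.isSymmSndFDerivAt (by
    rw [minSmoothness_of_isRCLikeNormedField]
    exact WithTop.coe_le_coe.2 (le_top : (2 : ℕ∞) ≤ ⊤))) u v

theorem covDeriv_fderiv (hψ : ContDiffAt ℝ ∞ ψ y) (u v : E) :
    covDeriv G ψ (fun z => fderiv ℝ ψ z v) y u = covHess G ψ y u v := by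
  rw [covDeriv, covHess, fderiv_apply_const ((contDiffAt_fderiv hψ).differentiableAt (by simp))]

/-- The derivative of an endomorphism field applied to a vector field along `ψ`. -/
theorem covDeriv_clm_apply {Φ : V → V →L[ℝ] V} (hψ : DifferentiableAt ℝ ψ y)
    (hΦ : DifferentiableAt ℝ Φ (ψ y))
    (hpar : ∀ u v, fderiv ℝ Φ (ψ y) u v + christoffel G (ψ y) u (Φ (ψ y) v)
      - Φ (ψ y) (christoffel G (ψ y) u v) = 0)
    {W : E → V} (hW : DifferentiableAt ℝ W y) (u : E) :
    covDeriv G ψ (fun z => Φ (ψ z) (W z)) y u = Φ (ψ y) (covDeriv G ψ W y u) := by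
  have h := ((hΦ.hasFDerivAt.comp y hψ.hasFDerivAt).clm_apply hW.hasFDerivAt).fderiv
  simp only [Function.comp_apply] at h
  rw [covDeriv, h]
  have := hpar (fderiv ℝ ψ y u) (W y)
  simp only [add_apply, ContinuousLinearMap.comp_apply,
    ContinuousLinearMap.flip_apply, covDeriv, map_add]
  rw [← sub_eq_zero, ← this]
  abel

variable [FiniteDimensional ℝ V]

theorem covHess_symm (hG : IsLocalMetric G U) (hy : ψ y ∈ U) (hψ : ContDiffAt ℝ ∞ ψ y) (u v : E) :
    covHess G ψ y u v = covHess G ψ y v u := by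
  rw [covHess, covHess, hG.christoffel_symm hy, fderiv_fderiv_symm hψ]

/-- The product rule for the metric and covariant derivatives along `ψ`. -/
theorem fderiv_inner (hG : IsLocalMetric G U) (hy : ψ y ∈ U) (hψ : DifferentiableAt ℝ ψ y)
    {W W' : E → V} (hW : DifferentiableAt ℝ W y) (hW' : DifferentiableAt ℝ W' y) (u : E) :
    fderiv ℝ (fun z => G (ψ z) (W z) (W' z)) y u =
      G (ψ y) (covDeriv G ψ W y u) (W' y) + G (ψ y) (W y) (covDeriv G ψ W' y u) := by
  have h := (((hG.differentiableAt hy).hasFDerivAt.comp y hψ.hasFDerivAt).clm_apply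
    hW.hasFDerivAt).clm_apply hW'.hasFDerivAt
  have h' := h.fderiv
  simp only [Function.comp_apply] at h'
  rw [h']
  simp only [add_apply, ContinuousLinearMap.comp_apply,
    ContinuousLinearMap.flip_apply, hG.fderiv_eq hy, covDeriv, map_add]
  ring

theorem differentiableAt_christoffelL (hG : IsLocalMetric G U) {z : V} (hz : z ∈ U) :
    DifferentiableAt ℝ (christoffelL G) z :=
  (hG.contDiffOn_christoffelL.contDiffAt (hG.isOpen.mem_nhds hz)).differentiableAt (by simp)

theorem contDiffAt_covDeriv (hG : IsLocalMetric G U) (hy : ψ y ∈ U) (hψ : ContDiffAt ℝ ∞ ψ y)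
    {W : E → V} (hW : ContDiffAt ℝ ∞ W y) (v : E) :
    ContDiffAt ℝ ∞ (fun z => covDeriv G ψ W z v) y := by
  simp only [covDeriv, ← christoffelL_apply]
  have h1 := (hG.contDiffOn_christoffelL.contDiffAt (hG.isOpen.mem_nhds hy)).comp y hψ
  exact (contDiffAt_fderiv_apply hW v).add
    ((h1.clm_apply (contDiffAt_fderiv_apply hψ v)).clm_apply hW)

/-- The curvature tensor is the commutator of covariant derivatives along `ψ`. -/
theorem covDeriv_covDeriv_sub (hG : IsLocalMetric G U) (hy : ψ y ∈ U) (hψ : ContDiffAt ℝ ∞ ψ y)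
    {W : E → V} (hW : ContDiffAt ℝ ∞ W y) (u v : E) :
    covDeriv G ψ (fun z => covDeriv G ψ W z v) y u - covDeriv G ψ (fun z => covDeriv G ψ W z u) y v
      = localCurvature G (ψ y) (fderiv ℝ ψ y u) (fderiv ℝ ψ y v) (W y) := by
  have hd : DifferentiableAt ℝ ψ y := hψ.differentiableAt (by simp)
  have hΓ := differentiableAt_christoffelL hG hy
  have hWd : DifferentiableAt ℝ W y := hW.differentiableAt (by simp)
  have key : ∀ v, HasFDerivAt (fun z => covDeriv G ψ W z v) _ y := fun v => by
    simp only [covDeriv, ← christoffelL_apply]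
    exact (((contDiffAt_fderiv hW).differentiableAt (by simp)).hasFDerivAt.clm_apply
      (hasFDerivAt_const v y)).add (((hΓ.hasFDerivAt.comp y hd.hasFDerivAt).clm_apply
      (((contDiffAt_fderiv hψ).differentiableAt (by simp)).hasFDerivAt.clm_apply
        (hasFDerivAt_const v y))).clm_apply hWd.hasFDerivAt)
  have hc : ∀ a b c : V, fderiv ℝ (fun z => christoffel G z b c) (ψ y) a
      = fderiv ℝ (christoffelL G) (ψ y) a b c := fun a b c => by
    simp only [← christoffelL_apply]
    rw [((hΓ.hasFDerivAt.clm_apply (hasFDerivAt_const b _)).clm_apply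
      (hasFDerivAt_const c _)).fderiv]
    simp
  rw [localCurvature, hc, hc]
  change fderiv ℝ (fun z => covDeriv G ψ W z v) y u + _
    - (fderiv ℝ (fun z => covDeriv G ψ W z u) y v + _) = _
  rw [(key v).fderiv, (key u).fderiv]
  simp only [covDeriv, ← christoffelL_apply, add_apply,
    ContinuousLinearMap.comp_apply, ContinuousLinearMap.flip_apply, Function.comp_apply, map_add,
    fderiv_fderiv_symm hψ v u, fderiv_fderiv_symm hW v u]
  simp
  abel

end Along

/-! ### Curvature tensors with Kähler symmetries -/

section CurvatureAlgebra

variable {V : Type*} [AddCommGroup V] [Module ℝ V]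

/-- The algebraic symmetries of the `(0,4)` curvature tensor `T(x, y, z, w) = ⟨R(x, y) z, w⟩` of a
connection that also makes an endomorphism `J` parallel. -/
structure IsKaehlerCurvature (T : V →ₗ[ℝ] V →ₗ[ℝ] V →ₗ[ℝ] V →ₗ[ℝ] ℝ) (J : V →ₗ[ℝ] V) : Prop where
  skew_left : ∀ x y z w, T x y z w = -T y x z w
  skew_right : ∀ x y z w, T x y z w = -T x y w z
  bianchi : ∀ x y z w, T x y z w + T y z x w + T z x y w = 0
  invariant : ∀ x y z w, T x y (J z) (J w) = T x y z w

namespace IsKaehlerCurvature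

variable {T : V →ₗ[ℝ] V →ₗ[ℝ] V →ₗ[ℝ] V →ₗ[ℝ] ℝ} {J : V →ₗ[ℝ] V}

theorem pair_symm (h : IsKaehlerCurvature T J) (x y z w : V) : T x y z w = T z w x y := by
  linarith [h.bianchi x y z w, h.bianchi y z w x, h.bianchi z w x y, h.bianchi w x y z,
    h.skew_left x y z w, h.skew_left y z w x, h.skew_left z w x y, h.skew_left w x y z,
    h.skew_left x z y w, h.skew_left y w z x,
    h.skew_right x y z w, h.skew_right y z x w, h.skew_right z x y w, h.skew_right w y z x,
    h.skew_right z w x y, h.skew_right w x y z, h.skew_right x z y w, h.skew_right y w z x,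
    h.skew_right y z w x, h.skew_right x w y z, h.skew_left z x y w, h.skew_left w y z x,
    h.skew_left x z w y, h.skew_right x z w y, h.skew_left y x w z, h.skew_left x w y z]

theorem invariant_left (h : IsKaehlerCurvature T J) (x y z w : V) :
    T (J x) (J y) z w = T x y z w := by
  rw [h.pair_symm, h.invariant, h.pair_symm]

/-- Polarization of `T(x, Jx, Jx, x) = c |x|⁴` at `x` and `z`. -/
theorem polarization (h : IsKaehlerCurvature T J) {c a b : ℝ} {x z : V}
    (hz : J (J z) = -z) (h₁ : T x (J x) (J x) x = c * a ^ 2)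
    (h₂ : T z (J z) (J z) z = c * b ^ 2)
    (h₃ : T (x + z) (J (x + z)) (J (x + z)) (x + z) = c * (a + b) ^ 2)
    (h₄ : T (x - z) (J (x - z)) (J (x - z)) (x - z) = c * (a + b) ^ 2) :
    T x z z x + 3 * T x (J z) (J z) x = c * (a * b) ∧
      T x (J x) (J z) z = T x z z x + T x (J z) (J z) x := by
  simp only [map_add, map_sub, LinearMap.add_apply, LinearMap.sub_apply] at h₃ h₄
  -- `T(x, Jz, ·, ·) = T(z, Jx, ·, ·)` since `J² z = -z`
  have e : ∀ u v, T x (J z) u v = T z (J x) u v := fun u v => by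
    have := h.invariant_left x (J z) u v
    rw [hz, map_neg, LinearMap.neg_apply, LinearMap.neg_apply] at this
    rw [← this, h.skew_left, neg_neg]
  have e1 := e (J z) x
  have e2 := e (J x) z
  have e3 : T x (J z) (J x) z = T x (J z) (J z) x := by
    linarith [h.pair_symm x (J z) (J x) z, h.skew_left (J x) z x (J z), e x (J z),
      h.skew_right x (J z) x (J z)]
  have e4 : T z (J z) (J x) x = T x (J x) (J z) z := by
    rw [h.pair_symm, h.skew_left, h.skew_right, neg_neg]
  have e5 := h.bianchi x (J x) (J z) z
  have e6 : T (J x) (J z) x z = - T x z z x := by rw [h.invariant_left, h.skew_right]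
  have e7 : T (J z) x (J x) z = - T x (J z) (J x) z := by rw [h.skew_left]
  exact ⟨by linarith, by linarith⟩

/-- If all the planes spanned by `x` and `Jx`, for `x` in a `J`-invariant subspace on which `J` is a
complex structure compatible with the inner product `B`, have curvature `c`, then
`T(x, Jx, Jz, z) = (c / 2) |x|² |z|²` for orthogonal complex lines spanned by `x` and `z`. -/
theorem apply_of_const (h : IsKaehlerCurvature T J) {B : V →ₗ[ℝ] V →ₗ[ℝ] ℝ} {D : Submodule ℝ V}
    (hB : ∀ u v, B u v = B v u) (hBJ : ∀ u ∈ D, B (J u) (J u) = B u u) (hD : ∀ u ∈ D, J u ∈ D)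
    (hJ : ∀ u ∈ D, J (J u) = -u) {c : ℝ} (hc : ∀ u ∈ D, T u (J u) (J u) u = c * B u u ^ 2)
    {x z : V} (hx : x ∈ D) (hz : z ∈ D) (hxz : B x z = 0) (hxJz : B x (J z) = 0) :
    T x (J x) (J z) z = c / 2 * (B x x * B z z) := by
  have hp : ∀ z, B x z = 0 → B (x + z) (x + z) = B x x + B z z := fun z hz => by
    simp [hz, hB z x]
  have hm : ∀ z, B x z = 0 → B (x - z) (x - z) = B x x + B z z := fun z hz => by
    simp [hz, hB z x]
  have h1 := h.polarization (hJ z hz) (hc x hx) (hc z hz)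
    (by rw [hc _ (D.add_mem hx hz), hp z hxz]) (by rw [hc _ (D.sub_mem hx hz), hm z hxz])
  have hz' := hD z hz
  have h2 := h.polarization (hJ _ hz') (hc x hx) (hc _ hz')
    (by rw [hc _ (D.add_mem hx hz'), hp _ hxJz]) (by rw [hc _ (D.sub_mem hx hz'), hm _ hxJz])
  have h3 := h2.1
  simp only [hJ z hz, hBJ z hz, map_neg, LinearMap.neg_apply, neg_neg] at h3
  rw [h1.2]
  linarith [h1.1]

end IsKaehlerCurvature

end CurvatureAlgebra

section LocalCurvature

variable {V : Type*} [NormedAddCommGroup V] [NormedSpace ℝ V]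
  {G : V → V →L[ℝ] V →L[ℝ] ℝ} {U : Set V} {y : V}

theorem localCurvature_skew_left (G : V → V →L[ℝ] V →L[ℝ] ℝ) (y u v w : V) :
    localCurvature G y u v w = -localCurvature G y v u w := by
  simp only [localCurvature]
  abel

variable [FiniteDimensional ℝ V]

theorem localCurvature_eq (hG : IsLocalMetric G U) (hy : y ∈ U) (u v w : V) :
    localCurvature G y u v w = fderiv ℝ (christoffelL G) y u v w - fderiv ℝ (christoffelL G) y v u w
      + christoffelL G y u (christoffelL G y v w) - christoffelL G y v (christoffelL G y u w) := by
  have hΓ := differentiableAt_christoffelL hG hy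
  have hc : ∀ a b c : V, fderiv ℝ (fun z => christoffel G z b c) y a
      = fderiv ℝ (christoffelL G) y a b c := fun a b c => by
    simp only [← christoffelL_apply]
    rw [((hΓ.hasFDerivAt.clm_apply (hasFDerivAt_const b _)).clm_apply
      (hasFDerivAt_const c _)).fderiv]
    simp
  simp only [localCurvature, hc, christoffelL_apply]

/-- The curvature tensor `⟨R(x, y) z, w⟩` as a multilinear map. -/
def curvatureForm (G : V → V →L[ℝ] V →L[ℝ] ℝ) (y : V) : V →ₗ[ℝ] V →ₗ[ℝ] V →ₗ[ℝ] V →ₗ[ℝ] ℝ :=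
  LinearMap.mk₂ ℝ (fun u v =>
    LinearMap.mk₂ ℝ (fun w t => G y (fderiv ℝ (christoffelL G) y u v w
      - fderiv ℝ (christoffelL G) y v u w + christoffelL G y u (christoffelL G y v w)
      - christoffelL G y v (christoffelL G y u w)) t)
      (fun _ _ _ => by simp; ring) (fun _ _ _ => by simp; ring)
      (fun _ _ _ => by simp; ring) (fun _ _ _ => by simp))
    (fun _ _ _ => by ext; simp; ring) (fun _ _ _ => by ext; simp; ring)
    (fun _ _ _ => by ext; simp; ring) (fun _ _ _ => by ext; simp; ring)

theorem curvatureForm_apply (hG : IsLocalMetric G U) (hy : y ∈ U) (u v w t : V) :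
    curvatureForm G y u v w t = G y (localCurvature G y u v w) t := by
  rw [localCurvature_eq hG hy]
  rfl

/-- The first Bianchi identity. -/
theorem localCurvature_bianchi (hG : IsLocalMetric G U) (hy : y ∈ U) (u v w : V) :
    localCurvature G y u v w + localCurvature G y v w u + localCurvature G y w u v = 0 := by
  have hs : ∀ u v w, fderiv ℝ (christoffelL G) y u v w = fderiv ℝ (christoffelL G) y u w v := by
    intro u v w
    have hΓ := differentiableAt_christoffelL hG hy
    have h1 : ∀ b c, HasFDerivAt (fun z => christoffelL G z b c) _ y := fun b c =>
      (hΓ.hasFDerivAt.clm_apply (hasFDerivAt_const b _)).clm_apply (hasFDerivAt_const c _)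
    have h2 : (fun z => christoffelL G z v w) =ᶠ[nhds y] fun z => christoffelL G z w v :=
      Filter.eventually_of_mem (hG.isOpen.mem_nhds hy) fun z hz => by
        simp only [christoffelL_apply, hG.christoffel_symm hz v w]
    have := DFunLike.congr_fun (((h1 v w).congr_of_eventuallyEq h2.symm).unique (h1 w v)) u
    simpa using this
  have hs' : ∀ u v, christoffelL G y u v = christoffelL G y v u := fun u v => by
    simp only [christoffelL_apply, hG.christoffel_symm hy u v]
  simp only [localCurvature_eq hG hy]
  rw [hs u v w, hs v w u, hs w u v, hs' v w, hs' u w, hs' u v]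
  abel

/-- `R(u, v)` is skew for the metric: the second derivatives of `G(w, w)`, for constant `w`,
commute. -/
theorem inner_localCurvature_self (hG : IsLocalMetric G U) (hy : y ∈ U) (u v w : V) :
    G y (localCurvature G y u v w) w = 0 := by
  have hid : ∀ z : V, ContDiffAt ℝ ∞ (id : V → V) z := fun z => contDiffAt_id
  have hW : ∀ z : V, ContDiffAt ℝ ∞ (fun _ : V => w) z := fun z => contDiffAt_const
  let N : V → ℝ := fun z => G z w w
  have hN : ContDiffAt ℝ ∞ N y :=
    ((hG.contDiffAt hy).clm_apply contDiffAt_const).clm_apply contDiffAt_const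
  have h1 : ∀ v, (fun z => fderiv ℝ N z v) =ᶠ[nhds y]
      fun z => 2 * G z (covDeriv G id (fun _ => w) z v) w := fun v =>
    Filter.eventually_of_mem (hG.isOpen.mem_nhds hy) fun z hz => by
      have := fderiv_inner (ψ := id) hG hz differentiableAt_id
        (differentiableAt_const w) (differentiableAt_const w) v
      simp only [id] at this ⊢
      simp only [N]
      rw [this, hG.symm z hz w]
      ring
  have h2 : ∀ u v, fderiv ℝ (fderiv ℝ N) y u v =
      2 * (G y (covDeriv G id (fun z => covDeriv G id (fun _ => w) z v) y u) w
        + G y (covDeriv G id (fun _ => w) y v) (covDeriv G id (fun _ => w) y u)) := fun u v => by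
    rw [← fderiv_apply_const ((contDiffAt_fderiv hN).differentiableAt (by simp)), (h1 v).fderiv_eq]
    have hd := ((contDiffAt_covDeriv hG (ψ := id) hy (hid y) (hW y) v).differentiableAt (by simp))
    have hd' : DifferentiableAt ℝ (fun z => G z (covDeriv G id (fun _ => w) z v) w) y :=
      ((hG.differentiableAt hy).clm_apply hd).clm_apply (differentiableAt_const w)
    rw [fderiv_const_mul hd']
    have := fderiv_inner (ψ := id) hG hy differentiableAt_id hd (differentiableAt_const w) u
    simp only [id] at this ⊢
    simp [this]
  have h3 := fderiv_fderiv_symm hN u v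
  rw [h2, h2, hG.symm y hy (covDeriv G id (fun _ => w) y v)] at h3
  have h4 := covDeriv_covDeriv_sub (ψ := id) hG hy (hid y) (hW y) u v
  simp only [fderiv_id, id, ContinuousLinearMap.id_apply] at h4
  rw [← h4, map_sub, sub_apply]
  linarith

/-- The curvature tensor commutes with a parallel endomorphism field. -/
theorem localCurvature_clm_apply (hG : IsLocalMetric G U) (hy : y ∈ U) {Φ : V → V →L[ℝ] V}
    (hΦ : ContDiffOn ℝ ∞ Φ U) (hpar : ∀ z ∈ U, ∀ u v, fderiv ℝ Φ z u v
      + christoffel G z u (Φ z v) - Φ z (christoffel G z u v) = 0) (u v w : V) :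
    localCurvature G y u v (Φ y w) = Φ y (localCurvature G y u v w) := by
  have hid : ∀ z : V, ContDiffAt ℝ ∞ (id : V → V) z := fun z => contDiffAt_id
  have hW : ∀ z : V, ContDiffAt ℝ ∞ (fun _ : V => w) z := fun z => contDiffAt_const
  have hΦa : ∀ z ∈ U, ContDiffAt ℝ ∞ Φ z := fun z hz => hΦ.contDiffAt (hG.isOpen.mem_nhds hz)
  have h1 := covDeriv_covDeriv_sub (ψ := id) hG hy (hid y)
    ((hΦa y hy).clm_apply (hW y)) u v
  have h2 := covDeriv_covDeriv_sub (ψ := id) hG hy (hid y) (hW y) u v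
  have h3 : ∀ v, (fun z => covDeriv G id (fun z => Φ z w) z v) =ᶠ[nhds y]
      fun z => Φ z (covDeriv G id (fun _ => w) z v) := fun v =>
    Filter.eventually_of_mem (hG.isOpen.mem_nhds hy) fun z hz =>
      covDeriv_clm_apply (ψ := id) differentiableAt_id
        ((hΦa z hz).differentiableAt (by simp)) (hpar z hz) (differentiableAt_const w) v
  have h4 : ∀ u v, covDeriv G id (fun z => covDeriv G id (fun z => Φ z w) z v) y u =
      Φ y (covDeriv G id (fun z => covDeriv G id (fun _ => w) z v) y u) := fun u v => by
    have := covDeriv_clm_apply (G := G) (ψ := id) differentiableAt_id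
        ((hΦa y hy).differentiableAt (by simp)) (hpar y hy)
        ((contDiffAt_covDeriv hG (ψ := id) hy (hid y) (hW y) v).differentiableAt (by simp)) u
    simp only [id] at this
    rw [← this, covDeriv_congr (h3 v)]
  simp only [fderiv_id, id, ContinuousLinearMap.id_apply] at h1 h2
  rw [← h1, ← h2, map_sub, h4, h4]

end LocalCurvature

/-! ### Cosymplectic structures on open sets -/

section AlmostContact

variable {V : Type*} [NormedAddCommGroup V] [NormedSpace ℝ V]

/-- An almost contact metric structure on the vector space `V`, with metric `B`. -/
structure IsAlmostContactMetric (B : V →L[ℝ] V →L[ℝ] ℝ) (φ : V →L[ℝ] V) (ξ : V) (η : V →L[ℝ] ℝ) :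
    Prop where
  symm : ∀ u v, B u v = B v u
  pos : ∀ v, v ≠ 0 → 0 < B v v
  phi_phi : ∀ u, φ (φ u) = -u + η u • ξ
  eta_xi : η ξ = 1
  phi_phi_inner : ∀ u v, B (φ u) (φ v) = B u v - η u * η v

namespace IsAlmostContactMetric

variable {B : V →L[ℝ] V →L[ℝ] ℝ} {φ : V →L[ℝ] V} {ξ : V} {η : V →L[ℝ] ℝ}

/-- By `φ² = -1 + η ⊗ ξ`, the vector `φ ξ` is `η(φ ξ) ξ`, and `φ² ξ = 0` makes the factor vanish. -/
theorem phi_xi (h : IsAlmostContactMetric B φ ξ η) : φ ξ = 0 := by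
  have h1 : φ (φ ξ) = 0 := by simp [h.phi_phi, h.eta_xi]
  have h2 : φ ξ = η (φ ξ) • ξ := by
    have := h.phi_phi (φ ξ)
    rw [h1, map_zero] at this
    rwa [eq_comm, neg_add_eq_zero] at this
  have h3 : η (φ ξ) * η (φ ξ) = 0 := by
    have h4 : η (φ (φ ξ)) = 0 := by rw [h1, map_zero]
    rw [h2, map_smul, map_smul, smul_eq_mul] at h4
    rcases mul_eq_zero.1 h4 with h5 | h5
    · have h6 : η (φ ξ) = 0 := by rw [h5] at h2; simp [h2]
      simp [h6]
    · simp [h5]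
  rw [h2, mul_self_eq_zero.1 h3, zero_smul]

theorem inner_xi (h : IsAlmostContactMetric B φ ξ η) (u : V) : B u ξ = η u := by
  have := h.phi_phi_inner u ξ
  rw [h.phi_xi, map_zero, h.eta_xi] at this
  linarith

theorem xi_ne_zero (h : IsAlmostContactMetric B φ ξ η) : ξ ≠ 0 := by
  rintro rfl
  simpa using h.eta_xi

theorem eta_phi (h : IsAlmostContactMetric B φ ξ η) (u : V) : η (φ u) = 0 := by
  have h1 : φ (φ (φ u)) = -φ u := by rw [h.phi_phi u]; simp [h.phi_xi]
  rw [h.phi_phi (φ u)] at h1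
  have : η (φ u) • ξ = 0 := by simpa using h1
  exact (smul_eq_zero.1 this).resolve_right h.xi_ne_zero

theorem skew (h : IsAlmostContactMetric B φ ξ η) (u v : V) : B (φ u) v = -B u (φ v) := by
  have := h.phi_phi_inner (φ u) v
  rw [h.eta_phi, h.phi_phi, map_add, map_neg, map_smul] at this
  simp only [add_apply, neg_apply, smul_apply, smul_eq_mul, h.symm ξ,
    h.inner_xi, h.eta_phi] at this
  linarith

theorem inner_phi_self (h : IsAlmostContactMetric B φ ξ η) (u : V) : B u (φ u) = 0 := by
  have := h.skew u u
  rw [h.symm] at this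
  linarith

end IsAlmostContactMetric

/-- A cosymplectic structure on the open set `U`: an almost contact metric structure with parallel
`Φ`. No regularity
of `ξ` and `η` is required, as only their values at single points are used. -/
structure IsLocalCosymplectic (G : V → V →L[ℝ] V →L[ℝ] ℝ) (Φ : V → V →L[ℝ] V) (ξ : V → V)
    (η : V → V →L[ℝ] ℝ) (U : Set V) : Prop where
  metric : IsLocalMetric G U
  contDiffOn : ContDiffOn ℝ ∞ Φ U
  parallel : ∀ y ∈ U, ∀ u v, fderiv ℝ Φ y u v + christoffel G y u (Φ y v)
    - Φ y (christoffel G y u v) = 0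
  contact : ∀ y ∈ U, IsAlmostContactMetric (G y) (Φ y) (ξ y) (η y)

/-- A continuous bilinear form as a bilinear map of vector spaces. -/
def toBilin {W : Type*} [NormedAddCommGroup W] [NormedSpace ℝ W] (B : V →L[ℝ] V →L[ℝ] W) :
    V →ₗ[ℝ] V →ₗ[ℝ] W :=
  LinearMap.mk₂ ℝ (fun u v => B u v) (by simp) (by simp) (by simp) (by simp)

@[simp]
theorem toBilin_apply {W : Type*} [NormedAddCommGroup W] [NormedSpace ℝ W]
    (B : V →L[ℝ] V →L[ℝ] W) (u v : V) : toBilin B u v = B u v := rfl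

namespace IsLocalCosymplectic

variable {G : V → V →L[ℝ] V →L[ℝ] ℝ} {Φ : V → V →L[ℝ] V} {ξ : V → V} {η : V → V →L[ℝ] ℝ}
  {U : Set V} [FiniteDimensional ℝ V] {y : V}

/-- The vector `R(u, v) ξ` is in the kernel of `φ`, as `R` commutes with `φ`, and it is orthogonal
to `ξ`. -/
theorem localCurvature_xi (h : IsLocalCosymplectic G Φ ξ η U) (hy : y ∈ U) (u v : V) :
    localCurvature G y u v (ξ y) = 0 := by
  have hc := h.contact y hy
  set r := localCurvature G y u v (ξ y) with hr
  have h1 : Φ y r = 0 := by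
    rw [hr, ← localCurvature_clm_apply h.metric hy h.contDiffOn h.parallel, hc.phi_xi,
      localCurvature_eq h.metric hy]
    simp
  have h2 : η y r = 0 := by
    rw [← hc.inner_xi]
    exact inner_localCurvature_self h.metric hy u v (ξ y)
  have h3 := hc.phi_phi r
  rw [h1, map_zero, h2, zero_smul, add_zero] at h3
  exact neg_eq_zero.1 h3.symm

/-- The curvature of a cosymplectic structure has Kähler symmetries, although `Φ` is not invertible:
`R(u, v)` maps into the orthogonal complement of `ξ`, on which `Φ` is an isometry. -/
theorem isKaehlerCurvature (h : IsLocalCosymplectic G Φ ξ η U) (hy : y ∈ U) :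
    IsKaehlerCurvature (curvatureForm G y) (Φ y : V →ₗ[ℝ] V) := by
  have hc := h.contact y hy
  have hsk : ∀ u v z w, curvatureForm G y u v z w = -curvatureForm G y u v w z := by
    intro u v z w
    have h0 : ∀ z, curvatureForm G y u v z z = 0 := fun z => by
      rw [curvatureForm_apply h.metric hy, inner_localCurvature_self h.metric hy]
    have := h0 (z + w)
    simp only [map_add, LinearMap.add_apply, h0] at this
    linarith
  refine ⟨fun u v z w => ?_, hsk, fun u v z w => ?_, fun u v z w => ?_⟩
  · rw [curvatureForm_apply h.metric hy, curvatureForm_apply h.metric hy,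
      localCurvature_skew_left]
    simp
  · simp only [curvatureForm_apply h.metric hy]
    have := localCurvature_bianchi h.metric hy u v z
    rw [← add_apply, ← add_apply, ← map_add,
      ← map_add, this]
    simp
  · have h1 : η y (localCurvature G y u v z) = 0 := by
      rw [← hc.inner_xi, ← curvatureForm_apply h.metric hy, hsk, curvatureForm_apply h.metric hy,
        h.localCurvature_xi hy]
      simp
    rw [curvatureForm_apply h.metric hy, curvatureForm_apply h.metric hy]
    simp only [ContinuousLinearMap.coe_coe]
    rw [localCurvature_clm_apply h.metric hy h.contDiffOn h.parallel, hc.phi_phi_inner, h1]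
    simp

/-- In a cosymplectic space form, `⟨R(x, φx) φz, z⟩ = (c / 2) |x|² |z|²` for `x`, `z` orthogonal to
`ξ` that span orthogonal `φ`-invariant planes. -/
theorem inner_localCurvature (h : IsLocalCosymplectic G Φ ξ η U) (hy : y ∈ U) {c : ℝ}
    (hc : ∀ u, u ≠ 0 → η y u = 0 → G y (localCurvature G y u (Φ y u) (Φ y u)) u
      / (G y u u * G y (Φ y u) (Φ y u) - G y u (Φ y u) ^ 2) = c)
    {x z : V} (hx : η y x = 0) (hz : η y z = 0) (hxz : G y x z = 0) (hxz' : G y x (Φ y z) = 0) :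
    G y (localCurvature G y x (Φ y x) (Φ y z)) z = c / 2 * (G y x x * G y z z) := by
  have hk := h.contact y hy
  have key := (h.isKaehlerCurvature hy).apply_of_const (B := toBilin (G y))
    (D := LinearMap.ker (η y : V →ₗ[ℝ] ℝ)) (c := c) (x := x) (z := z) hk.symm
  simp only [LinearMap.mem_ker, ContinuousLinearMap.coe_coe, toBilin_apply,
    curvatureForm_apply h.metric hy] at key
  refine key (fun u hu => ?_) (fun u _ => hk.eta_phi u) (fun u hu => ?_) (fun u hu => ?_)
    hx hz hxz hxz'
  · rw [hk.phi_phi_inner, hu]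
    ring
  · rw [hk.phi_phi, hu]
    simp
  · rcases eq_or_ne u 0 with rfl | hu0
    · simp
    · have h1 := hc u hu0 hu
      have h2 := hk.pos u hu0
      rw [hk.inner_phi_self, hk.phi_phi_inner, hu, div_eq_iff (by simp; exact h2.ne')] at h1
      rw [h1]
      ring

end IsLocalCosymplectic

end AlmostContact

/-! ### The second fundamental form in coordinates -/

section Pullback

variable {E V : Type*} [NormedAddCommGroup E] [NormedSpace ℝ E]
  [NormedAddCommGroup V] [NormedSpace ℝ V]

theorem contDiffAt_bilinearComp {F A B : Type*} [NormedAddCommGroup F] [NormedSpace ℝ F]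
    [NormedAddCommGroup A] [NormedSpace ℝ A] [NormedAddCommGroup B] [NormedSpace ℝ B]
    {G : F → V →L[ℝ] V →L[ℝ] ℝ} {S : F → A →L[ℝ] V} {T : F → B →L[ℝ] V} {y : F}
    (hG : ContDiffAt ℝ ∞ G y) (hS : ContDiffAt ℝ ∞ S y) (hT : ContDiffAt ℝ ∞ T y) :
    ContDiffAt ℝ ∞ (fun z => (G z).bilinearComp (S z) (T z)) y := by
  have h1 : ContDiffAt ℝ ∞ (fun z => ((G z) ∘L (S z)).flip) y :=
    (ContinuousLinearMap.flipₗᵢ ℝ A V ℝ).contDiff.contDiffAt.comp y (hG.clm_comp hS)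
  exact (ContinuousLinearMap.flipₗᵢ ℝ B A ℝ).contDiff.contDiffAt.comp y (h1.clm_comp hT)

/-- The metric induced from `G` by the map `ψ`. -/
def pullback (G : V → V →L[ℝ] V →L[ℝ] ℝ) (ψ : E → V) (y : E) : E →L[ℝ] E →L[ℝ] ℝ :=
  (G (ψ y)).bilinearComp (fderiv ℝ ψ y) (fderiv ℝ ψ y)

/-- The second fundamental form of `ψ` by the Gauss formula. -/
def sff (G : V → V →L[ℝ] V →L[ℝ] ℝ) (ψ : E → V) (y u v : E) : V :=
  covHess G ψ y u v - fderiv ℝ ψ y (christoffel (pullback G ψ) y u v)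

theorem pullback_apply (G : V → V →L[ℝ] V →L[ℝ] ℝ) (ψ : E → V) (y u v : E) :
    pullback G ψ y u v = G (ψ y) (fderiv ℝ ψ y u) (fderiv ℝ ψ y v) := rfl

variable {G : V → V →L[ℝ] V →L[ℝ] ℝ} {U : Set V} {ψ : E → V} {y : E}

theorem contDiffAt_pullback (hG : IsLocalMetric G U) (hy : ψ y ∈ U) (hψ : ContDiffAt ℝ ∞ ψ y) :
    ContDiffAt ℝ ∞ (pullback G ψ) y :=
  contDiffAt_bilinearComp ((hG.contDiffAt hy).comp y hψ) (contDiffAt_fderiv hψ)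
    (contDiffAt_fderiv hψ)

theorem fderiv_bilin_apply {F A : Type*} [NormedAddCommGroup F] [NormedSpace ℝ F]
    [NormedAddCommGroup A] [NormedSpace ℝ A]
    {B : F → A →L[ℝ] A →L[ℝ] ℝ} {y : F} (hB : DifferentiableAt ℝ B y) (u : F) (v w : A) :
    fderiv ℝ (fun z => B z v w) y u = fderiv ℝ B y u v w := by
  rw [((hB.hasFDerivAt.clm_apply (hasFDerivAt_const v y)).clm_apply
    (hasFDerivAt_const w y)).fderiv]
  simp

theorem covDeriv_fderiv_apply (hψ : ContDiffAt ℝ ∞ ψ y) {v : E → E} (hv : DifferentiableAt ℝ v y)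
    (u : E) : covDeriv G ψ (fun z => fderiv ℝ ψ z (v z)) y u =
      fderiv ℝ ψ y (fderiv ℝ v y u) + covHess G ψ y u (v y) := by
  rw [covDeriv, covHess, (((contDiffAt_fderiv hψ).differentiableAt (by simp)).hasFDerivAt.clm_apply
    hv.hasFDerivAt).fderiv]
  simp
  abel

/-- The covariant second derivative as a bilinear map. -/
def covHessL (G : V → V →L[ℝ] V →L[ℝ] ℝ) (ψ : E → V) (y : E) : E →L[ℝ] E →L[ℝ] V :=
  fderiv ℝ (fderiv ℝ ψ) y + (christoffelL G (ψ y)).bilinearComp (fderiv ℝ ψ y) (fderiv ℝ ψ y)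

theorem covHessL_apply (u v : E) : covHessL G ψ y u v = covHess G ψ y u v := by
  simp [covHessL, covHess, christoffelL_apply]

variable [FiniteDimensional ℝ V]

theorem fderiv_pullback (hG : IsLocalMetric G U) (hy : ψ y ∈ U) (hψ : ContDiffAt ℝ ∞ ψ y)
    (u v w : E) : fderiv ℝ (pullback G ψ) y u v w =
      G (ψ y) (covHess G ψ y u v) (fderiv ℝ ψ y w)
        + G (ψ y) (fderiv ℝ ψ y v) (covHess G ψ y u w) := by
  rw [← fderiv_bilin_apply ((contDiffAt_pullback hG hy hψ).differentiableAt (by simp))]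
  simp only [pullback_apply]
  rw [fderiv_inner hG hy (hψ.differentiableAt (by simp))
    ((contDiffAt_fderiv_apply hψ v).differentiableAt (by simp))
    ((contDiffAt_fderiv_apply hψ w).differentiableAt (by simp)), covDeriv_fderiv hψ,
    covDeriv_fderiv hψ]

/-- The tangential part of the covariant second derivative is given by Koszul's formula. -/
theorem inner_covHess (hG : IsLocalMetric G U) (hy : ψ y ∈ U) (hψ : ContDiffAt ℝ ∞ ψ y)
    (u v w : E) : G (ψ y) (covHess G ψ y u v) (fderiv ℝ ψ y w) =
      (fderiv ℝ (pullback G ψ) y u v w + fderiv ℝ (pullback G ψ) y v u w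
        - fderiv ℝ (pullback G ψ) y w u v) / 2 := by
  simp only [fderiv_pullback hG hy hψ]
  rw [covHess_symm hG hy hψ v u, covHess_symm hG hy hψ w u, covHess_symm hG hy hψ w v,
    hG.symm _ hy (fderiv ℝ ψ y v), hG.symm _ hy (fderiv ℝ ψ y u)]
  ring

end Pullback

/-! ### Contact CR-warped products in coordinates -/

section LocalWarped

variable {E₁ E₂ V : Type*} [NormedAddCommGroup E₁] [NormedSpace ℝ E₁]
  [NormedAddCommGroup E₂] [NormedSpace ℝ E₂] [NormedAddCommGroup V] [NormedSpace ℝ V]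

/-- A contact CR-warped product immersion `ψ` in coordinates, with warped product metric
`G₁ + ρ G₂`: the warping function is the square root of `ρ`. -/
structure IsLocalCRWarped (G : V → V →L[ℝ] V →L[ℝ] ℝ) (Φ : V → V →L[ℝ] V) (ξ : V → V)
    (η : V → V →L[ℝ] ℝ) (U : Set V) (G₁ : E₁ → E₁ →L[ℝ] E₁ →L[ℝ] ℝ) (U₁ : Set E₁)
    (G₂ : E₂ → E₂ →L[ℝ] E₂ →L[ℝ] ℝ) (U₂ : Set E₂) (ρ : E₁ → ℝ) (ψ : E₁ × E₂ → V)
    (O : Set (E₁ × E₂)) : Prop where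
  cosymplectic : IsLocalCosymplectic G Φ ξ η U
  metric₁ : IsLocalMetric G₁ U₁
  metric₂ : IsLocalMetric G₂ U₂
  contDiffOn_warp : ContDiffOn ℝ ∞ ρ U₁
  warp_pos : ∀ y ∈ U₁, 0 < ρ y
  isOpen : IsOpen O
  contDiffOn : ContDiffOn ℝ ∞ ψ O
  mapsTo : ∀ y ∈ O, ψ y ∈ U
  mapsTo₁ : ∀ y ∈ O, y.1 ∈ U₁
  mapsTo₂ : ∀ y ∈ O, y.2 ∈ U₂
  isometric : ∀ y ∈ O, ∀ u v, G (ψ y) (fderiv ℝ ψ y u) (fderiv ℝ ψ y v) =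
    G₁ y.1 u.1 v.1 + ρ y.1 * G₂ y.2 u.2 v.2
  xi_tangent : ∀ y ∈ O, ∃ k : E₁, fderiv ℝ ψ y (k, 0) = ξ (ψ y)
  invariant : ∀ y ∈ O, ∀ X : E₁, ∃ X' : E₁,
    fderiv ℝ ψ y (X', 0) = Φ (ψ y) (fderiv ℝ ψ y (X, 0))
  antiInvariant : ∀ y ∈ O, ∀ (Z : E₂) (w : E₁ × E₂),
    G (ψ y) (Φ (ψ y) (fderiv ℝ ψ y (0, Z))) (fderiv ℝ ψ y w) = 0

/-- The Hessian of the function `ρ` for the metric `G`. -/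
def localHessian {E : Type*} [NormedAddCommGroup E] [NormedSpace ℝ E]
    (G : E → E →L[ℝ] E →L[ℝ] ℝ) (ρ : E → ℝ) (y u v : E) : ℝ :=
  fderiv ℝ (fderiv ℝ ρ) y u v - fderiv ℝ ρ y (christoffel G y u v)

namespace IsLocalCRWarped

variable {G : V → V →L[ℝ] V →L[ℝ] ℝ} {Φ : V → V →L[ℝ] V} {ξ : V → V}
    {η : V → V →L[ℝ] ℝ} {U : Set V} {G₁ : E₁ → E₁ →L[ℝ] E₁ →L[ℝ] ℝ} {U₁ : Set E₁}
    {G₂ : E₂ → E₂ →L[ℝ] E₂ →L[ℝ] ℝ} {U₂ : Set E₂} {ρ : E₁ → ℝ} {ψ : E₁ × E₂ → V}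
    {O : Set (E₁ × E₂)} {y : E₁ × E₂}

theorem contDiffAt (h : IsLocalCRWarped G Φ ξ η U G₁ U₁ G₂ U₂ ρ ψ O) (hy : y ∈ O) :
    ContDiffAt ℝ ∞ ψ y :=
  h.contDiffOn.contDiffAt (h.isOpen.mem_nhds hy)

theorem contDiffAt_warp (h : IsLocalCRWarped G Φ ξ η U G₁ U₁ G₂ U₂ ρ ψ O) (hy : y ∈ O) :
    ContDiffAt ℝ ∞ ρ y.1 :=
  h.contDiffOn_warp.contDiffAt (h.metric₁.isOpen.mem_nhds (h.mapsTo₁ y hy))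

theorem eventually (h : IsLocalCRWarped G Φ ξ η U G₁ U₁ G₂ U₂ ρ ψ O) (hy : y ∈ O)
    {p : E₁ × E₂ → Prop} (hp : ∀ z ∈ O, p z) : ∀ᶠ z in nhds y, p z :=
  Filter.eventually_of_mem (h.isOpen.mem_nhds hy) hp

theorem pos (h : IsLocalCRWarped G Φ ξ η U G₁ U₁ G₂ U₂ ρ ψ O) (hy : y ∈ O) (w : V) (hw : w ≠ 0) :
    0 < G (ψ y) w w :=
  h.cosymplectic.metric.pos _ (h.mapsTo y hy) w hw

theorem inner_symm (h : IsLocalCRWarped G Φ ξ η U G₁ U₁ G₂ U₂ ρ ψ O) (hy : y ∈ O) (u v : V) :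
    G (ψ y) u v = G (ψ y) v u :=
  h.cosymplectic.metric.symm _ (h.mapsTo y hy) u v

theorem contact (h : IsLocalCRWarped G Φ ξ η U G₁ U₁ G₂ U₂ ρ ψ O) (hy : y ∈ O) :
    IsAlmostContactMetric (G (ψ y)) (Φ (ψ y)) (ξ (ψ y)) (η (ψ y)) :=
  h.cosymplectic.contact _ (h.mapsTo y hy)

theorem contDiffAt_phi [FiniteDimensional ℝ V]
    (h : IsLocalCRWarped G Φ ξ η U G₁ U₁ G₂ U₂ ρ ψ O) (hy : y ∈ O) : ContDiffAt ℝ ∞ Φ (ψ y) :=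
  h.cosymplectic.contDiffOn.contDiffAt
    (h.cosymplectic.metric.isOpen.mem_nhds (h.mapsTo y hy))

theorem covDeriv_phi [FiniteDimensional ℝ V]
    (h : IsLocalCRWarped G Φ ξ η U G₁ U₁ G₂ U₂ ρ ψ O) (hy : y ∈ O)
    {W : E₁ × E₂ → V} (hW : DifferentiableAt ℝ W y) (u : E₁ × E₂) :
    covDeriv G ψ (fun z => Φ (ψ z) (W z)) y u = Φ (ψ y) (covDeriv G ψ W y u) :=
  covDeriv_clm_apply ((h.contDiffAt hy).differentiableAt (by simp))
    ((h.contDiffAt_phi hy).differentiableAt (by simp))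
    (h.cosymplectic.parallel _ (h.mapsTo y hy)) hW u

variable [FiniteDimensional ℝ E₁] [FiniteDimensional ℝ E₂] [FiniteDimensional ℝ V]

theorem fderiv_pullback_eq (h : IsLocalCRWarped G Φ ξ η U G₁ U₁ G₂ U₂ ρ ψ O) (hy : y ∈ O)
    (u v w : E₁ × E₂) : fderiv ℝ (pullback G ψ) y u v w =
      fderiv ℝ G₁ y.1 u.1 v.1 w.1 + fderiv ℝ ρ y.1 u.1 * G₂ y.2 v.2 w.2
        + ρ y.1 * fderiv ℝ G₂ y.2 u.2 v.2 w.2 := by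
  rw [← fderiv_bilin_apply ((contDiffAt_pullback h.cosymplectic.metric (h.mapsTo y hy)
    (h.contDiffAt hy)).differentiableAt (by simp))]
  have h1 : (fun z => pullback G ψ z v w) =ᶠ[nhds y]
      fun z => G₁ z.1 v.1 w.1 + ρ z.1 * G₂ z.2 v.2 w.2 :=
    h.eventually hy fun z hz => h.isometric z hz v w
  rw [h1.fderiv_eq]
  have hρ : HasFDerivAt (fun z : E₁ × E₂ => ρ z.1) _ y :=
    ((h.contDiffAt_warp hy).differentiableAt (by simp)).hasFDerivAt.comp y hasFDerivAt_fst
  have hG₁ : HasFDerivAt (fun z : E₁ × E₂ => G₁ z.1 v.1 w.1) _ y :=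
    ((((h.metric₁.differentiableAt (h.mapsTo₁ y hy)).hasFDerivAt.comp y
      hasFDerivAt_fst).clm_apply (hasFDerivAt_const v.1 y)).clm_apply (hasFDerivAt_const w.1 y))
  have hG₂ : HasFDerivAt (fun z : E₁ × E₂ => G₂ z.2 v.2 w.2) _ y :=
    ((((h.metric₂.differentiableAt (h.mapsTo₂ y hy)).hasFDerivAt.comp y
      hasFDerivAt_snd).clm_apply (hasFDerivAt_const v.2 y)).clm_apply (hasFDerivAt_const w.2 y))
  have h2 : HasFDerivAt (fun z => G₁ z.1 v.1 w.1 + ρ z.1 * G₂ z.2 v.2 w.2) _ y :=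
    hG₁.add (hρ.mul hG₂)
  rw [h2.fderiv]
  simp
  ring

/-- The tangential part of the covariant second derivative of a warped product immersion. -/
theorem inner_covHess (h : IsLocalCRWarped G Φ ξ η U G₁ U₁ G₂ U₂ ρ ψ O) (hy : y ∈ O)
    (u v w : E₁ × E₂) : G (ψ y) (covHess G ψ y u v) (fderiv ℝ ψ y w) =
      G₁ y.1 (christoffel G₁ y.1 u.1 v.1) w.1 + ρ y.1 * G₂ y.2 (christoffel G₂ y.2 u.2 v.2) w.2
      + (fderiv ℝ ρ y.1 u.1 * G₂ y.2 v.2 w.2 + fderiv ℝ ρ y.1 v.1 * G₂ y.2 u.2 w.2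
        - fderiv ℝ ρ y.1 w.1 * G₂ y.2 u.2 v.2) / 2 := by
  rw [CRWarped.inner_covHess h.cosymplectic.metric (h.mapsTo y hy) (h.contDiffAt hy),
    h.fderiv_pullback_eq hy, h.fderiv_pullback_eq hy, h.fderiv_pullback_eq hy,
    h.metric₁.inner_christoffel (h.mapsTo₁ y hy), h.metric₂.inner_christoffel (h.mapsTo₂ y hy)]
  ring

theorem covHess_symm (h : IsLocalCRWarped G Φ ξ η U G₁ U₁ G₂ U₂ ρ ψ O) (hy : y ∈ O)
    (u v : E₁ × E₂) : covHess G ψ y u v = covHess G ψ y v u :=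
  CRWarped.covHess_symm h.cosymplectic.metric (h.mapsTo y hy) (h.contDiffAt hy) u v

/-- The endomorphism field `P` of the first factor with `dψ(P X) = Φ dψ(X)`. It is defined by
`G₁(P X, Y) = G(Φ dψ(X), dψ(Y))`, which makes its smoothness evident. -/
def endo (G : V → V →L[ℝ] V →L[ℝ] ℝ) (Φ : V → V →L[ℝ] V) (G₁ : E₁ → E₁ →L[ℝ] E₁ →L[ℝ] ℝ)
    (ψ : E₁ × E₂ → V) (y : E₁ × E₂) : E₁ →L[ℝ] E₁ :=
  (G₁ y.1).inverse ∘L (G (ψ y)).bilinearComp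
    ((Φ (ψ y)) ∘L (fderiv ℝ ψ y) ∘L ContinuousLinearMap.inl ℝ E₁ E₂)
    ((fderiv ℝ ψ y) ∘L ContinuousLinearMap.inl ℝ E₁ E₂)

theorem contDiffAt_endo (h : IsLocalCRWarped G Φ ξ η U G₁ U₁ G₂ U₂ ρ ψ O) (hy : y ∈ O) :
    ContDiffAt ℝ ∞ (endo G Φ G₁ ψ) y := by
  have h1 : ContDiffAt ℝ ∞ (fun y : E₁ × E₂ => G₁ y.1) y :=
    ContDiffAt.comp y (h.metric₁.contDiffAt (h.mapsTo₁ y hy)) contDiffAt_fst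
  have h2 : ContDiffAt ℝ ∞ (fun y : E₁ × E₂ => (G₁ y.1).inverse) y :=
    ContDiffAt.comp (f := fun y : E₁ × E₂ => G₁ y.1) y ((isInvertible_of_pos
      (h.metric₁.pos _ (h.mapsTo₁ y hy))).contDiffAt_map_inverse) h1
  have h3 : ContDiffAt ℝ ∞
      (fun z => (fderiv ℝ ψ z) ∘L ContinuousLinearMap.inl ℝ E₁ E₂) y :=
    (contDiffAt_fderiv (h.contDiffAt hy)).clm_comp contDiffAt_const
  have h4 : ContDiffAt ℝ ∞ (fun z => Φ (ψ z)) y := (h.contDiffAt_phi hy).comp y (h.contDiffAt hy)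
  have h5 : ContDiffAt ℝ ∞ (fun z => G (ψ z)) y :=
    (h.cosymplectic.metric.contDiffAt (h.mapsTo y hy)).comp y (h.contDiffAt hy)
  exact h2.clm_comp (contDiffAt_bilinearComp h5 (h4.clm_comp h3) h3)

theorem differentiableAt_endo_apply (h : IsLocalCRWarped G Φ ξ η U G₁ U₁ G₂ U₂ ρ ψ O) (hy : y ∈ O)
    (X : E₁) : DifferentiableAt ℝ (fun z => (endo G Φ G₁ ψ z X)) y :=
  ((h.contDiffAt_endo hy).differentiableAt (by simp)).clm_apply (differentiableAt_const X)

/-- The vectors `Φ dψ(X)` are tangent to the first factor, so they are given by their inner products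
with it. -/
theorem fderiv_endo (h : IsLocalCRWarped G Φ ξ η U G₁ U₁ G₂ U₂ ρ ψ O) (hy : y ∈ O) (X : E₁) :
    fderiv ℝ ψ y (endo G Φ G₁ ψ y X, 0) = Φ (ψ y) (fderiv ℝ ψ y (X, 0)) := by
  obtain ⟨X', hX'⟩ := h.invariant y hy X
  have h1 := h.metric₁.pos _ (h.mapsTo₁ y hy)
  have h2 : endo G Φ G₁ ψ y X = X' := by
    apply eq_of_apply_eq h1
    intro W
    have h3 := h.isometric y hy (X', 0) (W, 0)
    simp only [map_zero, mul_zero, add_zero] at h3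
    rw [endo, ContinuousLinearMap.comp_apply, apply_inverse_of_pos h1, ← h3, hX']
    rfl
  rw [h2, hX']

theorem inner_fst (h : IsLocalCRWarped G Φ ξ η U G₁ U₁ G₂ U₂ ρ ψ O) (hy : y ∈ O) (X Y : E₁) :
    G (ψ y) (fderiv ℝ ψ y (X, 0)) (fderiv ℝ ψ y (Y, 0)) = G₁ y.1 X Y := by
  rw [h.isometric y hy]
  simp

theorem inner_snd (h : IsLocalCRWarped G Φ ξ η U G₁ U₁ G₂ U₂ ρ ψ O) (hy : y ∈ O) (Z W : E₂) :
    G (ψ y) (fderiv ℝ ψ y (0, Z)) (fderiv ℝ ψ y (0, W)) = ρ y.1 * G₂ y.2 Z W := by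
  rw [h.isometric y hy]
  simp

theorem inner_fst_snd (h : IsLocalCRWarped G Φ ξ η U G₁ U₁ G₂ U₂ ρ ψ O) (hy : y ∈ O) (X : E₁)
    (Z : E₂) : G (ψ y) (fderiv ℝ ψ y (X, 0)) (fderiv ℝ ψ y (0, Z)) = 0 := by
  rw [h.isometric y hy]
  simp

theorem endo_skew (h : IsLocalCRWarped G Φ ξ η U G₁ U₁ G₂ U₂ ρ ψ O) (hy : y ∈ O) (X Y : E₁) :
    G₁ y.1 (endo G Φ G₁ ψ y X) Y = -G₁ y.1 X (endo G Φ G₁ ψ y Y) := by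
  rw [← h.inner_fst hy, ← h.inner_fst hy, h.fderiv_endo hy, h.fderiv_endo hy, (h.contact hy).skew]

/-- `∇_Z (P X) = Φ ∇_Z X`: the endomorphism `P` does not depend on the point of the second
factor. -/
theorem fderiv_endo_snd (h : IsLocalCRWarped G Φ ξ η U G₁ U₁ G₂ U₂ ρ ψ O) (hy : y ∈ O) (X : E₁)
    (Z : E₂) : covHess G ψ y (0, Z) (endo G Φ G₁ ψ y X, 0) =
      Φ (ψ y) (covHess G ψ y (0, Z) (X, 0)) := by
  have hψ := h.contDiffAt hy
  have hc := h.contact hy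
  have hP := h.differentiableAt_endo_apply hy X
  -- differentiate `Φ dψ(X) = dψ(P X)` in the direction `Z`
  have h1 := h.covDeriv_phi hy
    ((contDiffAt_fderiv_apply hψ (X, 0)).differentiableAt (by simp)) (0, Z)
  have h2 : (fun z => Φ (ψ z) (fderiv ℝ ψ z (X, 0))) =ᶠ[nhds y]
      fun z => fderiv ℝ ψ z (endo G Φ G₁ ψ z X, 0) :=
    h.eventually hy fun z hz => (h.fderiv_endo hz X).symm
  have hP' : HasFDerivAt (fun z => ((endo G Φ G₁ ψ z X, 0) : E₁ × E₂)) _ y :=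
    hP.hasFDerivAt.prodMk (hasFDerivAt_const 0 y)
  rw [covDeriv_congr h2, covDeriv_fderiv_apply hψ hP'.differentiableAt, covDeriv_fderiv hψ,
    hP'.fderiv] at h1
  set W := fderiv ℝ (fun z => endo G Φ G₁ ψ z X) y (0, Z) with hW
  simp only [ContinuousLinearMap.prod_apply, zero_apply, ← hW] at h1
  -- `W` is orthogonal to itself, as the inner products of `∇_Z (P X)` and `∇_Z X` with vectors
  -- tangent to the first factor vanish
  have h3 : G (ψ y) (fderiv ℝ ψ y (W, 0)) (fderiv ℝ ψ y (W, 0)) = 0 := by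
    have h4 := congrArg (fun v => G (ψ y) v (fderiv ℝ ψ y (W, 0))) h1
    simp only [map_add, add_apply] at h4
    rw [hc.skew, ← h.fderiv_endo hy, h.inner_covHess hy, h.inner_covHess hy] at h4
    simpa using h4
  have h5 := eq_zero_of_apply_self (h.pos hy) h3
  rw [h5, zero_add] at h1
  exact h1

end IsLocalCRWarped

end LocalWarped

/-! ### A curvature component of contact CR-warped products -/

section LocalWarped

variable {E₁ E₂ V : Type*} [NormedAddCommGroup E₁] [NormedSpace ℝ E₁]
  [NormedAddCommGroup E₂] [NormedSpace ℝ E₂] [NormedAddCommGroup V] [NormedSpace ℝ V]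
  [FiniteDimensional ℝ E₁] [FiniteDimensional ℝ E₂] [FiniteDimensional ℝ V]

namespace IsLocalCRWarped

variable {G : V → V →L[ℝ] V →L[ℝ] ℝ} {Φ : V → V →L[ℝ] V} {ξ : V → V}
    {η : V → V →L[ℝ] ℝ} {U : Set V} {G₁ : E₁ → E₁ →L[ℝ] E₁ →L[ℝ] ℝ} {U₁ : Set E₁}
    {G₂ : E₂ → E₂ →L[ℝ] E₂ →L[ℝ] ℝ} {U₂ : Set E₂} {ρ : E₁ → ℝ} {ψ : E₁ × E₂ → V}
    {O : Set (E₁ × E₂)} {y : E₁ × E₂}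

/-- `P` is parallel for the metric `G₁`. -/
theorem fderiv_endo_fst (h : IsLocalCRWarped G Φ ξ η U G₁ U₁ G₂ U₂ ρ ψ O) (hy : y ∈ O)
    (X Y : E₁) : fderiv ℝ (endo G Φ G₁ ψ) y (X, 0) Y =
      endo G Φ G₁ ψ y (christoffel G₁ y.1 X Y) - christoffel G₁ y.1 X (endo G Φ G₁ ψ y Y) := by
  have hψ := h.contDiffAt hy
  have hc := h.contact hy
  have hP := h.differentiableAt_endo_apply hy Y
  have h1 := h.covDeriv_phi hy
    ((contDiffAt_fderiv_apply hψ (Y, 0)).differentiableAt (by simp)) (X, 0)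
  have h2 : (fun z => Φ (ψ z) (fderiv ℝ ψ z (Y, 0))) =ᶠ[nhds y]
      fun z => fderiv ℝ ψ z (endo G Φ G₁ ψ z Y, 0) :=
    h.eventually hy fun z hz => (h.fderiv_endo hz Y).symm
  have hP' : HasFDerivAt (fun z => ((endo G Φ G₁ ψ z Y, 0) : E₁ × E₂)) _ y :=
    hP.hasFDerivAt.prodMk (hasFDerivAt_const 0 y)
  rw [covDeriv_congr h2, covDeriv_fderiv_apply hψ hP'.differentiableAt, covDeriv_fderiv hψ,
    hP'.fderiv] at h1
  rw [← fderiv_apply_const ((h.contDiffAt_endo hy).differentiableAt (by simp))]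
  apply eq_of_apply_eq (h.metric₁.pos _ (h.mapsTo₁ y hy))
  intro W
  have h4 := congrArg (fun v => G (ψ y) v (fderiv ℝ ψ y (W, 0))) h1
  simp only [map_add, add_apply] at h4
  rw [hc.skew, ← h.fderiv_endo hy, h.inner_covHess hy, h.inner_covHess hy] at h4
  simp only [ContinuousLinearMap.prod_apply, zero_apply, h.inner_fst hy, map_zero,
    mul_zero, add_zero, sub_self, zero_div] at h4
  rw [map_sub, sub_apply, h.endo_skew hy]
  linarith

theorem endo_endo (h : IsLocalCRWarped G Φ ξ η U G₁ U₁ G₂ U₂ ρ ψ O) (hy : y ∈ O) (X : E₁) :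
    fderiv ℝ ψ y (endo G Φ G₁ ψ y (endo G Φ G₁ ψ y X), 0) =
      -fderiv ℝ ψ y (X, 0) + η (ψ y) (fderiv ℝ ψ y (X, 0)) • ξ (ψ y) := by
  rw [h.fderiv_endo hy, h.fderiv_endo hy, (h.contact hy).phi_phi]

/-- `∇_Z X` is orthogonal to `ξ`, which is tangent to the first factor. -/
theorem eta_covHess (h : IsLocalCRWarped G Φ ξ η U G₁ U₁ G₂ U₂ ρ ψ O) (hy : y ∈ O) (X : E₁)
    (Z : E₂) : η (ψ y) (covHess G ψ y (0, Z) (X, 0)) = 0 := by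
  obtain ⟨k, hk⟩ := h.xi_tangent y hy
  rw [← (h.contact hy).inner_xi, ← hk, h.inner_covHess hy]
  simp

theorem eta_snd (h : IsLocalCRWarped G Φ ξ η U G₁ U₁ G₂ U₂ ρ ψ O) (hy : y ∈ O) (Z : E₂) :
    η (ψ y) (fderiv ℝ ψ y (0, Z)) = 0 := by
  obtain ⟨k, hk⟩ := h.xi_tangent y hy
  rw [← (h.contact hy).inner_xi, ← hk, h.inner_symm hy, h.inner_fst_snd hy]

/-- `∇_Z (P² X) = Φ² ∇_Z X`, and `∇_Z X` is orthogonal to `ξ`. -/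
theorem covHess_endo_endo (h : IsLocalCRWarped G Φ ξ η U G₁ U₁ G₂ U₂ ρ ψ O) (hy : y ∈ O) (X : E₁)
    (Z : E₂) : covHess G ψ y (0, Z) (endo G Φ G₁ ψ y (endo G Φ G₁ ψ y X), 0) =
      -covHess G ψ y (0, Z) (X, 0) := by
  rw [h.fderiv_endo_snd hy, h.fderiv_endo_snd hy, (h.contact hy).phi_phi, h.eta_covHess hy]
  simp

/-- The tangential part of `∇_X Z` is `X(ln √ρ) Z`. -/
theorem inner_covHess_snd (h : IsLocalCRWarped G Φ ξ η U G₁ U₁ G₂ U₂ ρ ψ O) (hy : y ∈ O) (X : E₁)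
    (Z W : E₂) : G (ψ y) (covHess G ψ y (0, Z) (X, 0)) (fderiv ℝ ψ y (0, W)) =
      fderiv ℝ ρ y.1 X * G₂ y.2 Z W / 2 := by
  rw [h.inner_covHess hy]
  simp

/-- The warping function is constant along `ξ`: `P² X = -X` up to a multiple of `ξ`. -/
theorem fderiv_warp_endo_endo (h : IsLocalCRWarped G Φ ξ η U G₁ U₁ G₂ U₂ ρ ψ O) (hy : y ∈ O)
    {Z : E₂} (hZ : Z ≠ 0) (X : E₁) :
    fderiv ℝ ρ y.1 (endo G Φ G₁ ψ y (endo G Φ G₁ ψ y X)) = -fderiv ℝ ρ y.1 X := by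
  have h1 := h.inner_covHess_snd hy (endo G Φ G₁ ψ y (endo G Φ G₁ ψ y X)) Z Z
  rw [h.covHess_endo_endo hy, map_neg, neg_apply, h.inner_covHess_snd hy] at h1
  have h2 := h.metric₂.pos _ (h.mapsTo₂ y hy) Z hZ
  apply mul_right_cancel₀ h2.ne'
  linarith

/-- The directions `X + P² X`, which are multiples of `ξ`, are in the kernel of the Hessian of the
warping function, since `P` is parallel. -/
theorem localHessian_endo_endo (h : IsLocalCRWarped G Φ ξ η U G₁ U₁ G₂ U₂ ρ ψ O) (hy : y ∈ O)
    {Z : E₂} (hZ : Z ≠ 0) (X Y : E₁) :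
    localHessian G₁ ρ y.1 X (endo G Φ G₁ ψ y (endo G Φ G₁ ψ y Y)) =
      -localHessian G₁ ρ y.1 X Y := by
  have h1 : (fun z : E₁ × E₂ => fderiv ℝ ρ z.1 (endo G Φ G₁ ψ z (endo G Φ G₁ ψ z Y)))
      =ᶠ[nhds y] fun z => -fderiv ℝ ρ z.1 Y :=
    h.eventually hy fun z hz => h.fderiv_warp_endo_endo hz hZ Y
  have hρ : HasFDerivAt (fun z : E₁ × E₂ => fderiv ℝ ρ z.1) _ y :=
    HasFDerivAt.comp y (((contDiffAt_fderiv (h.contDiffAt_warp hy)).differentiableAt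
      (by simp)).hasFDerivAt) hasFDerivAt_fst
  have hP := ((h.contDiffAt_endo hy).differentiableAt (by simp)).hasFDerivAt
  have h2 := hρ.clm_apply (hP.clm_apply (hP.clm_apply (hasFDerivAt_const Y y)))
  have h3 : HasFDerivAt (fun z : E₁ × E₂ => -fderiv ℝ ρ z.1 Y) _ y :=
    (hρ.clm_apply (hasFDerivAt_const Y y)).neg
  have h4 := DFunLike.congr_fun ((h2.congr_of_eventuallyEq h1.symm).unique h3) (X, 0)
  simp only [add_apply, ContinuousLinearMap.comp_apply, ContinuousLinearMap.flip_apply,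
    ContinuousLinearMap.coe_fst', zero_apply, map_zero, zero_add, neg_apply,
    h.fderiv_endo_fst hy, map_sub, map_add, h.fderiv_warp_endo_endo hy hZ] at h4
  rw [localHessian, localHessian]
  linarith

theorem localHessian_symm (h : IsLocalCRWarped G Φ ξ η U G₁ U₁ G₂ U₂ ρ ψ O) (hy : y ∈ O)
    (X Y : E₁) : localHessian G₁ ρ y.1 X Y = localHessian G₁ ρ y.1 Y X := by
  rw [localHessian, localHessian, fderiv_fderiv_symm (h.contDiffAt_warp hy),
    h.metric₁.christoffel_symm (h.mapsTo₁ y hy)]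

/-- The component of `∇_X Z` along `φ Z` is again a derivative of the warping function. -/
theorem inner_covHess_phi (h : IsLocalCRWarped G Φ ξ η U G₁ U₁ G₂ U₂ ρ ψ O) (hy : y ∈ O) (X : E₁)
    (Z : E₂) : G (ψ y) (covHess G ψ y (0, Z) (X, 0)) (Φ (ψ y) (fderiv ℝ ψ y (0, Z))) =
      -(fderiv ℝ ρ y.1 (endo G Φ G₁ ψ y X) * G₂ y.2 Z Z / 2) := by
  rw [← h.inner_covHess_snd hy, h.fderiv_endo_snd hy, (h.contact hy).skew, neg_neg]

/-- The component `⟨∇_X ∇_Y Z, φ Z⟩`, for coordinate vector fields, from the derivative along `X` of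
`⟨∇_Y Z, φ Z⟩`. -/
theorem inner_covDeriv_covHess (h : IsLocalCRWarped G Φ ξ η U G₁ U₁ G₂ U₂ ρ ψ O) (hy : y ∈ O)
    (X Y : E₁) (Z : E₂) :
    G (ψ y) (covDeriv G ψ (fun z => covDeriv G ψ (fun z => fderiv ℝ ψ z (0, Z)) z (Y, 0)) y (X, 0))
        (Φ (ψ y) (fderiv ℝ ψ y (0, Z)))
      = -((localHessian G₁ ρ y.1 X (endo G Φ G₁ ψ y Y)
          + fderiv ℝ ρ y.1 (endo G Φ G₁ ψ y (christoffel G₁ y.1 X Y))) * G₂ y.2 Z Z / 2)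
        - G (ψ y) (covHess G ψ y (0, Z) (Y, 0))
          (Φ (ψ y) (covHess G ψ y (0, Z) (X, 0))) := by
  have hψ := h.contDiffAt hy
  have hg := h.cosymplectic.metric
  have hZ := contDiffAt_fderiv_apply hψ (0, Z)
  have hA := (contDiffAt_covDeriv hg (h.mapsTo y hy) hψ hZ (Y, 0)).differentiableAt (by simp)
  have hΦ : DifferentiableAt ℝ (fun z => Φ (ψ z) (fderiv ℝ ψ z (0, Z))) y :=
    (((h.contDiffAt_phi hy).comp y hψ).clm_apply hZ).differentiableAt (by simp)
  have hA' : ∀ z ∈ O, ∀ Y, covDeriv G ψ (fun z => fderiv ℝ ψ z (0, Z)) z (Y, 0) =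
      covHess G ψ z (0, Z) (Y, 0) := fun z hz Y => by
    rw [covDeriv_fderiv (h.contDiffAt hz), h.covHess_symm hz]
  have h1 := fderiv_inner hg (h.mapsTo y hy) (hψ.differentiableAt (by simp)) hA hΦ (X, 0)
  rw [h.covDeriv_phi hy (hZ.differentiableAt (by simp)), hA' y hy, hA' y hy] at h1
  have h2 : (fun z => G (ψ z) (covDeriv G ψ (fun z => fderiv ℝ ψ z (0, Z)) z (Y, 0))
      (Φ (ψ z) (fderiv ℝ ψ z (0, Z)))) =ᶠ[nhds y]
      fun z => -(fderiv ℝ ρ z.1 (endo G Φ G₁ ψ z Y) * G₂ z.2 Z Z / 2) :=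
    h.eventually hy fun z hz => by
      simp only [hA' z hz]
      exact h.inner_covHess_phi hz Y Z
  have hρ : HasFDerivAt (fun z : E₁ × E₂ => fderiv ℝ ρ z.1) _ y :=
    HasFDerivAt.comp y (((contDiffAt_fderiv (h.contDiffAt_warp hy)).differentiableAt
      (by simp)).hasFDerivAt) hasFDerivAt_fst
  have hP := ((h.contDiffAt_endo hy).differentiableAt (by simp)).hasFDerivAt
  have hG₂ : HasFDerivAt (fun z : E₁ × E₂ => G₂ z.2 Z Z) _ y :=
    ((((h.metric₂.differentiableAt (h.mapsTo₂ y hy)).hasFDerivAt.comp y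
      hasFDerivAt_snd).clm_apply (hasFDerivAt_const Z y)).clm_apply (hasFDerivAt_const Z y))
  have h3 : HasFDerivAt (fun z : E₁ × E₂ =>
      -(fderiv ℝ ρ z.1 (endo G Φ G₁ ψ z Y) * G₂ z.2 Z Z / 2)) _ y :=
    (((hρ.clm_apply (hP.clm_apply (hasFDerivAt_const Y y))).mul hG₂).mul_const (2⁻¹ : ℝ)).neg
  rw [h2.fderiv_eq, h3.fderiv] at h1
  simp only [add_apply, ContinuousLinearMap.comp_apply, ContinuousLinearMap.flip_apply,
    ContinuousLinearMap.coe_fst', ContinuousLinearMap.coe_snd', zero_apply, map_zero, zero_add,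
    neg_apply, smul_apply, smul_eq_mul, mul_zero,
    h.fderiv_endo_fst hy, map_sub] at h1
  rw [localHessian]
  linarith

/-- The curvature component `⟨R(X, φX) Z, φZ⟩` of a contact CR-warped product, in terms of the
warping function and of `∇_X Z`. -/
theorem inner_localCurvature (h : IsLocalCRWarped G Φ ξ η U G₁ U₁ G₂ U₂ ρ ψ O) (hy : y ∈ O)
    (X : E₁) {Z : E₂} (hZ : Z ≠ 0) :
    G (ψ y) (localCurvature G (ψ y) (fderiv ℝ ψ y (X, 0))
        (Φ (ψ y) (fderiv ℝ ψ y (X, 0))) (fderiv ℝ ψ y (0, Z))) (Φ (ψ y) (fderiv ℝ ψ y (0, Z)))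
      = G₂ y.2 Z Z / 2 * (localHessian G₁ ρ y.1 X X
          + localHessian G₁ ρ y.1 (endo G Φ G₁ ψ y X) (endo G Φ G₁ ψ y X))
        - 2 * G (ψ y) (covHess G ψ y (0, Z) (X, 0)) (covHess G ψ y (0, Z) (X, 0)) := by
  have hψ := h.contDiffAt hy
  have hc := h.contact hy
  set P := endo G Φ G₁ ψ y X with hP
  -- `P` stands for the constant vector field with the value of `P X` at `y`
  have h1 := covDeriv_covDeriv_sub h.cosymplectic.metric (h.mapsTo y hy) hψ
    (contDiffAt_fderiv_apply hψ (0, Z)) (X, 0) (P, 0)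
  rw [hP, h.fderiv_endo hy, ← hP] at h1
  rw [← h1, map_sub, sub_apply, h.inner_covDeriv_covHess hy, h.inner_covDeriv_covHess hy, hP,
    h.fderiv_endo_snd hy, ← hP, h.metric₁.christoffel_symm (h.mapsTo₁ y hy) P X,
    hc.phi_phi, h.eta_covHess hy, hc.phi_phi_inner, h.eta_covHess hy, hP,
    h.localHessian_endo_endo hy hZ]
  simp only [zero_smul, add_zero, map_neg]
  ring

/-- The length of `∇_X Z` in a contact CR-warped product in a cosymplectic space form, where the
curvature component `⟨R(X, φX) Z, φZ⟩` is also known from the constant `φ`-sectional curvature. -/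
theorem inner_covHess_self (h : IsLocalCRWarped G Φ ξ η U G₁ U₁ G₂ U₂ ρ ψ O) (hy : y ∈ O) {c : ℝ}
    (hc : ∀ u, u ≠ 0 → η (ψ y) u = 0 →
      G (ψ y) (localCurvature G (ψ y) u (Φ (ψ y) u) (Φ (ψ y) u)) u
      / (G (ψ y) u u * G (ψ y) (Φ (ψ y) u) (Φ (ψ y) u) - G (ψ y) u (Φ (ψ y) u) ^ 2) = c)
    (X : E₁) {Z : E₂} (hZ : Z ≠ 0) :
    G (ψ y) (covHess G ψ y (0, Z) (X, 0)) (covHess G ψ y (0, Z) (X, 0)) =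
      G₂ y.2 Z Z / 4 * (localHessian G₁ ρ y.1 X X
          + localHessian G₁ ρ y.1 (endo G Φ G₁ ψ y X) (endo G Φ G₁ ψ y X))
        + c / 4 * (G₁ y.1 X X - η (ψ y) (fderiv ℝ ψ y (X, 0)) ^ 2) * (ρ y.1 * G₂ y.2 Z Z) := by
  have hk := h.contact hy
  -- replace `X` by `P² X`, which is `-X` plus a multiple of `ξ` and is orthogonal to `ξ`
  set X' := endo G Φ G₁ ψ y (endo G Φ G₁ ψ y X) with hX'
  have hηX : η (ψ y) (fderiv ℝ ψ y (X', 0)) = 0 := by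
    rw [hX', h.fderiv_endo hy, hk.eta_phi]
  have h1 := h.inner_localCurvature hy X' hZ
  have h2 := h.cosymplectic.inner_localCurvature (h.mapsTo y hy) hc hηX (h.eta_snd hy Z)
    (h.inner_fst_snd hy X' Z) (by rw [h.inner_symm hy, h.antiInvariant y hy])
  have h3 := (h.cosymplectic.isKaehlerCurvature (h.mapsTo y hy)).skew_right
    (fderiv ℝ ψ y (X', 0)) (Φ (ψ y) (fderiv ℝ ψ y (X', 0))) (fderiv ℝ ψ y (0, Z))
    (Φ (ψ y) (fderiv ℝ ψ y (0, Z)))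
  rw [curvatureForm_apply h.cosymplectic.metric (h.mapsTo y hy),
    curvatureForm_apply h.cosymplectic.metric (h.mapsTo y hy), h1, h2] at h3
  have hPP : endo G Φ G₁ ψ y X' = -endo G Φ G₁ ψ y X := by
    apply eq_of_apply_eq (h.metric₁.pos _ (h.mapsTo₁ y hy))
    intro W
    rw [← h.inner_fst hy, ← h.inner_fst hy, hX', h.endo_endo hy, h.fderiv_endo hy, hk.eta_phi,
      ← h.fderiv_endo hy, zero_smul, add_zero, ← map_neg]
    simp
  have h4 : ∀ A B, localHessian G₁ ρ y.1 (-A) B = -localHessian G₁ ρ y.1 A B := fun A B => by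
    simp only [localHessian, ← christoffelL_apply, map_neg, neg_apply]
    ring
  have h5 : localHessian G₁ ρ y.1 X' X' = localHessian G₁ ρ y.1 X X := by
    rw [hX', h.localHessian_endo_endo hy hZ, h.localHessian_symm hy,
      h.localHessian_endo_endo hy hZ, neg_neg]
  have h6 : G (ψ y) (fderiv ℝ ψ y (X', 0)) (fderiv ℝ ψ y (X', 0)) =
      G₁ y.1 X X - η (ψ y) (fderiv ℝ ψ y (X, 0)) ^ 2 := by
    rw [hX', h.fderiv_endo hy, hk.phi_phi_inner, h.fderiv_endo hy, hk.eta_phi,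
      hk.phi_phi_inner, h.inner_fst hy]
    ring
  rw [hPP, h5, h4, h.localHessian_symm hy _ (-_), h4, neg_neg, h6, h.inner_snd hy, hX',
    h.covHess_endo_endo hy] at h3
  simp only [map_neg, neg_apply, neg_neg] at h3
  linarith

end IsLocalCRWarped

end LocalWarped

/-! ### The leaves of the two factors -/

section Leaf

variable {E F V : Type*} [NormedAddCommGroup E] [NormedSpace ℝ E] [NormedAddCommGroup F]
  [NormedSpace ℝ F] [NormedAddCommGroup V] [NormedSpace ℝ V]

theorem christoffel_congr {G G' : V → V →L[ℝ] V →L[ℝ] ℝ} {y : V} (h : G =ᶠ[nhds y] G') (u v : V) :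
    christoffel G y u v = christoffel G' y u v := by
  simp only [christoffel, h.eq_of_nhds, h.fderiv_eq]

theorem IsLocalMetric.const_smul {G : V → V →L[ℝ] V →L[ℝ] ℝ} {U : Set V} (hG : IsLocalMetric G U)
    {r : ℝ} (hr : 0 < r) : IsLocalMetric (fun y => r • G y) U where
  isOpen := hG.isOpen
  contDiffOn := hG.contDiffOn.const_smul r
  symm y hy u v := by simp [hG.symm y hy u v]
  pos y hy v hv := by
    simpa using mul_pos hr (hG.pos y hy v hv)

theorem IsLocalMetric.christoffel_const_smul [FiniteDimensional ℝ V] {G : V → V →L[ℝ] V →L[ℝ] ℝ}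
    {U : Set V} (hG : IsLocalMetric G U) {r : ℝ} (hr : 0 < r) {y : V} (hy : y ∈ U) (u v : V) :
    christoffel (fun y => r • G y) y u v = christoffel G y u v := by
  have hr' := hG.const_smul hr
  apply eq_of_apply_eq (hr'.pos y hy)
  intro w
  rw [hr'.inner_christoffel hy, smul_apply, smul_apply,
    hG.inner_christoffel hy, fderiv_fun_const_smul (hG.differentiableAt hy)]
  simp
  ring

variable {G : V → V →L[ℝ] V →L[ℝ] ℝ} {ψ : E → V} {i : F → E} {L : F →L[ℝ] E} {z : F}

theorem fderiv_comp_affine (hi : ∀ z, HasFDerivAt i L z) (hψ : ContDiffAt ℝ ∞ ψ (i z)) :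
    fderiv ℝ (ψ ∘ i) z = (fderiv ℝ ψ (i z)) ∘L L :=
  ((hψ.differentiableAt (by simp)).hasFDerivAt.comp z (hi z)).fderiv

/-- The covariant second derivative of the restriction of `ψ` to an affine subspace. -/
theorem covHess_comp_affine {O : Set E} (hO : IsOpen O) (hz : i z ∈ O)
    (hi : ∀ z, HasFDerivAt i L z) (hψ : ContDiffOn ℝ ∞ ψ O) (u v : F) :
    covHess G (ψ ∘ i) z u v = covHess G ψ (i z) (L u) (L v) := by
  have hψ' : ∀ y ∈ O, ContDiffAt ℝ ∞ ψ y := fun y hy => hψ.contDiffAt (hO.mem_nhds hy)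
  have h1 : fderiv ℝ (ψ ∘ i) =ᶠ[nhds z] fun z => (fderiv ℝ ψ (i z)) ∘L L :=
    Filter.eventually_of_mem ((hi z).continuousAt.preimage_mem_nhds (hO.mem_nhds hz))
      fun x hx => fderiv_comp_affine hi (hψ' _ hx)
  have h2 : HasFDerivAt (fun z => (fderiv ℝ ψ (i z)) ∘L L) _ z :=
    ((((contDiffAt_fderiv (hψ' _ hz)).differentiableAt (by simp)).hasFDerivAt.comp z
      (hi z))).clm_comp (hasFDerivAt_const L z)
  rw [covHess, covHess, h1.fderiv_eq, h1.eq_of_nhds, h2.fderiv]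
  simp

end Leaf

section LocalWarped

variable {E₁ E₂ V : Type*} [NormedAddCommGroup E₁] [NormedSpace ℝ E₁]
  [NormedAddCommGroup E₂] [NormedSpace ℝ E₂] [NormedAddCommGroup V] [NormedSpace ℝ V]
  [FiniteDimensional ℝ E₁] [FiniteDimensional ℝ E₂] [FiniteDimensional ℝ V]

namespace IsLocalCRWarped

variable {G : V → V →L[ℝ] V →L[ℝ] ℝ} {Φ : V → V →L[ℝ] V} {ξ : V → V}
    {η : V → V →L[ℝ] ℝ} {U : Set V} {G₁ : E₁ → E₁ →L[ℝ] E₁ →L[ℝ] ℝ} {U₁ : Set E₁}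
    {G₂ : E₂ → E₂ →L[ℝ] E₂ →L[ℝ] ℝ} {U₂ : Set E₂} {ρ : E₁ → ℝ} {ψ : E₁ × E₂ → V}
    {O : Set (E₁ × E₂)} {y : E₁ × E₂}

theorem isLocalMetric_pullback (h : IsLocalCRWarped G Φ ξ η U G₁ U₁ G₂ U₂ ρ ψ O) :
    IsLocalMetric (pullback G ψ) O where
  isOpen := h.isOpen
  contDiffOn y hy := (contDiffAt_pullback h.cosymplectic.metric (h.mapsTo y hy)
    (h.contDiffAt hy)).contDiffWithinAt
  symm y hy u v := h.inner_symm hy _ _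
  pos y hy v hv := by
    rw [pullback_apply, h.isometric y hy]
    have hρ := h.warp_pos _ (h.mapsTo₁ y hy)
    have h1 := apply_self_nonneg (h.metric₁.pos _ (h.mapsTo₁ y hy)) v.1
    have h2 := apply_self_nonneg (h.metric₂.pos _ (h.mapsTo₂ y hy)) v.2
    rcases eq_or_ne v.1 0 with h3 | h3
    · have h4 : v.2 ≠ 0 := fun h4 => hv (Prod.ext h3 h4)
      have := mul_pos hρ (h.metric₂.pos _ (h.mapsTo₂ y hy) v.2 h4)
      linarith
    · have := h.metric₁.pos _ (h.mapsTo₁ y hy) v.1 h3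
      have := mul_nonneg hρ.le h2
      linarith

/-- The Levi-Civita connection of a warped product. -/
theorem christoffel_pullback (h : IsLocalCRWarped G Φ ξ η U G₁ U₁ G₂ U₂ ρ ψ O) (hy : y ∈ O)
    (u v : E₁ × E₂) : christoffel (pullback G ψ) y u v =
      (christoffel G₁ y.1 u.1 v.1 - (G₂ y.2 u.2 v.2 / 2) • (G₁ y.1).inverse (fderiv ℝ ρ y.1),
        christoffel G₂ y.2 u.2 v.2 + (fderiv ℝ ρ y.1 u.1 / (2 * ρ y.1)) • v.2
          + (fderiv ℝ ρ y.1 v.1 / (2 * ρ y.1)) • u.2) := by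
  have hp := h.isLocalMetric_pullback
  apply eq_of_apply_eq (hp.pos y hy)
  intro w
  have h1 : pullback G ψ y (christoffel (pullback G ψ) y u v) w =
      G (ψ y) (covHess G ψ y u v) (fderiv ℝ ψ y w) := by
    rw [hp.inner_christoffel hy, CRWarped.inner_covHess h.cosymplectic.metric (h.mapsTo y hy)
      (h.contDiffAt hy)]
  have hρ := (h.warp_pos _ (h.mapsTo₁ y hy)).ne'
  rw [h1, h.inner_covHess hy, pullback_apply, h.isometric y hy]
  simp only [map_sub, map_add, map_smul, sub_apply, add_apply, smul_apply, smul_eq_mul,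
    apply_inverse_of_pos (h.metric₁.pos _ (h.mapsTo₁ y hy))]
  field_simp
  ring

/-- The first factor is totally geodesic in the warped product, so the second fundamental form of
its leaves is the restriction of that of `ψ`. -/
theorem sff_fst_fst (h : IsLocalCRWarped G Φ ξ η U G₁ U₁ G₂ U₂ ρ ψ O) (hy : y ∈ O) (X Y : E₁) :
    sff G ψ y (X, 0) (Y, 0) = sff G (ψ ∘ fun z => (z, y.2)) y.1 X Y := by
  have hi : ∀ z, HasFDerivAt (fun z : E₁ => (z, y.2)) (ContinuousLinearMap.inl ℝ E₁ E₂) z :=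
    fun z => hasFDerivAt_prodMk_left z y.2
  have hO : ∀ᶠ z in nhds y.1, (z, y.2) ∈ O :=
    (hi y.1).continuousAt.preimage_mem_nhds (h.isOpen.mem_nhds hy)
  have h1 : pullback G (ψ ∘ fun z => (z, y.2)) =ᶠ[nhds y.1] G₁ := hO.mono fun z hz => by
    ext u v
    rw [pullback_apply, fderiv_comp_affine hi (h.contDiffAt hz)]
    exact h.inner_fst hz u v
  rw [sff, sff, covHess_comp_affine h.isOpen hy hi h.contDiffOn, christoffel_congr h1,
    h.christoffel_pullback hy, fderiv_comp_affine hi (h.contDiffAt hy)]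
  simp

/-- The leaves of the second factor are totally umbilical in the warped product: their second
fundamental form in the ambient space is that of `ψ` minus `g ⊗ ∇(ln √ρ)`. -/
theorem sff_snd_snd (h : IsLocalCRWarped G Φ ξ η U G₁ U₁ G₂ U₂ ρ ψ O) (hy : y ∈ O) (Z W : E₂) :
    sff G ψ y (0, Z) (0, W) = sff G (ψ ∘ fun z => (y.1, z)) y.2 Z W +
      (G₂ y.2 Z W / 2) • fderiv ℝ ψ y ((G₁ y.1).inverse (fderiv ℝ ρ y.1), 0) := by
  have hi : ∀ z, HasFDerivAt (fun z : E₂ => (y.1, z)) (ContinuousLinearMap.inr ℝ E₁ E₂) z :=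
    fun z => hasFDerivAt_prodMk_right y.1 z
  have hO : ∀ᶠ z in nhds y.2, (y.1, z) ∈ O :=
    (hi y.2).continuousAt.preimage_mem_nhds (h.isOpen.mem_nhds hy)
  have h1 : pullback G (ψ ∘ fun z => (y.1, z)) =ᶠ[nhds y.2] fun z => ρ y.1 • G₂ z :=
    hO.mono fun z hz => by
      ext u v
      rw [pullback_apply, fderiv_comp_affine hi (h.contDiffAt hz)]
      exact h.inner_snd hz u v
  rw [sff, sff, covHess_comp_affine h.isOpen hy hi h.contDiffOn, christoffel_congr h1,
    h.christoffel_pullback hy, fderiv_comp_affine hi (h.contDiffAt hy),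
    h.metric₂.christoffel_const_smul (h.warp_pos _ (h.mapsTo₁ y hy)) (h.mapsTo₂ y hy)]
  have h2 : ∀ (a : E₁) (b : E₂) (r : ℝ), ((0 - r • a, b) : E₁ × E₂) = (0, b) - r • (a, 0) :=
    fun a b r => by simp
  simp only [christoffel_zero_left, map_zero, zero_div, zero_smul, add_zero, h2, map_sub, map_smul,
    ContinuousLinearMap.inr_apply, ContinuousLinearMap.comp_apply]
  abel

theorem inner_sff_tangent (h : IsLocalCRWarped G Φ ξ η U G₁ U₁ G₂ U₂ ρ ψ O) (hy : y ∈ O)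
    (u v w : E₁ × E₂) : G (ψ y) (sff G ψ y u v) (fderiv ℝ ψ y w) = 0 := by
  have h1 : pullback G ψ y (christoffel (pullback G ψ) y u v) w =
      G (ψ y) (covHess G ψ y u v) (fderiv ℝ ψ y w) := by
    rw [h.isLocalMetric_pullback.inner_christoffel hy, CRWarped.inner_covHess
      h.cosymplectic.metric (h.mapsTo y hy) (h.contDiffAt hy)]
  rw [sff, map_sub, sub_apply, ← h1, pullback_apply, sub_self]

theorem sff_symm (h : IsLocalCRWarped G Φ ξ η U G₁ U₁ G₂ U₂ ρ ψ O) (hy : y ∈ O)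
    (u v : E₁ × E₂) : sff G ψ y u v = sff G ψ y v u := by
  rw [sff, sff, h.covHess_symm hy, h.isLocalMetric_pullback.christoffel_symm hy]

/-- The tangential part `X(ln √ρ) Z` of `∇_X Z` is subtracted from it. -/
theorem inner_sff_fst_snd (h : IsLocalCRWarped G Φ ξ η U G₁ U₁ G₂ U₂ ρ ψ O) (hy : y ∈ O)
    (X : E₁) (Z : E₂) :
    G (ψ y) (sff G ψ y (X, 0) (0, Z)) (sff G ψ y (X, 0) (0, Z)) =
      G (ψ y) (covHess G ψ y (0, Z) (X, 0)) (covHess G ψ y (0, Z) (X, 0))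
        - fderiv ℝ ρ y.1 X ^ 2 * G₂ y.2 Z Z / (4 * ρ y.1) := by
  have hρ := (h.warp_pos _ (h.mapsTo₁ y hy)).ne'
  have h1 : sff G ψ y (X, 0) (0, Z) = covHess G ψ y (0, Z) (X, 0)
      - (fderiv ℝ ρ y.1 X / (2 * ρ y.1)) • fderiv ℝ ψ y (0, Z) := by
    rw [sff, h.covHess_symm hy, ← map_smul, h.christoffel_pullback hy]
    simp
  have h3 := h.inner_sff_tangent hy (X, 0) (0, Z) (0, Z)
  have h4 : ∀ a b : V, ∀ r : ℝ, G (ψ y) (a - r • b) b = 0 →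
      G (ψ y) (a - r • b) (a - r • b) = G (ψ y) a a - r * G (ψ y) a b := fun a b r hab => by
    rw [map_sub, map_smul, hab, map_sub, sub_apply, map_smul, smul_apply, h.inner_symm hy b a]
    simp
  rw [h1] at h3 ⊢
  rw [h4 _ _ _ h3, h.inner_covHess_snd hy]
  field_simp
  ring

end IsLocalCRWarped

end LocalWarped

/-! ### The mixed part of the second fundamental form -/

/-- For a skew endomorphism `P` with `H(x, P² y) = -H(x, y)`, the forms `H` and `H(P ·, P ·)` have
the same trace. -/
theorem IsOrthonormalBasis.sum_skew {V ι : Type*} [AddCommGroup V] [Module ℝ V] [Fintype ι]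
    [DecidableEq ι] {B : V →ₗ[ℝ] V →ₗ[ℝ] ℝ} {b : Module.Basis ι ℝ V}
    (hb : IsOrthonormalBasis (fun u v => B u v) b) {P : V →ₗ[ℝ] V}
    (hP : ∀ u v, B (P u) v = -B u (P v)) {H : V →ₗ[ℝ] V →ₗ[ℝ] ℝ}
    (hH : ∀ u v, H u (P (P v)) = -H u v) :
    ∑ i, H (P (b i)) (P (b i)) = ∑ i, H (b i) (b i) := by
  have h1 : ∀ i, H (P (b i)) (P (b i)) = -∑ j, B (b i) (P (b j)) * H (b j) (P (b i)) := fun i => by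
    rw [← LinearMap.flip_apply H, hb.apply_eq_sum (H.flip (P (b i))) (P (b i)),
      ← Finset.sum_neg_distrib]
    refine Finset.sum_congr rfl fun j _ => ?_
    rw [← hb.symm, hP]
    simp
  have h2 : ∀ j, H (b j) (b j) = -∑ i, B (b i) (P (b j)) * H (b j) (P (b i)) := fun j => by
    rw [← neg_eq_iff_eq_neg, ← hH]
    exact hb.apply_eq_sum ((H (b j)).comp P) (P (b j))
  simp only [h1, h2, Finset.sum_neg_distrib]
  rw [Finset.sum_comm]

section Hessian

variable {E : Type*} [NormedAddCommGroup E] [NormedSpace ℝ E]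

/-- The Hessian of a function as a bilinear form. -/
def localHessianL (G : E → E →L[ℝ] E →L[ℝ] ℝ) (ρ : E → ℝ) (y : E) : E →ₗ[ℝ] E →ₗ[ℝ] ℝ :=
  LinearMap.mk₂ ℝ (fun u v => fderiv ℝ (fderiv ℝ ρ) y u v - fderiv ℝ ρ y (christoffelL G y u v))
    (fun _ _ _ => by simp; ring) (fun _ _ _ => by simp; ring)
    (fun _ _ _ => by simp; ring) (fun _ _ _ => by simp; ring)

theorem localHessianL_apply (G : E → E →L[ℝ] E →L[ℝ] ℝ) (ρ : E → ℝ) (y u v : E) :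
    localHessianL G ρ y u v = localHessian G ρ y u v := by
  simp [localHessianL, localHessian, christoffelL_apply]

theorem fderiv_exp_two_mul {ℓ ρ : E → ℝ} {y : E} (hℓ : DifferentiableAt ℝ ℓ y)
    (h : ρ =ᶠ[nhds y] fun z => Real.exp (2 * ℓ z)) :
    fderiv ℝ ρ y = (2 * ρ y) • fderiv ℝ ℓ y := by
  rw [h.fderiv_eq, h.eq_of_nhds, ((hℓ.hasFDerivAt.const_mul 2).exp).fderiv, smul_smul, mul_comm]

theorem localHessian_exp_two_mul (G : E → E →L[ℝ] E →L[ℝ] ℝ) {ℓ ρ : E → ℝ} {y : E}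
    (hℓ : ContDiffAt ℝ ∞ ℓ y) (h : ρ =ᶠ[nhds y] fun z => Real.exp (2 * ℓ z)) (u v : E) :
    localHessian G ρ y u v =
      2 * ρ y * (localHessian G ℓ y u v + 2 * (fderiv ℝ ℓ y u * fderiv ℝ ℓ y v)) := by
  have hd : DifferentiableAt ℝ ℓ y := hℓ.differentiableAt (by simp)
  have hρ : DifferentiableAt ℝ ρ y :=
    ((hd.const_mul 2).exp).congr_of_eventuallyEq h
  have h1 : fderiv ℝ ρ =ᶠ[nhds y] fun z => (2 * ρ z) • fderiv ℝ ℓ z := by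
    have h2 : ∀ᶠ z in nhds y, DifferentiableAt ℝ ℓ z :=
      ((hℓ.of_le (m := 1) (by simp)).eventually (by simp)).mono
        fun z hz => hz.differentiableAt (by simp)
    filter_upwards [h.eventually_nhds, h2] with z hz hz2
    exact fderiv_exp_two_mul hz2 hz
  have h3 : HasFDerivAt (fun z => (2 * ρ z) • fderiv ℝ ℓ z) _ y :=
    (hρ.hasFDerivAt.const_mul 2).smul
      (((contDiffAt_fderiv hℓ).differentiableAt (by simp)).hasFDerivAt)
  rw [localHessian, localHessian, h1.fderiv_eq, h3.fderiv, fderiv_exp_two_mul hd h]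
  simp only [add_apply, smul_apply, ContinuousLinearMap.smulRight_apply, smul_eq_mul]
  ring

end Hessian

section LocalWarped

variable {E₁ E₂ V : Type*} [NormedAddCommGroup E₁] [NormedSpace ℝ E₁]
  [NormedAddCommGroup E₂] [NormedSpace ℝ E₂] [NormedAddCommGroup V] [NormedSpace ℝ V]
  [FiniteDimensional ℝ E₁] [FiniteDimensional ℝ E₂] [FiniteDimensional ℝ V]

namespace IsLocalCRWarped

variable {G : V → V →L[ℝ] V →L[ℝ] ℝ} {Φ : V → V →L[ℝ] V} {ξ : V → V}
    {η : V → V →L[ℝ] ℝ} {U : Set V} {G₁ : E₁ → E₁ →L[ℝ] E₁ →L[ℝ] ℝ} {U₁ : Set E₁}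
    {G₂ : E₂ → E₂ →L[ℝ] E₂ →L[ℝ] ℝ} {U₂ : Set E₂} {ρ : E₁ → ℝ} {ψ : E₁ × E₂ → V}
    {O : Set (E₁ × E₂)} {y : E₁ × E₂}

/-- The field `ξ` is a unit vector tangent to the first factor. -/
theorem sum_eta_sq (h : IsLocalCRWarped G Φ ξ η U G₁ U₁ G₂ U₂ ρ ψ O) (hy : y ∈ O)
    {ι : Type*} [Fintype ι] [DecidableEq ι] {b : Module.Basis ι ℝ E₁}
    (hb : IsOrthonormalBasis (fun u v => toBilin (G₁ y.1) u v) b) :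
    ∑ i, η (ψ y) (fderiv ℝ ψ y (b i, 0)) ^ 2 = 1 := by
  obtain ⟨k, hk⟩ := h.xi_tangent y hy
  have hc := h.contact hy
  have h1 : ∀ X, η (ψ y) (fderiv ℝ ψ y (X, 0)) = toBilin (G₁ y.1) X k := fun X => by
    rw [← hc.inner_xi, ← hk, h.inner_fst hy, toBilin_apply]
  have h2 : toBilin (G₁ y.1) k k = 1 := by
    rw [← h1, hk, hc.eta_xi]
  rw [← h2, hb.apply_eq_sum (toBilin (G₁ y.1) k) k]
  refine Finset.sum_congr rfl fun i _ => ?_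
  rw [h1, hb.symm k, smul_eq_mul, sq]

/-- The sum of the squares of the mixed components of the second fundamental form depends on the
warping function only. -/
theorem sum_inner_sff_fst_snd (h : IsLocalCRWarped G Φ ξ η U G₁ U₁ G₂ U₂ ρ ψ O) (hy : y ∈ O) {c : ℝ}
    (hc : ∀ u, u ≠ 0 → η (ψ y) u = 0 →
      G (ψ y) (localCurvature G (ψ y) u (Φ (ψ y) u) (Φ (ψ y) u)) u
      / (G (ψ y) u u * G (ψ y) (Φ (ψ y) u) (Φ (ψ y) u) - G (ψ y) u (Φ (ψ y) u) ^ 2) = c)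
    {ℓ : E₁ → ℝ} (hℓ : ContDiffAt ℝ ∞ ℓ y.1) (hρ : ρ =ᶠ[nhds y.1] fun z => Real.exp (2 * ℓ z))
    {ι κ : Type*} [Fintype ι] [DecidableEq ι] [Fintype κ] [DecidableEq κ]
    {b₁ : Module.Basis ι ℝ E₁} {b₂ : Module.Basis κ ℝ E₂}
    (hb₁ : IsOrthonormalBasis (fun u v => toBilin (G₁ y.1) u v) b₁)
    (hb₂ : IsOrthonormalBasis (fun u v => toBilin (ρ y.1 • G₂ y.2) u v) b₂) :
    ∑ i, ∑ j, G (ψ y) (sff G ψ y (b₁ i, 0) (0, b₂ j)) (sff G ψ y (b₁ i, 0) (0, b₂ j)) =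
      Fintype.card κ * (∑ i, localHessian G₁ ℓ y.1 (b₁ i) (b₁ i)
        + ∑ i, fderiv ℝ ℓ y.1 (b₁ i) ^ 2 + (Fintype.card ι - 1) * c / 4) := by
  have hpos := (h.warp_pos _ (h.mapsTo₁ y hy)).ne'
  have hd := fderiv_exp_two_mul (hℓ.differentiableAt (by simp)) hρ
  have hG₂ : ∀ j, G₂ y.2 (b₂ j) (b₂ j) = 1 / ρ y.1 := fun j => by
    have := hb₂.apply_eq j j
    simp only [toBilin_apply, smul_apply, smul_eq_mul, if_true] at this
    rw [eq_div_iff hpos, mul_comm, this]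
  set P := endo G Φ G₁ ψ y with hP
  have h1 : ∀ i j, G (ψ y) (sff G ψ y (b₁ i, 0) (0, b₂ j)) (sff G ψ y (b₁ i, 0) (0, b₂ j)) =
      (localHessian G₁ ρ y.1 (b₁ i) (b₁ i) + localHessian G₁ ρ y.1 (P (b₁ i)) (P (b₁ i)))
        / (4 * ρ y.1)
      + c / 4 * (1 - η (ψ y) (fderiv ℝ ψ y (b₁ i, 0)) ^ 2) - fderiv ℝ ℓ y.1 (b₁ i) ^ 2 := by
    intro i j
    have hb := hb₁.apply_eq i i
    simp only [toBilin_apply, if_true] at hb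
    rw [h.inner_sff_fst_snd hy, h.inner_covHess_self hy hc _ (b₂.ne_zero j), hG₂, hb, hd, hP]
    simp only [smul_apply, smul_eq_mul]
    field_simp
    ring
  -- the symmetry of the Hessian under `P²` needs a nonzero vector of the second factor
  rcases isEmpty_or_nonempty κ with hκ | ⟨⟨j₀⟩⟩
  · simp
  have h2 := hb₁.sum_skew (P := (P : E₁ →ₗ[ℝ] E₁)) (H := localHessianL G₁ ρ y.1)
    (fun u v => h.endo_skew hy u v) (fun u v => by
      simp only [localHessianL_apply]
      exact h.localHessian_endo_endo hy (b₂.ne_zero j₀) u v)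
  simp only [localHessianL_apply, ContinuousLinearMap.coe_coe] at h2
  simp only [h1, Finset.sum_const, Finset.card_univ, nsmul_eq_mul, ← Finset.mul_sum]
  congr 1
  rw [Finset.sum_sub_distrib, Finset.sum_add_distrib, ← Finset.sum_div, Finset.sum_add_distrib, h2,
    ← Finset.mul_sum, Finset.sum_sub_distrib, h.sum_eta_sq hy hb₁]
  simp only [localHessian_exp_two_mul G₁ hℓ hρ, ← Finset.mul_sum, Finset.sum_add_distrib, ← sq]
  simp only [Finset.sum_const, Finset.card_univ, nsmul_eq_mul]
  field_simp
  ring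

end IsLocalCRWarped

end LocalWarped

/-! ### The inequality and its equality case in coordinates -/

section NormSq

variable {E V : Type*} [NormedAddCommGroup E] [NormedSpace ℝ E]
  [NormedAddCommGroup V] [NormedSpace ℝ V]

/-- The second fundamental form as a bilinear map. -/
def sffL (G : V → V →L[ℝ] V →L[ℝ] ℝ) (ψ : E → V) (y : E) : E →ₗ[ℝ] E →ₗ[ℝ] V :=
  LinearMap.mk₂ ℝ
    (fun u v => covHessL G ψ y u v - fderiv ℝ ψ y (christoffelL (pullback G ψ) y u v))
    (fun _ _ _ => by simp only [map_add, add_apply]; abel)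
    (fun _ _ _ => by simp only [map_smul, smul_apply, smul_sub])
    (fun _ _ _ => by simp only [map_add]; abel)
    (fun _ _ _ => by simp only [map_smul, smul_sub])

theorem sffL_apply (G : V → V →L[ℝ] V →L[ℝ] ℝ) (ψ : E → V) (y u v : E) :
    sffL G ψ y u v = sff G ψ y u v := by
  simp [sffL, sff, covHessL_apply, christoffelL_apply]

theorem metricTrace_metricTrace_eq_sum {ι : Type*} [Fintype ι] [DecidableEq ι]
    {B : E →ₗ[ℝ] E →ₗ[ℝ] ℝ} {b : Module.Basis ι ℝ E}
    (hb : IsOrthonormalBasis (fun u v => B u v) b) (g : V →L[ℝ] V →L[ℝ] ℝ)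
    (S : E →ₗ[ℝ] E →ₗ[ℝ] V) :
    metricTrace (fun u v => B u v) (fun u u' => metricTrace (fun u v => B u v)
      fun v v' => g (S u v) (S u' v')) = ∑ i, ∑ j, g (S (b i) (b j)) (S (b i) (b j)) := by
  have h1 : ∀ u u', metricTrace (fun u v => B u v) (fun v v' => g (S u v) (S u' v')) =
      ∑ j, g (S u (b j)) (S u' (b j)) := fun u u' =>
    metricTrace_eq_sum hb ((toBilin g).compl₁₂ (S u) (S u'))
  simp only [h1]
  have h2 := metricTrace_eq_sum hb
    (∑ j, (toBilin g).compl₁₂ (S.flip (b j)) (S.flip (b j)))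
  simpa using h2

/-- The squared norm of the second fundamental form at the coordinate point `y`. -/
def sffNormSq (G : V → V →L[ℝ] V →L[ℝ] ℝ) (ψ : E → V) (y : E) : ℝ :=
  metricTrace (fun u v => pullback G ψ y u v) fun u u' =>
    metricTrace (fun u v => pullback G ψ y u v) fun v v' =>
      G (ψ y) (sff G ψ y u v) (sff G ψ y u' v')

/-- The mean curvature vector at the coordinate point `y`. -/
def meanCurv (G : V → V →L[ℝ] V →L[ℝ] ℝ) (ψ : E → V) (y : E) :
    V :=
  ((Module.finrank ℝ E : ℝ)⁻¹) • metricTrace (fun u v => pullback G ψ y u v) (sff G ψ y)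

end NormSq

section LocalWarped

variable {E₁ E₂ V : Type*} [NormedAddCommGroup E₁] [NormedSpace ℝ E₁]
  [NormedAddCommGroup E₂] [NormedSpace ℝ E₂] [NormedAddCommGroup V] [NormedSpace ℝ V]
  [FiniteDimensional ℝ E₁] [FiniteDimensional ℝ E₂] [FiniteDimensional ℝ V]

namespace IsLocalCRWarped

variable {G : V → V →L[ℝ] V →L[ℝ] ℝ} {Φ : V → V →L[ℝ] V} {ξ : V → V}
    {η : V → V →L[ℝ] ℝ} {U : Set V} {G₁ : E₁ → E₁ →L[ℝ] E₁ →L[ℝ] ℝ} {U₁ : Set E₁}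
    {G₂ : E₂ → E₂ →L[ℝ] E₂ →L[ℝ] ℝ} {U₂ : Set E₂} {ρ : E₁ → ℝ} {ψ : E₁ × E₂ → V}
    {O : Set (E₁ × E₂)} {y : E₁ × E₂}

theorem exists_basis_fst (h : IsLocalCRWarped G Φ ξ η U G₁ U₁ G₂ U₂ ρ ψ O) (hy : y ∈ O) :
    ∃ b : Module.Basis (Fin (Module.finrank ℝ E₁)) ℝ E₁,
      IsOrthonormalBasis (fun u v => toBilin (G₁ y.1) u v) b :=
  exists_isOrthonormalBasis _ (h.metric₁.symm _ (h.mapsTo₁ y hy))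
    (h.metric₁.pos _ (h.mapsTo₁ y hy))

theorem exists_basis_snd (h : IsLocalCRWarped G Φ ξ η U G₁ U₁ G₂ U₂ ρ ψ O) (hy : y ∈ O) :
    ∃ b : Module.Basis (Fin (Module.finrank ℝ E₂)) ℝ E₂,
      IsOrthonormalBasis (fun u v => toBilin (ρ y.1 • G₂ y.2) u v) b :=
  have h1 := h.metric₂.const_smul (h.warp_pos _ (h.mapsTo₁ y hy))
  exists_isOrthonormalBasis _ (h1.symm _ (h.mapsTo₂ y hy)) (h1.pos _ (h.mapsTo₂ y hy))

theorem isOrthonormalBasis_prod (h : IsLocalCRWarped G Φ ξ η U G₁ U₁ G₂ U₂ ρ ψ O) (hy : y ∈ O)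
    {ι κ : Type*} [DecidableEq ι] [DecidableEq κ]
    {b₁ : Module.Basis ι ℝ E₁} {b₂ : Module.Basis κ ℝ E₂}
    (hb₁ : IsOrthonormalBasis (fun u v => toBilin (G₁ y.1) u v) b₁)
    (hb₂ : IsOrthonormalBasis (fun u v => toBilin (ρ y.1 • G₂ y.2) u v) b₂) :
    IsOrthonormalBasis (fun u v => toBilin (pullback G ψ y) u v) (b₁.prod b₂) :=
  hb₁.prod hb₂ (h.inner_fst hy) (h.inner_snd hy) (h.inner_fst_snd hy)
    (fun u v => by
      rw [toBilin_apply, pullback_apply, h.inner_symm hy, h.inner_fst_snd hy])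

/-- The mixed components of the second fundamental form count twice, by symmetry. -/
theorem sffNormSq_eq (h : IsLocalCRWarped G Φ ξ η U G₁ U₁ G₂ U₂ ρ ψ O) (hy : y ∈ O)
    {ι κ : Type*} [Fintype ι] [DecidableEq ι] [Fintype κ] [DecidableEq κ]
    {b₁ : Module.Basis ι ℝ E₁} {b₂ : Module.Basis κ ℝ E₂}
    (hb₁ : IsOrthonormalBasis (fun u v => toBilin (G₁ y.1) u v) b₁)
    (hb₂ : IsOrthonormalBasis (fun u v => toBilin (ρ y.1 • G₂ y.2) u v) b₂) :
    sffNormSq G ψ y =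
      ∑ i, ∑ j, G (ψ y) (sff G ψ y (b₁ i, 0) (b₁ j, 0)) (sff G ψ y (b₁ i, 0) (b₁ j, 0))
      + ∑ i, ∑ j, G (ψ y) (sff G ψ y (0, b₂ i) (0, b₂ j)) (sff G ψ y (0, b₂ i) (0, b₂ j))
      + 2 * ∑ i, ∑ j, G (ψ y) (sff G ψ y (b₁ i, 0) (0, b₂ j)) (sff G ψ y (b₁ i, 0) (0, b₂ j)) := by
  have h1 := metricTrace_metricTrace_eq_sum (h.isOrthonormalBasis_prod hy hb₁ hb₂) (G (ψ y))
    (sffL G ψ y)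
  simp only [sffL_apply, toBilin_apply] at h1
  have h2 : ∑ i, ∑ j, G (ψ y) (sff G ψ y (0, b₂ i) (b₁ j, 0)) (sff G ψ y (0, b₂ i) (b₁ j, 0)) =
      ∑ i, ∑ j, G (ψ y) (sff G ψ y (b₁ i, 0) (0, b₂ j)) (sff G ψ y (b₁ i, 0) (0, b₂ j)) := by
    rw [Finset.sum_comm]
    refine Finset.sum_congr rfl fun i _ => Finset.sum_congr rfl fun j _ => ?_
    rw [h.sff_symm hy]
  rw [sffNormSq, h1]
  simp only [Fintype.sum_sum_type, Finset.sum_add_distrib, Module.Basis.prod_apply, Sum.elim_inl,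
    Sum.elim_inr, Function.comp_apply, LinearMap.inl_apply, LinearMap.inr_apply, h2]
  ring

/-- The lower bound for the squared norm of the second fundamental form, in coordinates, with the
discussion of equality. Here `ℓ` is the logarithm of the warping function `√ρ`, and `N` and `L` are
the squared norm of its gradient and its Laplacian. -/
theorem le_sffNormSq (h : IsLocalCRWarped G Φ ξ η U G₁ U₁ G₂ U₂ ρ ψ O) (hy : y ∈ O) {c : ℝ}
    (hc : ∀ u, u ≠ 0 → η (ψ y) u = 0 →
      G (ψ y) (localCurvature G (ψ y) u (Φ (ψ y) u) (Φ (ψ y) u)) u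
      / (G (ψ y) u u * G (ψ y) (Φ (ψ y) u) (Φ (ψ y) u) - G (ψ y) u (Φ (ψ y) u) ^ 2) = c)
    {ℓ : E₁ → ℝ} (hℓ : ContDiffAt ℝ ∞ ℓ y.1) (hρ : ρ =ᶠ[nhds y.1] fun z => Real.exp (2 * ℓ z))
    {N L : ℝ} (hN : N = G₁ y.1 ((G₁ y.1).inverse (fderiv ℝ ℓ y.1))
      ((G₁ y.1).inverse (fderiv ℝ ℓ y.1)))
    (hL : L = -metricTrace (fun u v => G₁ y.1 u v) (localHessian G₁ ℓ y.1)) :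
    2 * (Module.finrank ℝ E₂ : ℝ) * (N - L + ((Module.finrank ℝ E₁ : ℝ) - 1) * c / 4)
        ≤ sffNormSq G ψ y ∧
      (sffNormSq G ψ y =
        2 * (Module.finrank ℝ E₂ : ℝ) * (N - L + ((Module.finrank ℝ E₁ : ℝ) - 1) * c / 4) ↔
        (∀ X Y, sff G ψ y (X, 0) (Y, 0) = 0) ∧ ∀ Z W, sff G ψ y (0, Z) (0, W) = 0) := by
  obtain ⟨b₁, hb₁⟩ := h.exists_basis_fst hy
  obtain ⟨b₂, hb₂⟩ := h.exists_basis_snd hy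
  have hN' : N = ∑ i, fderiv ℝ ℓ y.1 (b₁ i) ^ 2 := by
    have hp := h.metric₁.pos _ (h.mapsTo₁ y hy)
    set v := (G₁ y.1).inverse (fderiv ℝ ℓ y.1) with hv
    have h1 : ∀ w, toBilin (G₁ y.1) v w = fderiv ℝ ℓ y.1 w := fun w => by
      rw [toBilin_apply, hv, apply_inverse_of_pos hp]
    have h2 := hb₁.apply_eq_sum (toBilin (G₁ y.1) v) v
    rw [hN, ← toBilin_apply, h2]
    refine Finset.sum_congr rfl fun i _ => ?_
    rw [hb₁.symm, h1, smul_eq_mul, sq]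
  have hL' : L = -∑ i, localHessian G₁ ℓ y.1 (b₁ i) (b₁ i) := by
    have := metricTrace_eq_sum hb₁ (localHessianL G₁ ℓ y.1)
    simp only [localHessianL_apply, toBilin_apply] at this
    rw [hL, ← this]
  have h1 := h.sffNormSq_eq hy hb₁ hb₂
  rw [h.sum_inner_sff_fst_snd hy hc hℓ hρ hb₁ hb₂, Fintype.card_fin, Fintype.card_fin] at h1
  have h2 : sffNormSq G ψ y =
      ∑ i, ∑ j, G (ψ y) (sff G ψ y (b₁ i, 0) (b₁ j, 0)) (sff G ψ y (b₁ i, 0) (b₁ j, 0))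
      + ∑ i, ∑ j, G (ψ y) (sff G ψ y (0, b₂ i) (0, b₂ j)) (sff G ψ y (0, b₂ i) (0, b₂ j))
      + 2 * (Module.finrank ℝ E₂ : ℝ) * (N - L + ((Module.finrank ℝ E₁ : ℝ) - 1) * c / 4) := by
    rw [h1, hN', hL']
    ring
  have hn : ∀ v, 0 ≤ G (ψ y) v v := apply_self_nonneg (h.pos hy)
  have hTT : 0 ≤ ∑ i, ∑ j,
      G (ψ y) (sff G ψ y (b₁ i, 0) (b₁ j, 0)) (sff G ψ y (b₁ i, 0) (b₁ j, 0)) :=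
    Finset.sum_nonneg fun i _ => Finset.sum_nonneg fun j _ => hn _
  have hPP : 0 ≤ ∑ i, ∑ j,
      G (ψ y) (sff G ψ y (0, b₂ i) (0, b₂ j)) (sff G ψ y (0, b₂ i) (0, b₂ j)) :=
    Finset.sum_nonneg fun i _ => Finset.sum_nonneg fun j _ => hn _
  refine ⟨by linarith, fun heq => ?_, fun ⟨h3, h4⟩ => ?_⟩
  · have h3 := (Finset.sum_eq_zero_iff_of_nonneg fun i _ => Finset.sum_nonneg fun j _ => hn _).1
      (le_antisymm (by linarith) hTT)
    have h4 := (Finset.sum_eq_zero_iff_of_nonneg fun i _ => Finset.sum_nonneg fun j _ => hn _).1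
      (le_antisymm (by linarith) hPP)
    have h5 : ∀ i j, sff G ψ y (b₁ i, 0) (b₁ j, 0) = 0 := fun i j =>
      eq_zero_of_apply_self (h.pos hy) ((Finset.sum_eq_zero_iff_of_nonneg fun j _ => hn _).1
        (h3 i (Finset.mem_univ i)) j (Finset.mem_univ j))
    have h6 : ∀ i j, sff G ψ y (0, b₂ i) (0, b₂ j) = 0 := fun i j =>
      eq_zero_of_apply_self (h.pos hy) ((Finset.sum_eq_zero_iff_of_nonneg fun j _ => hn _).1
        (h4 i (Finset.mem_univ i)) j (Finset.mem_univ j))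
    have h7 : (sffL G ψ y).compl₁₂ (LinearMap.inl ℝ E₁ E₂) (LinearMap.inl ℝ E₁ E₂) = 0 :=
      b₁.ext fun i => b₁.ext fun j => by simp [sffL_apply, h5]
    have h8 : (sffL G ψ y).compl₁₂ (LinearMap.inr ℝ E₁ E₂) (LinearMap.inr ℝ E₁ E₂) = 0 :=
      b₂.ext fun i => b₂.ext fun j => by simp [sffL_apply, h6]
    refine ⟨fun X Y => ?_, fun Z W => ?_⟩
    · simpa [sffL_apply] using DFunLike.congr_fun (DFunLike.congr_fun h7 X) Y
    · simpa [sffL_apply] using DFunLike.congr_fun (DFunLike.congr_fun h8 Z) W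
  · rw [h2]
    simp [h3, h4]

/-- In a contact CR-warped product, the second fundamental form vanishes on both factors exactly
when the leaves of the first one are totally geodesic, those of the second one are totally umbilical
and the submanifold is minimal (all conditions at one point). -/
theorem sff_eq_zero_iff (h : IsLocalCRWarped G Φ ξ η U G₁ U₁ G₂ U₂ ρ ψ O) (hy : y ∈ O) :
    ((∀ X Y, sff G ψ y (X, 0) (Y, 0) = 0) ∧ ∀ Z W, sff G ψ y (0, Z) (0, W) = 0) ↔
      (∀ X Y, sff G (ψ ∘ fun z => (z, y.2)) y.1 X Y = 0) ∧
      (∀ Z W, sff G (ψ ∘ fun z => (y.1, z)) y.2 Z W =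
        pullback G (ψ ∘ fun z => (y.1, z)) y.2 Z W • meanCurv G (ψ ∘ fun z => (y.1, z)) y.2) ∧
      meanCurv G ψ y = 0 := by
  obtain ⟨b₁, hb₁⟩ := h.exists_basis_fst hy
  obtain ⟨b₂, hb₂⟩ := h.exists_basis_snd hy
  have hpos := h.warp_pos _ (h.mapsTo₁ y hy)
  have hi : ∀ z, HasFDerivAt (fun z : E₂ => (y.1, z)) (ContinuousLinearMap.inr ℝ E₁ E₂) z :=
    fun z => hasFDerivAt_prodMk_right y.1 z
  have hpull : ∀ Z W, pullback G (ψ ∘ fun z => (y.1, z)) y.2 Z W =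
      toBilin (ρ y.1 • G₂ y.2) Z W := fun Z W => by
    rw [pullback_apply, fderiv_comp_affine hi (h.contDiffAt hy)]
    exact h.inner_snd hy Z W
  -- the mean curvature vectors as sums over orthonormal bases
  have hm₂ : meanCurv G (ψ ∘ fun z => (y.1, z)) y.2 = ((Module.finrank ℝ E₂ : ℝ)⁻¹) •
      ∑ j, sff G (ψ ∘ fun z => (y.1, z)) y.2 (b₂ j) (b₂ j) := by
    have h1 := metricTrace_eq_sum hb₂ (sffL G (ψ ∘ fun z => (y.1, z)) y.2)
    simp only [sffL_apply] at h1
    simp only [meanCurv, hpull]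
    rw [← h1]
  have hm : meanCurv G ψ y = ((Module.finrank ℝ (E₁ × E₂) : ℝ)⁻¹) •
      (∑ i, sff G ψ y (b₁ i, 0) (b₁ i, 0) + ∑ j, sff G ψ y (0, b₂ j) (0, b₂ j)) := by
    have h1 := metricTrace_eq_sum (h.isOrthonormalBasis_prod hy hb₁ hb₂) (sffL G ψ y)
    simp only [sffL_apply, Fintype.sum_sum_type, Module.Basis.prod_apply, Sum.elim_inl,
      Sum.elim_inr, Function.comp_apply, LinearMap.inl_apply, LinearMap.inr_apply] at h1
    rw [meanCurv, ← h1]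
    rfl
  have hb₂' : ∀ j, toBilin (ρ y.1 • G₂ y.2) (b₂ j) (b₂ j) = 1 := fun j => by
    simpa using hb₂.apply_eq j j
  have hT : ∀ X Y, sff G ψ y (X, 0) (Y, 0) = sff G (ψ ∘ fun z => (z, y.2)) y.1 X Y :=
    h.sff_fst_fst hy
  -- `sff` on the second factor differs from that of the leaf by a multiple of the metric
  set K := (1 / (2 * ρ y.1)) • fderiv ℝ ψ y ((G₁ y.1).inverse (fderiv ℝ ρ y.1), 0) with hK
  have hP : ∀ Z W, sff G ψ y (0, Z) (0, W) = sff G (ψ ∘ fun z => (y.1, z)) y.2 Z W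
      + toBilin (ρ y.1 • G₂ y.2) Z W • K := fun Z W => by
    rw [h.sff_snd_snd hy, hK, smul_smul]
    congr 2
    simp only [toBilin_apply, smul_apply, smul_eq_mul]
    field_simp
  simp only [hT, hpull]
  -- without a second factor the mean curvature of its leaves carries no information
  rcases Nat.eq_zero_or_pos (Module.finrank ℝ E₂) with h0 | h0
  · have : Subsingleton E₂ := Module.finrank_zero_iff.1 h0
    have hz : ∀ Z : E₂, Z = 0 := fun Z => Subsingleton.elim _ _
    have h1 : ∀ Z W, sff G (ψ ∘ fun z => (y.1, z)) y.2 Z W = 0 := fun Z W => by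
      rw [hz Z, ← sffL_apply]; simp
    have h2 : ∀ Z W, sff G ψ y (0, Z) (0, W) = 0 := fun Z W => by
      rw [hP, h1, hz Z]; simp
    refine ⟨fun ⟨h3, _⟩ => ⟨h3, fun Z W => by rw [h1, hz Z]; simp, ?_⟩, fun ⟨h3, _⟩ => ⟨h3, h2⟩⟩
    rw [hm]
    simp [hT, h3, h2]
  have hn₂ : (Module.finrank ℝ E₂ : ℝ) ≠ 0 := by exact_mod_cast h0.ne'
  constructor
  · rintro ⟨h1, h2⟩
    have h3 : ∀ Z W, sff G (ψ ∘ fun z => (y.1, z)) y.2 Z W =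
        toBilin (ρ y.1 • G₂ y.2) Z W • (-K) := fun Z W => by
      rw [smul_neg]
      exact eq_neg_of_add_eq_zero_left ((hP Z W).symm.trans (h2 Z W))
    have h4 : meanCurv G (ψ ∘ fun z => (y.1, z)) y.2 = -K := by
      simp only [hm₂, h3, hb₂', one_smul]
      rw [Finset.sum_const, Finset.card_univ, Fintype.card_fin, ← Nat.cast_smul_eq_nsmul ℝ,
        smul_smul, inv_mul_cancel₀ hn₂, one_smul]
    refine ⟨h1, fun Z W => by rw [h3, h4], ?_⟩
    rw [hm]
    simp [hT, h1, h2]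
  · rintro ⟨h1, h2, h3⟩
    refine ⟨h1, ?_⟩
    set K' := meanCurv G (ψ ∘ fun z => (y.1, z)) y.2 with hK'
    have h4 : ∀ Z W, sff G ψ y (0, Z) (0, W) = toBilin (ρ y.1 • G₂ y.2) Z W • (K' + K) :=
      fun Z W => by rw [hP, h2, smul_add]
    -- `sff` on the second factor is a multiple of the metric, and minimality makes it trace free
    have hn : (Module.finrank ℝ (E₁ × E₂) : ℝ) ≠ 0 := by
      rw [Module.finrank_prod]
      exact_mod_cast (by omega)
    simp only [hm, hT, h1, h4, hb₂', one_smul, Finset.sum_const_zero, zero_add] at h3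
    rw [Finset.sum_const, Finset.card_univ, Fintype.card_fin, ← Nat.cast_smul_eq_nsmul ℝ,
      smul_smul] at h3
    have h5 := (smul_eq_zero.1 h3).resolve_left (mul_ne_zero (inv_ne_zero hn) hn₂)
    intro Z W
    rw [h4, h5, smul_zero]

end IsLocalCRWarped

end LocalWarped

/-! ### Tensor fields in preferred charts -/

section Chart

variable {E : Type*} [NormedAddCommGroup E] [NormedSpace ℝ E]
  {H : Type*} [TopologicalSpace H] {I : ModelWithCorners ℝ E H} [I.Boundaryless]
  {M : Type*} [TopologicalSpace M] [ChartedSpace H M] [IsManifold I ∞ M]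

/-- The frame of the preferred chart is that of the trivialization of the tangent bundle, in which
smoothness of tensor fields is formulated. -/
theorem chartSymmDeriv_eq (x₀ : M) {y : E} (hy : y ∈ (extChartAt I x₀).target) :
    chartSymmDeriv (I := I) x₀ y =
      (trivializationAt E (TangentSpace I) x₀).symmL ℝ ((extChartAt I x₀).symm y) := by
  have hs : (extChartAt I x₀).symm y ∈ (chartAt H x₀).source := by
    rw [← extChartAt_source (I := I)]
    exact (extChartAt I x₀).map_target hy
  rw [TangentBundle.symmL_trivializationAt hs, (extChartAt I x₀).right_inv hy, I.range_eq_univ,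
    mfderivWithin_univ]
  rfl

theorem isInvertible_chartSymmDeriv (x₀ : M) {y : E} (hy : y ∈ (extChartAt I x₀).target) :
    (chartSymmDeriv (I := I) x₀ y).IsInvertible := by
  have := isInvertible_mfderivWithin_extChartAt_symm (I := I) hy
  rwa [I.range_eq_univ, mfderivWithin_univ] at this

theorem chartSymmDeriv_mfderiv (x₀ : M) {y : E} (hy : y ∈ (extChartAt I x₀).target)
    (v : TangentSpace I ((extChartAt I x₀).symm y)) :
    chartSymmDeriv x₀ y
      (mfderiv I 𝓘(ℝ, E) (extChartAt I x₀) ((extChartAt I x₀).symm y) v) = v := by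
  have := mfderivWithin_extChartAt_symm_comp_mfderiv_extChartAt (I := I) hy
  rw [I.range_eq_univ, mfderivWithin_univ] at this
  exact DFunLike.congr_fun this v

theorem contMDiffOn_symmL (x₀ : M) (u : E) :
    ContMDiffOn I (I.prod 𝓘(ℝ, E)) ∞ (fun z => TotalSpace.mk' E (E := fun x : M => TangentSpace I x)
      z ((trivializationAt E (TangentSpace I) x₀).symmL ℝ z u))
      (trivializationAt E (TangentSpace I) x₀).baseSet := by
  rw [Trivialization.contMDiffOn_section_baseSet_iff]
  refine (contMDiffOn_const (c := u)).congr fun z hz => ?_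
  rw [Trivialization.symmL_apply _ hz, Trivialization.apply_mk_symm _ hz]

theorem symm_mem_baseSet (x₀ : M) {y : E} (hy : y ∈ (extChartAt I x₀).target) :
    (extChartAt I x₀).symm y ∈ (trivializationAt E (TangentSpace I) x₀).baseSet := by
  rw [TangentBundle.trivializationAt_baseSet, ← extChartAt_source (I := I)]
  exact (extChartAt I x₀).map_target hy

theorem chartMetric_apply (g : Metric I M) (x₀ : M) (y u v : E) : chartMetric g x₀ y u v =
    g.inner ((extChartAt I x₀).symm y) (chartSymmDeriv x₀ y u) (chartSymmDeriv x₀ y v) := rfl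

theorem contDiffOn_chartMetric_apply (g : Metric I M) (x₀ : M) (u v : E) :
    ContDiffOn ℝ ∞ (fun y => chartMetric g x₀ y u v) (extChartAt I x₀).target := by
  have h1 : ContMDiffOn I 𝓘(ℝ, ℝ) ∞
      (fun z => g.inner z ((trivializationAt E (TangentSpace I) x₀).symmL ℝ z u)
        ((trivializationAt E (TangentSpace I) x₀).symmL ℝ z v))
      (trivializationAt E (TangentSpace I) x₀).baseSet := by
    intro z hz
    have h2 : ContMDiffWithinAt I (I.prod 𝓘(ℝ)) ∞ (fun z => TotalSpace.mk' ℝ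
        (E := Bundle.Trivial M ℝ) z
        (g.inner z ((trivializationAt E (TangentSpace I) x₀).symmL ℝ z u)
          ((trivializationAt E (TangentSpace I) x₀).symmL ℝ z v)))
        (trivializationAt E (TangentSpace I) x₀).baseSet z := by
      apply ContMDiffWithinAt.clm_bundle_apply₂ (F₁ := E) (F₂ := E)
      · exact g.contMDiff.contMDiffAt.contMDiffWithinAt
      · exact contMDiffOn_symmL x₀ u z hz
      · exact contMDiffOn_symmL x₀ v z hz
    simp only [contMDiffWithinAt_totalSpace] at h2
    exact h2.2
  have h3 := h1.comp (contMDiffOn_extChartAt_symm (n := ∞) (I := I) x₀)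
    (fun y hy => symm_mem_baseSet x₀ hy)
  rw [contMDiffOn_iff_contDiffOn] at h3
  refine h3.congr fun y hy => ?_
  rw [chartMetric_apply, chartSymmDeriv_eq x₀ hy]
  rfl

theorem chartPhi_apply (S : AlmostContactMetricStructure I M) (x₀ : M) (y u : E) :
    S.chartPhi x₀ y u = mfderiv I 𝓘(ℝ, E) (extChartAt I x₀) ((extChartAt I x₀).symm y)
      (S.phi ((extChartAt I x₀).symm y) (chartSymmDeriv x₀ y u)) := rfl

theorem chartSymmDeriv_chartPhi (S : AlmostContactMetricStructure I M) (x₀ : M) {y : E}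
    (hy : y ∈ (extChartAt I x₀).target) (u : E) :
    chartSymmDeriv x₀ y (S.chartPhi x₀ y u) =
      S.phi ((extChartAt I x₀).symm y) (chartSymmDeriv x₀ y u) := by
  rw [chartPhi_apply, chartSymmDeriv_mfderiv x₀ hy]

theorem contDiffOn_chartPhi_apply (S : AlmostContactMetricStructure I M) (x₀ : M) (u : E) :
    ContDiffOn ℝ ∞ (fun y => S.chartPhi x₀ y u) (extChartAt I x₀).target := by
  have h1 : ContMDiffOn I (I.prod 𝓘(ℝ, E)) ∞ (fun z => TotalSpace.mk' E
      (E := fun x : M => TangentSpace I x) z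
        (S.phi z ((trivializationAt E (TangentSpace I) x₀).symmL ℝ z u)))
      (trivializationAt E (TangentSpace I) x₀).baseSet :=
    (S.phi_smooth.contMDiffOn).clm_bundle_apply (contMDiffOn_symmL x₀ u)
  rw [Trivialization.contMDiffOn_section_baseSet_iff] at h1
  have h3 := h1.comp (contMDiffOn_extChartAt_symm (n := ∞) (I := I) x₀)
    (fun y hy => symm_mem_baseSet x₀ hy)
  rw [contMDiffOn_iff_contDiffOn] at h3
  refine h3.congr fun y hy => ?_
  have hb := symm_mem_baseSet (I := I) x₀ hy
  have hs : (extChartAt I x₀).symm y ∈ (chartAt H x₀).source := by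
    rwa [TangentBundle.trivializationAt_baseSet] at hb
  have hgen : ∀ w : TangentSpace I ((extChartAt I x₀).symm y),
      (trivializationAt E (TangentSpace I) x₀).continuousLinearMapAt ℝ
        ((extChartAt I x₀).symm y) w =
      ((trivializationAt E (TangentSpace I) x₀) ⟨(extChartAt I x₀).symm y, w⟩).2 := fun w => by
    rw [Trivialization.continuousLinearMapAt_apply, Trivialization.linearMapAt_apply, if_pos hb]
  rw [chartPhi_apply, chartSymmDeriv_eq x₀ hy,
    ← TangentBundle.continuousLinearMapAt_trivializationAt hs]
  exact hgen _

/-- The vector field `ξ` in the preferred chart at `x₀`. -/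
def chartXi (S : AlmostContactMetricStructure I M) (x₀ : M) (y : E) : E :=
  mfderiv I 𝓘(ℝ, E) (extChartAt I x₀) ((extChartAt I x₀).symm y)
    (S.xi ((extChartAt I x₀).symm y))

/-- The contact form `η` in the preferred chart at `x₀`. -/
def chartEta (S : AlmostContactMetricStructure I M) (x₀ : M) (y : E) : E →L[ℝ] ℝ :=
  (S.eta ((extChartAt I x₀).symm y)) ∘L (chartSymmDeriv (I := I) x₀ y)

theorem chartEta_apply (S : AlmostContactMetricStructure I M) (x₀ : M) (y u : E) :
    chartEta S x₀ y u = S.eta ((extChartAt I x₀).symm y) (chartSymmDeriv x₀ y u) := rfl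

theorem chartSymmDeriv_chartXi (S : AlmostContactMetricStructure I M) (x₀ : M) {y : E}
    (hy : y ∈ (extChartAt I x₀).target) :
    chartSymmDeriv x₀ y (chartXi S x₀ y) = S.xi ((extChartAt I x₀).symm y) := by
  rw [chartXi, chartSymmDeriv_mfderiv x₀ hy]

section FiniteDimensional

variable [FiniteDimensional ℝ E]

theorem isLocalMetric_chartMetric (g : Metric I M) (x₀ : M) :
    IsLocalMetric (chartMetric g x₀) (extChartAt I x₀).target where
  isOpen := isOpen_extChartAt_target x₀
  contDiffOn :=
    contDiffOn_clm_apply.2 fun u => contDiffOn_clm_apply.2 (contDiffOn_chartMetric_apply g x₀ u)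
  symm y _ u v := by
    rw [chartMetric_apply, chartMetric_apply, g.symm]
  pos y hy v hv := by
    rw [chartMetric_apply]
    refine g.pos _ _ ?_
    have := (isInvertible_chartSymmDeriv (I := I) x₀ hy).injective.ne hv
    rwa [map_zero] at this

theorem contDiffOn_chartPhi (S : AlmostContactMetricStructure I M) (x₀ : M) :
    ContDiffOn ℝ ∞ (S.chartPhi x₀) (extChartAt I x₀).target :=
  contDiffOn_clm_apply.2 (contDiffOn_chartPhi_apply S x₀)

theorem isLocalCosymplectic_chart {S : AlmostContactMetricStructure I M} (hS : S.IsCosymplectic)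
    (x₀ : M) : IsLocalCosymplectic (chartMetric S.g x₀) (S.chartPhi x₀) (chartXi S x₀)
      (chartEta S x₀) (extChartAt I x₀).target where
  metric := isLocalMetric_chartMetric S.g x₀
  contDiffOn := contDiffOn_chartPhi S x₀
  parallel := hS x₀
  contact y hy := by
    have hm := isLocalMetric_chartMetric S.g x₀
    have hinj := (isInvertible_chartSymmDeriv (I := I) x₀ hy).injective
    refine ⟨hm.symm y hy, hm.pos y hy, fun u => ?_, ?_, fun u v => ?_⟩
    · apply hinj
      rw [chartSymmDeriv_chartPhi S x₀ hy, chartSymmDeriv_chartPhi S x₀ hy, S.phi_phi, map_add,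
        map_neg, map_smul, chartSymmDeriv_chartXi S x₀ hy, chartEta_apply]
    · rw [chartEta_apply, chartSymmDeriv_chartXi S x₀ hy, S.eta_xi]
    · rw [chartMetric_apply, chartSymmDeriv_chartPhi S x₀ hy, chartSymmDeriv_chartPhi S x₀ hy,
        S.g_phi_phi, chartMetric_apply, chartEta_apply, chartEta_apply]

end FiniteDimensional

end Chart

/-! ### Maps in preferred charts -/

section ChartAtPoint

variable {E : Type*} [NormedAddCommGroup E] [NormedSpace ℝ E]
  {H : Type*} [TopologicalSpace H] {I : ModelWithCorners ℝ E H} [I.Boundaryless]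
  {M : Type*} [TopologicalSpace M] [ChartedSpace H M] [IsManifold I ∞ M]

/-- Tangent spaces at equal points agree: the vectors `u` and `v` of the model space are taken as
tangent vectors at both. -/
theorem inner_congr (g : Metric I M) {z z' : M} (h : z = z') (u v : E) :
    g.inner z (show TangentSpace I z from u) (show TangentSpace I z from v) =
      g.inner z' (show TangentSpace I z' from u) (show TangentSpace I z' from v) := by
  subst h
  rfl

theorem phi_congr (S : AlmostContactMetricStructure I M) {z z' : M} (h : z = z') {u v : E}
    (huv : u = v) : (show E from S.phi z u) = (show E from S.phi z' v) := by
  subst h huv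
  rfl

theorem xi_congr (S : AlmostContactMetricStructure I M) {z z' : M} (h : z = z') :
    (show E from S.xi z) = (show E from S.xi z') := by
  subst h
  rfl

/-- The identification of the tangent space at `x` with the model space is the one given by the
preferred chart at `x`. -/
theorem chartSymmDeriv_self (x : M) (u : E) :
    (show E from chartSymmDeriv (I := I) x (extChartAt I x x) u) = u := by
  have h := mfderivWithin_range_extChartAt_symm (I := I) (x := x)
  rw [I.range_eq_univ, mfderivWithin_univ] at h
  exact DFunLike.congr_fun h u

theorem chartMetric_self (g : Metric I M) (x : M) (u v : E) :
    chartMetric g x (extChartAt I x x) u v = g.inner x u v := by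
  refine (chartMetric_apply g x _ u v).trans ?_
  refine Eq.trans ?_ (inner_congr g (extChartAt_to_inv (I := I) x) u v)
  exact congr_arg₂ (fun a b : E => g.inner ((extChartAt I x).symm (extChartAt I x x)) a b)
    (chartSymmDeriv_self x u) (chartSymmDeriv_self x v)

theorem chartPhi_self (S : AlmostContactMetricStructure I M) (x : M) (u : E) :
    S.chartPhi x (extChartAt I x x) u = S.phi x u := by
  have h := chartSymmDeriv_chartPhi S x (mem_extChartAt_target (I := I) x) u
  exact (chartSymmDeriv_self x _).symm.trans
    (Eq.trans h (phi_congr S (extChartAt_to_inv (I := I) x) (chartSymmDeriv_self x u)))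

theorem chartXi_self (S : AlmostContactMetricStructure I M) (x : M) :
    chartXi S x (extChartAt I x x) = S.xi x := by
  have h := chartSymmDeriv_chartXi S x (mem_extChartAt_target (I := I) x)
  exact (chartSymmDeriv_self x _).symm.trans
    (Eq.trans h (xi_congr S (extChartAt_to_inv (I := I) x)))

end ChartAtPoint

section WrittenInChart

variable {E : Type*} [NormedAddCommGroup E] [NormedSpace ℝ E]
  {H : Type*} [TopologicalSpace H] {I : ModelWithCorners ℝ E H} [I.Boundaryless]
  {M : Type*} [TopologicalSpace M] [ChartedSpace H M] [IsManifold I ∞ M]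
  {E' : Type*} [NormedAddCommGroup E'] [NormedSpace ℝ E']
  {H' : Type*} [TopologicalSpace H'] {J : ModelWithCorners ℝ E' H'} [J.Boundaryless]
  {N : Type*} [TopologicalSpace N] [ChartedSpace H' N] [IsManifold J ∞ N]

variable (I J) in
/-- The set of the coordinate points, in the preferred chart at `x`, of the points that `F` maps
into the domain of the preferred chart at `F x`. -/
def chartDomain (F : M → N) (x : M) : Set E :=
  (extChartAt I x).target ∩ (extChartAt I x).symm ⁻¹' (F ⁻¹' (extChartAt J (F x)).source)

variable {F : M → N} {x : M} {y : E}

theorem isOpen_chartDomain (hF : Continuous F) (x : M) : IsOpen (chartDomain I J F x) :=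
  (continuousOn_extChartAt_symm x).isOpen_inter_preimage (isOpen_extChartAt_target x)
    ((isOpen_extChartAt_source (F x)).preimage hF)

theorem extChartAt_mem_chartDomain (F : M → N) (x : M) :
    extChartAt I x x ∈ chartDomain I J F x := by
  refine ⟨mem_extChartAt_target x, ?_⟩
  rw [Set.mem_preimage, extChartAt_to_inv]
  exact mem_extChartAt_source (F x)

theorem writtenInExtChartAt_mem_target (hy : y ∈ chartDomain I J F x) :
    writtenInExtChartAt I J x F y ∈ (extChartAt J (F x)).target :=
  (extChartAt J (F x)).map_source hy.2

theorem symm_writtenInExtChartAt (hy : y ∈ chartDomain I J F x) :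
    (extChartAt J (F x)).symm (writtenInExtChartAt I J x F y) = F ((extChartAt I x).symm y) :=
  (extChartAt J (F x)).left_inv hy.2

theorem contDiffOn_writtenInExtChartAt (hF : ContMDiff I J ∞ F) (x : M) :
    ContDiffOn ℝ ∞ (writtenInExtChartAt I J x F) (chartDomain I J F x) := by
  rw [← contMDiffOn_iff_contDiffOn]
  refine (contMDiffOn_extChartAt (I := J) (n := ∞) (x := F x)).comp (t := (chartAt H' (F x)).source)
    (hF.comp_contMDiffOn ((contMDiffOn_extChartAt_symm x).mono Set.inter_subset_left)) ?_
  intro y hy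
  rw [← extChartAt_source (I := J)]
  exact hy.2

theorem mdifferentiableAt_symm (x : M) (hy : y ∈ (extChartAt I x).target) :
    MDifferentiableAt 𝓘(ℝ, E) I (extChartAt I x).symm y := by
  have := mdifferentiableWithinAt_extChartAt_symm (I := I) hy
  rwa [I.range_eq_univ, mdifferentiableWithinAt_univ] at this

/-- The chain rule for the expression of `F` in charts. -/
theorem chartSymmDeriv_fderiv_writtenInExtChartAt (hF : ContMDiff I J ∞ F)
    (hy : y ∈ chartDomain I J F x) (u : E) :
    (show E' from chartSymmDeriv (I := J) (F x) (writtenInExtChartAt I J x F y)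
      (fderiv ℝ (writtenInExtChartAt I J x F) y u)) =
    (show E' from mfderiv I J F ((extChartAt I x).symm y) (chartSymmDeriv (I := I) x y u)) := by
  have ho : chartDomain I J F x ∈ nhds y := (isOpen_chartDomain hF.continuous x).mem_nhds hy
  have h1 : (extChartAt J (F x)).symm ∘ writtenInExtChartAt I J x F =ᶠ[nhds y]
      F ∘ (extChartAt I x).symm :=
    Filter.eventually_of_mem ho fun z hz => symm_writtenInExtChartAt hz
  have h2 : MDifferentiableAt 𝓘(ℝ, E) 𝓘(ℝ, E') (writtenInExtChartAt I J x F) y :=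
    (((contDiffOn_writtenInExtChartAt hF x).contDiffAt ho).differentiableAt
      (by simp)).mdifferentiableAt
  have h3 := mfderiv_comp_apply y
    (mdifferentiableAt_symm (I := J) (F x) (writtenInExtChartAt_mem_target hy)) h2 u
  have h4 := mfderiv_comp_apply y ((hF.mdifferentiable (by simp)) ((extChartAt I x).symm y))
    (mdifferentiableAt_symm (I := I) x hy.1) u
  rw [mfderiv_eq_fderiv] at h3
  exact h3.symm.trans ((DFunLike.congr_fun h1.mfderiv_eq u).trans h4)

theorem chartMetric_fderiv_writtenInExtChartAt (g : Metric J N) (hF : ContMDiff I J ∞ F)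
    (hy : y ∈ chartDomain I J F x) (u v : E) :
    chartMetric g (F x) (writtenInExtChartAt I J x F y)
      (fderiv ℝ (writtenInExtChartAt I J x F) y u) (fderiv ℝ (writtenInExtChartAt I J x F) y v) =
    inducedMetric I g F ((extChartAt I x).symm y) (chartSymmDeriv x y u)
      (chartSymmDeriv x y v) := by
  rw [chartMetric_apply]
  refine Eq.trans ?_ (inner_congr g (symm_writtenInExtChartAt hy) _ _)
  exact congr_arg₂ (fun a b : E' => g.inner ((extChartAt J (F x)).symm
    (writtenInExtChartAt I J x F y)) a b) (chartSymmDeriv_fderiv_writtenInExtChartAt hF hy u)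
    (chartSymmDeriv_fderiv_writtenInExtChartAt hF hy v)

theorem fderiv_writtenInExtChartAt_self (hF : ContMDiff I J ∞ F) (x : M) (u : E) :
    fderiv ℝ (writtenInExtChartAt I J x F) (extChartAt I x x) u = mfderiv I J F x u := by
  rw [(hF.mdifferentiable (by simp) x).mfderiv, I.range_eq_univ, fderivWithin_univ]
  rfl

theorem writtenInExtChartAt_self (F : M → N) (x : M) :
    writtenInExtChartAt I J x F (extChartAt I x x) = extChartAt J (F x) (F x) := by
  simp [writtenInExtChartAt]

theorem inducedMetric_eq_pullback (g : Metric J N) (hF : ContMDiff I J ∞ F) (x : M) (u v : E) :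
    inducedMetric I g F x u v =
      pullback (chartMetric g (F x)) (writtenInExtChartAt I J x F) (extChartAt I x x) u v := by
  rw [pullback_apply, writtenInExtChartAt_self, chartMetric_self,
    fderiv_writtenInExtChartAt_self hF, fderiv_writtenInExtChartAt_self hF]
  rfl

/-- Both sides are the Gauss formula in the preferred charts. -/
theorem secondFundamentalForm_eq_sff (g : Metric J N) (F : M → N) (x : M) (u v : E) :
    secondFundamentalForm I g F x u v =
      sff (chartMetric g (F x)) (writtenInExtChartAt I J x F) (extChartAt I x x) u v := rfl

theorem meanCurvature_eq_meanCurv (g : Metric J N) (hF : ContMDiff I J ∞ F) (x : M) :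
    meanCurvature I g F x = meanCurv (chartMetric g (F x))
      (writtenInExtChartAt I J x F) (extChartAt I x x) := by
  have h : inducedMetric I g F x = fun u v : E => pullback (chartMetric g (F x))
      (writtenInExtChartAt I J x F) (extChartAt I x x) u v := by
    funext u v
    exact inducedMetric_eq_pullback g hF x u v
  rw [meanCurvature, h]
  rfl

end WrittenInChart

/-! ### Products of manifolds in preferred charts -/

section Product

variable {E₁ : Type*} [NormedAddCommGroup E₁] [NormedSpace ℝ E₁]
  {H₁ : Type*} [TopologicalSpace H₁] {I₁ : ModelWithCorners ℝ E₁ H₁} [I₁.Boundaryless]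
  {N₁ : Type*} [TopologicalSpace N₁] [ChartedSpace H₁ N₁] [IsManifold I₁ ∞ N₁]
  {E₂ : Type*} [NormedAddCommGroup E₂] [NormedSpace ℝ E₂]
  {H₂ : Type*} [TopologicalSpace H₂] {I₂ : ModelWithCorners ℝ E₂ H₂} [I₂.Boundaryless]
  {N₂ : Type*} [TopologicalSpace N₂] [ChartedSpace H₂ N₂] [IsManifold I₂ ∞ N₂]
  {E : Type*} [NormedAddCommGroup E] [NormedSpace ℝ E]
  {H : Type*} [TopologicalSpace H] {I : ModelWithCorners ℝ E H} [I.Boundaryless]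
  {M : Type*} [TopologicalSpace M] [ChartedSpace H M] [IsManifold I ∞ M]

theorem extChartAt_prod_apply (x z : N₁ × N₂) :
    extChartAt (I₁.prod I₂) x z = (extChartAt I₁ x.1 z.1, extChartAt I₂ x.2 z.2) := by
  rw [extChartAt_prod]
  rfl

theorem extChartAt_prod_symm_apply (x : N₁ × N₂) (y : E₁ × E₂) :
    (extChartAt (I₁.prod I₂) x).symm y =
      ((extChartAt I₁ x.1).symm y.1, (extChartAt I₂ x.2).symm y.2) := by
  rw [extChartAt_prod]
  rfl

theorem mem_extChartAt_prod_target {x : N₁ × N₂} {y : E₁ × E₂} :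
    y ∈ (extChartAt (I₁.prod I₂) x).target ↔
      y.1 ∈ (extChartAt I₁ x.1).target ∧ y.2 ∈ (extChartAt I₂ x.2).target := by
  rw [extChartAt_prod]
  rfl

theorem chartSymmDeriv_fst {x : N₁ × N₂} {y : E₁ × E₂}
    (hy : y ∈ (extChartAt (I₁.prod I₂) x).target) (u : E₁ × E₂) :
    (show E₁ × E₂ from chartSymmDeriv (I := I₁.prod I₂) x y u).1 =
      (show E₁ from chartSymmDeriv (I := I₁) x.1 y.1 u.1) := by
  have hf : (Prod.fst : N₁ × N₂ → N₁) ∘ (extChartAt (I₁.prod I₂) x).symm =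
      (extChartAt I₁ x.1).symm ∘ (Prod.fst : E₁ × E₂ → E₁) := by
    funext z
    rw [Function.comp_apply, Function.comp_apply, extChartAt_prod_symm_apply]
  have h1 := mfderiv_comp_apply (I'' := I₁) y
    (mdifferentiableAt_fst (I := I₁) (I' := I₂) (x := (extChartAt (I₁.prod I₂) x).symm y))
    (mdifferentiableAt_symm (I := I₁.prod I₂) x hy) u
  have h2 := mfderiv_comp_apply (I := 𝓘(ℝ, E₁ × E₂)) (I' := 𝓘(ℝ, E₁)) (I'' := I₁) y
    (mdifferentiableAt_symm (I := I₁) x.1 (mem_extChartAt_prod_target.1 hy).1)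
    (differentiableAt_fst (𝕜 := ℝ)).mdifferentiableAt u
  rw [mfderiv_fst] at h1
  rw [mfderiv_eq_fderiv, fderiv_fst] at h2
  rw [hf] at h1
  exact h1.symm.trans h2

theorem chartSymmDeriv_snd {x : N₁ × N₂} {y : E₁ × E₂}
    (hy : y ∈ (extChartAt (I₁.prod I₂) x).target) (u : E₁ × E₂) :
    (show E₁ × E₂ from chartSymmDeriv (I := I₁.prod I₂) x y u).2 =
      (show E₂ from chartSymmDeriv (I := I₂) x.2 y.2 u.2) := by
  have hf : (Prod.snd : N₁ × N₂ → N₂) ∘ (extChartAt (I₁.prod I₂) x).symm =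
      (extChartAt I₂ x.2).symm ∘ (Prod.snd : E₁ × E₂ → E₂) := by
    funext z
    rw [Function.comp_apply, Function.comp_apply, extChartAt_prod_symm_apply]
  have h1 := mfderiv_comp_apply (I'' := I₂) y
    (mdifferentiableAt_snd (I := I₁) (I' := I₂) (x := (extChartAt (I₁.prod I₂) x).symm y))
    (mdifferentiableAt_symm (I := I₁.prod I₂) x hy) u
  have h2 := mfderiv_comp_apply (I := 𝓘(ℝ, E₁ × E₂)) (I' := 𝓘(ℝ, E₂)) (I'' := I₂) y
    (mdifferentiableAt_symm (I := I₂) x.2 (mem_extChartAt_prod_target.1 hy).2)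
    (differentiableAt_snd (𝕜 := ℝ)).mdifferentiableAt u
  rw [mfderiv_snd] at h1
  rw [mfderiv_eq_fderiv, fderiv_snd] at h2
  rw [hf] at h1
  exact h1.symm.trans h2

theorem mfderiv_fst_leaf {F : N₁ × N₂ → M} (hF : ContMDiff (I₁.prod I₂) I ∞ F) (p : N₁) (q : N₂)
    (u : E₁) : mfderiv I₁ I (fun p' => F (p', q)) p u =
      mfderiv (I₁.prod I₂) I F (p, q) ((u, 0) : E₁ × E₂) := by
  have h := mfderiv_comp_apply (I := I₁) (I' := I₁.prod I₂) (I'' := I) (f := fun p' => (p', q)) p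
    (hF.mdifferentiable (by simp) (p, q))
    (mdifferentiableAt_id.prodMk mdifferentiableAt_const) u
  rw [mfderiv_prod_left] at h
  exact h

theorem mfderiv_snd_leaf {F : N₁ × N₂ → M} (hF : ContMDiff (I₁.prod I₂) I ∞ F) (p : N₁) (q : N₂)
    (u : E₂) : mfderiv I₂ I (fun q' => F (p, q')) q u =
      mfderiv (I₁.prod I₂) I F (p, q) ((0, u) : E₁ × E₂) := by
  have h := mfderiv_comp_apply (I := I₂) (I' := I₁.prod I₂) (I'' := I) (f := fun q' => (p, q')) q
    (hF.mdifferentiable (by simp) (p, q))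
    (mdifferentiableAt_const.prodMk mdifferentiableAt_id) u
  rw [mfderiv_prod_right] at h
  exact h

theorem writtenInExtChartAt_fst_leaf (F : N₁ × N₂ → M) (p : N₁) (q : N₂) :
    writtenInExtChartAt I₁ I p (fun p' => F (p', q)) =
      writtenInExtChartAt (I₁.prod I₂) I (p, q) F ∘ fun z => (z, extChartAt I₂ q q) := by
  funext z
  simp only [writtenInExtChartAt, Function.comp_apply, extChartAt_prod_symm_apply,
    extChartAt_to_inv]

theorem writtenInExtChartAt_snd_leaf (F : N₁ × N₂ → M) (p : N₁) (q : N₂) :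
    writtenInExtChartAt I₂ I q (fun q' => F (p, q')) =
      writtenInExtChartAt (I₁.prod I₂) I (p, q) F ∘ fun z => (extChartAt I₁ p p, z) := by
  funext z
  simp only [writtenInExtChartAt, Function.comp_apply, extChartAt_prod_symm_apply,
    extChartAt_to_inv]

theorem warpedMetric_apply (g₁ : Metric I₁ N₁) (g₂ : Metric I₂ N₂) (f : N₁ → ℝ) (x : N₁ × N₂)
    (u v : E₁ × E₂) : warpedMetric g₁ g₂ f x u v =
      g₁.inner x.1 u.1 v.1 + f x.1 ^ 2 * g₂.inner x.2 u.2 v.2 := by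
  have h₁ : ∀ w : E₁ × E₂, mfderiv (I₁.prod I₂) I₁ Prod.fst x w = w.1 := fun w => by
    rw [mfderiv_fst]
    rfl
  have h₂ : ∀ w : E₁ × E₂, mfderiv (I₁.prod I₂) I₂ Prod.snd x w = w.2 := fun w => by
    rw [mfderiv_snd]
    rfl
  exact congr_arg₂ (fun a b => a + f x.1 ^ 2 * b)
    (congr_arg₂ (fun a b : E₁ => g₁.inner x.1 a b) (h₁ u) (h₁ v))
    (congr_arg₂ (fun a b : E₂ => g₂.inner x.2 a b) (h₂ u) (h₂ v))

end Product

/-! ### The inequality on manifolds -/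

section Functions

variable {E : Type*} [NormedAddCommGroup E] [NormedSpace ℝ E]
  {H : Type*} [TopologicalSpace H] {I : ModelWithCorners ℝ E H} [I.Boundaryless]
  {M : Type*} [TopologicalSpace M] [ChartedSpace H M] [IsManifold I ∞ M]

theorem contDiffOn_comp_symm {f : M → ℝ} (hf : ContMDiff I 𝓘(ℝ, ℝ) ∞ f) (x : M) :
    ContDiffOn ℝ ∞ (f ∘ (extChartAt I x).symm) (extChartAt I x).target := by
  rw [← contMDiffOn_iff_contDiffOn]
  exact hf.comp_contMDiffOn (contMDiffOn_extChartAt_symm x)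

theorem contMDiff_log {f : M → ℝ} (hf : ContMDiff I 𝓘(ℝ, ℝ) ∞ f) (hpos : ∀ p, 0 < f p) :
    ContMDiff I 𝓘(ℝ, ℝ) ∞ fun p => Real.log (f p) := fun p =>
  ContMDiffAt.comp p ((Real.contDiffAt_log.2 (hpos p).ne').contMDiffAt) (hf p)

theorem chartMetric_self_eq (g : Metric I M) (x : M) :
    chartMetric g x (extChartAt I x x) = (show E →L[ℝ] E →L[ℝ] ℝ from g.inner x) := by
  ext u v
  exact chartMetric_self g x u v

theorem gradNormSq_eq (g : Metric I M) {ℓ : M → ℝ} (hℓ : ContMDiff I 𝓘(ℝ, ℝ) ∞ ℓ) (x : M) :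
    gradNormSq g ℓ x = chartMetric g x (extChartAt I x x)
      ((chartMetric g x (extChartAt I x x)).inverse
        (fderiv ℝ (ℓ ∘ (extChartAt I x).symm) (extChartAt I x x)))
      ((chartMetric g x (extChartAt I x x)).inverse
        (fderiv ℝ (ℓ ∘ (extChartAt I x).symm) (extChartAt I x x))) := by
  have h : (show E →L[ℝ] ℝ from mfderiv I 𝓘(ℝ, ℝ) ℓ x) =
      fderiv ℝ (ℓ ∘ (extChartAt I x).symm) (extChartAt I x x) := by
    rw [(hℓ.mdifferentiable (by simp) x).mfderiv, I.range_eq_univ, fderivWithin_univ]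
    rfl
  rw [chartMetric_self_eq, ← h]
  rfl

theorem laplacian_eq (g : Metric I M) (ℓ : M → ℝ) (x : M) :
    laplacian g ℓ x = -metricTrace (fun u v : E => chartMetric g x (extChartAt I x x) u v)
      (localHessian (chartMetric g x) (ℓ ∘ (extChartAt I x).symm) (extChartAt I x x)) := by
  rw [chartMetric_self_eq]
  rfl

end Functions

section Warped

variable {E₁ : Type*} [NormedAddCommGroup E₁] [NormedSpace ℝ E₁] [FiniteDimensional ℝ E₁]
  {H₁ : Type*} [TopologicalSpace H₁] {I₁ : ModelWithCorners ℝ E₁ H₁} [I₁.Boundaryless]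
  {N₁ : Type*} [TopologicalSpace N₁] [ChartedSpace H₁ N₁] [IsManifold I₁ ∞ N₁]
  {E₂ : Type*} [NormedAddCommGroup E₂] [NormedSpace ℝ E₂] [FiniteDimensional ℝ E₂]
  {H₂ : Type*} [TopologicalSpace H₂] {I₂ : ModelWithCorners ℝ E₂ H₂} [I₂.Boundaryless]
  {N₂ : Type*} [TopologicalSpace N₂] [ChartedSpace H₂ N₂] [IsManifold I₂ ∞ N₂]
  {E : Type*} [NormedAddCommGroup E] [NormedSpace ℝ E] [FiniteDimensional ℝ E]
  {H : Type*} [TopologicalSpace H] {I : ModelWithCorners ℝ E H} [I.Boundaryless]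
  {M : Type*} [TopologicalSpace M] [ChartedSpace H M] [IsManifold I ∞ M]
  {S : AlmostContactMetricStructure I M} {g₁ : Metric I₁ N₁} {g₂ : Metric I₂ N₂} {f : N₁ → ℝ}
  {F : N₁ × N₂ → M}

theorem chartSymmDeriv_fderiv_fst (hF : ContMDiff (I₁.prod I₂) I ∞ F) {x : N₁ × N₂} {y : E₁ × E₂}
    (hy : y ∈ chartDomain (I₁.prod I₂) I F x) (X : E₁) :
    (show E from chartSymmDeriv (I := I) (F x) (writtenInExtChartAt (I₁.prod I₂) I x F y)
      (fderiv ℝ (writtenInExtChartAt (I₁.prod I₂) I x F) y (X, 0))) =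
    (show E from mfderiv I₁ I (fun p => F (p, (extChartAt I₂ x.2).symm y.2))
      ((extChartAt I₁ x.1).symm y.1) (chartSymmDeriv x.1 y.1 X)) := by
  have h : ∀ {z : N₁ × N₂} {z₁ : N₁} {z₂ : N₂} (_ : z = (z₁, z₂)) {a : E₁ × E₂} {a₁ : E₁}
      (_ : a.1 = a₁) (_ : a.2 = 0), (show E from mfderiv (I₁.prod I₂) I F z a) =
      (show E from mfderiv I₁ I (fun p => F (p, z₂)) z₁ a₁) := by
    rintro _ z₁ z₂ rfl ⟨a₁, a₂⟩ _ rfl h₂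
    obtain rfl : a₂ = 0 := h₂
    exact (mfderiv_fst_leaf hF z₁ z₂ a₁).symm
  refine (chartSymmDeriv_fderiv_writtenInExtChartAt hF hy (X, 0)).trans
    (h (extChartAt_prod_symm_apply x y) (chartSymmDeriv_fst hy.1 (X, 0)) ?_)
  exact (chartSymmDeriv_snd hy.1 (X, 0)).trans (map_zero _)

theorem chartSymmDeriv_fderiv_snd (hF : ContMDiff (I₁.prod I₂) I ∞ F) {x : N₁ × N₂} {y : E₁ × E₂}
    (hy : y ∈ chartDomain (I₁.prod I₂) I F x) (Z : E₂) :
    (show E from chartSymmDeriv (I := I) (F x) (writtenInExtChartAt (I₁.prod I₂) I x F y)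
      (fderiv ℝ (writtenInExtChartAt (I₁.prod I₂) I x F) y (0, Z))) =
    (show E from mfderiv I₂ I (fun q => F ((extChartAt I₁ x.1).symm y.1, q))
      ((extChartAt I₂ x.2).symm y.2) (chartSymmDeriv x.2 y.2 Z)) := by
  have h : ∀ {z : N₁ × N₂} {z₁ : N₁} {z₂ : N₂} (_ : z = (z₁, z₂)) {a : E₁ × E₂} {a₂ : E₂}
      (_ : a.1 = 0) (_ : a.2 = a₂), (show E from mfderiv (I₁.prod I₂) I F z a) =
      (show E from mfderiv I₂ I (fun q => F (z₁, q)) z₂ a₂) := by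
    rintro _ z₁ z₂ rfl ⟨a₁, a₂⟩ _ h₁ rfl
    obtain rfl : a₁ = 0 := h₁
    exact (mfderiv_snd_leaf hF z₁ z₂ a₂).symm
  refine (chartSymmDeriv_fderiv_writtenInExtChartAt hF hy (0, Z)).trans
    (h (extChartAt_prod_symm_apply x y) ?_ (chartSymmDeriv_snd hy.1 (0, Z)))
  exact (chartSymmDeriv_fst hy.1 (0, Z)).trans (map_zero _)

theorem symm_writtenInExtChartAt_prod {x : N₁ × N₂} {y : E₁ × E₂}
    (hy : y ∈ chartDomain (I₁.prod I₂) I F x) :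
    (extChartAt I (F x)).symm (writtenInExtChartAt (I₁.prod I₂) I x F y) =
      F ((extChartAt I₁ x.1).symm y.1, (extChartAt I₂ x.2).symm y.2) := by
  rw [symm_writtenInExtChartAt hy, extChartAt_prod_symm_apply]

/-- A contact CR-warped product, written in the preferred charts, is one in coordinates. -/
theorem IsContactCRWarpedProduct.isLocalCRWarped (hF : IsContactCRWarpedProduct S g₁ g₂ f F)
    (hS : S.IsCosymplectic) (x : N₁ × N₂) :
    IsLocalCRWarped (chartMetric S.g (F x)) (S.chartPhi (F x)) (chartXi S (F x)) (chartEta S (F x))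
      (extChartAt I (F x)).target (chartMetric g₁ x.1) (extChartAt I₁ x.1).target
      (chartMetric g₂ x.2) (extChartAt I₂ x.2).target
      (fun z => f ((extChartAt I₁ x.1).symm z) ^ 2)
      (writtenInExtChartAt (I₁.prod I₂) I x F) (chartDomain (I₁.prod I₂) I F x) where
  cosymplectic := isLocalCosymplectic_chart hS (F x)
  metric₁ := isLocalMetric_chartMetric g₁ x.1
  metric₂ := isLocalMetric_chartMetric g₂ x.2
  contDiffOn_warp := (contDiffOn_comp_symm hF.warping_smooth x.1).pow 2
  warp_pos z _ := pow_pos (hF.warping_pos _) 2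
  isOpen := isOpen_chartDomain hF.smooth.continuous x
  contDiffOn := contDiffOn_writtenInExtChartAt hF.smooth x
  mapsTo y hy := writtenInExtChartAt_mem_target hy
  mapsTo₁ y hy := (mem_extChartAt_prod_target.1 hy.1).1
  mapsTo₂ y hy := (mem_extChartAt_prod_target.1 hy.1).2
  isometric y hy u v := by
    rw [chartMetric_fderiv_writtenInExtChartAt S.g hF.smooth hy, hF.isometric]
    have hz := extChartAt_prod_symm_apply (I₁ := I₁) (I₂ := I₂) x y
    have h : ∀ {z : N₁ × N₂} {z₁ : N₁} {z₂ : N₂} (_ : z = (z₁, z₂)) {a b : E₁ × E₂}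
        {a₁ b₁ : E₁} {a₂ b₂ : E₂} (_ : a.1 = a₁) (_ : a.2 = a₂) (_ : b.1 = b₁) (_ : b.2 = b₂),
        warpedMetric g₁ g₂ f z a b = g₁.inner z₁ a₁ b₁ + f z₁ ^ 2 * g₂.inner z₂ a₂ b₂ := by
      rintro _ z₁ z₂ rfl a b _ _ _ _ rfl rfl rfl rfl
      exact warpedMetric_apply g₁ g₂ f (z₁, z₂) a b
    exact h hz (chartSymmDeriv_fst hy.1 u) (chartSymmDeriv_snd hy.1 u)
      (chartSymmDeriv_fst hy.1 v) (chartSymmDeriv_snd hy.1 v)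
  xi_tangent y hy := by
    have ht := writtenInExtChartAt_mem_target hy
    have h₁ := (mem_extChartAt_prod_target.1 hy.1).1
    obtain ⟨u, hu⟩ := hF.xi_tangent ((extChartAt I₁ x.1).symm y.1) ((extChartAt I₂ x.2).symm y.2)
    obtain ⟨k, rfl⟩ := (isInvertible_chartSymmDeriv (I := I₁) x.1 h₁).surjective u
    refine ⟨k, (isInvertible_chartSymmDeriv (I := I) (F x) ht).injective ?_⟩
    rw [chartSymmDeriv_chartXi S (F x) ht]
    exact (chartSymmDeriv_fderiv_fst hF.smooth hy k).trans
      (Eq.trans hu (xi_congr S (symm_writtenInExtChartAt_prod hy)).symm)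
  invariant y hy X := by
    have ht := writtenInExtChartAt_mem_target hy
    have h₁ := (mem_extChartAt_prod_target.1 hy.1).1
    obtain ⟨u, hu⟩ := hF.invariant ((extChartAt I₁ x.1).symm y.1) ((extChartAt I₂ x.2).symm y.2)
      (chartSymmDeriv x.1 y.1 X)
    obtain ⟨X', rfl⟩ := (isInvertible_chartSymmDeriv (I := I₁) x.1 h₁).surjective u
    refine ⟨X', (isInvertible_chartSymmDeriv (I := I) (F x) ht).injective ?_⟩
    rw [chartSymmDeriv_chartPhi S (F x) ht]
    exact (chartSymmDeriv_fderiv_fst hF.smooth hy X').trans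
      (Eq.trans hu (phi_congr S (symm_writtenInExtChartAt_prod hy)
        (chartSymmDeriv_fderiv_fst hF.smooth hy X)).symm)
  antiInvariant y hy Z w := by
    have ht := writtenInExtChartAt_mem_target hy
    rw [chartMetric_apply, chartSymmDeriv_chartPhi S (F x) ht]
    have h : ∀ {z z' : M} (_ : z = z') {a a' b b' : E} (_ : a = a') (_ : b = b'),
        S.g.inner z (S.phi z a) b = S.g.inner z' (S.phi z' a') b' := by
      rintro z _ rfl a _ b _ rfl rfl
      rfl
    have hz := extChartAt_prod_symm_apply (I₁ := I₁) (I₂ := I₂) x y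
    have hw : ∀ {z : N₁ × N₂} {z₁ : N₁} {z₂ : N₂} (_ : z = (z₁, z₂)) (a : E₁ × E₂),
        (show E from mfderiv (I₁.prod I₂) I F z a) =
          (show E from mfderiv (I₁.prod I₂) I F (z₁, z₂) a) := by
      rintro _ z₁ z₂ rfl a
      rfl
    exact (h (symm_writtenInExtChartAt_prod hy) (chartSymmDeriv_fderiv_snd hF.smooth hy Z)
      ((chartSymmDeriv_fderiv_writtenInExtChartAt hF.smooth hy w).trans (hw hz _))).trans
      (hF.antiInvariant _ _ _ _)

/-- Constant `φ`-sectional curvature in the preferred chart, with `η(u) = 0` in place of `u ⟂ ξ`. -/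
theorem sectionalCurvature_chart {c : ℝ} (hS : S.IsCosymplecticSpaceForm c) (z : M) (u : E)
    (hu : u ≠ 0) (hη : chartEta S z (extChartAt I z z) u = 0) :
    chartMetric S.g z (extChartAt I z z) (localCurvature (chartMetric S.g z) (extChartAt I z z) u
        (S.chartPhi z (extChartAt I z z) u) (S.chartPhi z (extChartAt I z z) u)) u
      / (chartMetric S.g z (extChartAt I z z) u u
          * chartMetric S.g z (extChartAt I z z) (S.chartPhi z (extChartAt I z z) u)
              (S.chartPhi z (extChartAt I z z) u)
        - chartMetric S.g z (extChartAt I z z) u (S.chartPhi z (extChartAt I z z) u) ^ 2) = c := by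
  have h1 : chartMetric S.g z (extChartAt I z z) u (chartXi S z (extChartAt I z z)) = 0 := by
    rw [((isLocalCosymplectic_chart hS.1 z).contact _ (mem_extChartAt_target z)).inner_xi, hη]
  rw [chartMetric_self, chartXi_self] at h1
  rw [chartMetric_self, chartMetric_self, chartMetric_self, chartMetric_self, chartPhi_self]
  exact hS.2 z u hu h1

theorem IsContactCRWarpedProduct.secondFundamentalFormNormSq_eq
    (hF : IsContactCRWarpedProduct S g₁ g₂ f F) (x : N₁ × N₂) :
    secondFundamentalFormNormSq (I₁.prod I₂) S.g F x = sffNormSq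
      (chartMetric S.g (F x)) (writtenInExtChartAt (I₁.prod I₂) I x F)
      (extChartAt (I₁.prod I₂) x x) := by
  have h : inducedMetric (I₁.prod I₂) S.g F x = fun u v : E₁ × E₂ =>
      pullback (chartMetric S.g (F x)) (writtenInExtChartAt (I₁.prod I₂) I x F)
      (extChartAt (I₁.prod I₂) x x) u v := by
    funext u v
    exact inducedMetric_eq_pullback S.g hF.smooth x u v
  rw [secondFundamentalFormNormSq, h, sffNormSq, writtenInExtChartAt_self,
    chartMetric_self_eq]
  rfl

/-- The lower bound for `‖h‖²` at one point, and the meaning of equality at this point. -/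
theorem IsContactCRWarpedProduct.le_secondFundamentalFormNormSq
    (hF : IsContactCRWarpedProduct S g₁ g₂ f F) {c : ℝ} (hS : S.IsCosymplecticSpaceForm c)
    (x : N₁ × N₂) :
    2 * (Module.finrank ℝ E₂ : ℝ) * (gradNormSq g₁ (fun p => Real.log (f p)) x.1
        - laplacian g₁ (fun p => Real.log (f p)) x.1 + ((Module.finrank ℝ E₁ : ℝ) - 1) * c / 4)
      ≤ secondFundamentalFormNormSq (I₁.prod I₂) S.g F x ∧
    (secondFundamentalFormNormSq (I₁.prod I₂) S.g F x =
      2 * (Module.finrank ℝ E₂ : ℝ) * (gradNormSq g₁ (fun p => Real.log (f p)) x.1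
        - laplacian g₁ (fun p => Real.log (f p)) x.1 + ((Module.finrank ℝ E₁ : ℝ) - 1) * c / 4) ↔
      (∀ X Y : E₁, secondFundamentalForm I₁ S.g (fun p => F (p, x.2)) x.1 X Y = 0) ∧
      (∀ Z W : E₂, secondFundamentalForm I₂ S.g (fun q => F (x.1, q)) x.2 Z W =
        inducedMetric I₂ S.g (fun q => F (x.1, q)) x.2 Z W •
          meanCurvature I₂ S.g (fun q => F (x.1, q)) x.2) ∧
      meanCurvature (I₁.prod I₂) S.g F x = 0) := by
  have hl := hF.isLocalCRWarped hS.1 x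
  have hx := extChartAt_mem_chartDomain (I := I₁.prod I₂) (J := I) F x
  have hlog := contMDiff_log hF.warping_smooth hF.warping_pos
  have hx₁ : (extChartAt (I₁.prod I₂) x x).1 = extChartAt I₁ x.1 x.1 := by
    rw [extChartAt_prod_apply]
  have hx₂ : (extChartAt (I₁.prod I₂) x x).2 = extChartAt I₂ x.2 x.2 := by
    rw [extChartAt_prod_apply]
  have h1 := hl.le_sffNormSq hx (c := c) (ℓ := (fun p => Real.log (f p)) ∘ (extChartAt I₁ x.1).symm)
    (N := gradNormSq g₁ (fun p => Real.log (f p)) x.1)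
    (L := laplacian g₁ (fun p => Real.log (f p)) x.1)
    (by
      rw [writtenInExtChartAt_self]
      exact sectionalCurvature_chart hS (F x))
    (by
      rw [hx₁]
      exact (contDiffOn_comp_symm hlog x.1).contDiffAt (extChartAt_target_mem_nhds x.1))
    (Filter.Eventually.of_forall fun z => by
      change f ((extChartAt I₁ x.1).symm z) ^ 2 =
        Real.exp (2 * Real.log (f ((extChartAt I₁ x.1).symm z)))
      rw [two_mul, Real.exp_add, Real.exp_log (hF.warping_pos _), sq])
    (by rw [hx₁]; exact gradNormSq_eq g₁ hlog x.1)
    (by rw [hx₁]; exact laplacian_eq g₁ _ x.1)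
  rw [hF.secondFundamentalFormNormSq_eq x]
  refine ⟨h1.1, h1.2.trans ((hl.sff_eq_zero_iff hx).trans ?_)⟩
  have hF₁ : ContMDiff I₁ I ∞ fun p => F (p, x.2) :=
    hF.smooth.comp (contMDiff_id.prodMk contMDiff_const)
  have hF₂ : ContMDiff I₂ I ∞ fun q => F (x.1, q) :=
    hF.smooth.comp (contMDiff_const.prodMk contMDiff_id)
  have hw₁ := writtenInExtChartAt_fst_leaf (I₁ := I₁) (I₂ := I₂) (I := I) F x.1 x.2
  have hw₂ := writtenInExtChartAt_snd_leaf (I₁ := I₁) (I₂ := I₂) (I := I) F x.1 x.2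
  rw [hx₁, hx₂]
  refine and_congr (forall₂_congr fun X Y => ?_) (and_congr (forall₂_congr fun Z W => ?_) ?_)
  · rw [secondFundamentalForm_eq_sff, hw₁]
    rfl
  · rw [secondFundamentalForm_eq_sff, inducedMetric_eq_pullback S.g hF₂,
      meanCurvature_eq_meanCurv S.g hF₂, hw₂]
    rfl
  · rw [meanCurvature_eq_meanCurv S.g hF.smooth]
    rfl

end Warped

end CRWarped

end

theorem theorem4p2 (n₁ n₂ m : ℕ)
    {NT : Type*} [TopologicalSpace NT] [ChartedSpace (EuclideanSpace ℝ (Fin n₁)) NT]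
    [IsManifold (𝓡 n₁) ∞ NT]
    {NP : Type*} [TopologicalSpace NP] [ChartedSpace (EuclideanSpace ℝ (Fin n₂)) NP]
    [IsManifold (𝓡 n₂) ∞ NP]
    {M : Type*} [TopologicalSpace M] [ChartedSpace (EuclideanSpace ℝ (Fin (2 * m + 1))) M]
    [IsManifold (𝓡 (2 * m + 1)) ∞ M]
    (S : CRWarped.AlmostContactMetricStructure (𝓡 (2 * m + 1)) M) (c : ℝ)
    (hS : S.IsCosymplecticSpaceForm c)
    (gT : CRWarped.Metric (𝓡 n₁) NT) (gP : CRWarped.Metric (𝓡 n₂) NP)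
    (f : NT → ℝ) (F : NT × NP → M)
    (hF : CRWarped.IsContactCRWarpedProduct S gT gP f F) :
    (∀ x : NT × NP,
      2 * (n₂ : ℝ) * (CRWarped.gradNormSq gT (fun p => Real.log (f p)) x.1
          - CRWarped.laplacian gT (fun p => Real.log (f p)) x.1 + ((n₁ : ℝ) - 1) * c / 4)
        ≤ CRWarped.secondFundamentalFormNormSq ((𝓡 n₁).prod (𝓡 n₂)) S.g F x) ∧
    ((∀ x : NT × NP,
      CRWarped.secondFundamentalFormNormSq ((𝓡 n₁).prod (𝓡 n₂)) S.g F x =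
        2 * (n₂ : ℝ) * (CRWarped.gradNormSq gT (fun p => Real.log (f p)) x.1
          - CRWarped.laplacian gT (fun p => Real.log (f p)) x.1 + ((n₁ : ℝ) - 1) * c / 4)) ↔
      (∀ q : NP, CRWarped.IsTotallyGeodesic (𝓡 n₁) S.g (fun p => F (p, q))) ∧
      (∀ p : NT, CRWarped.IsTotallyUmbilical (𝓡 n₂) S.g (fun q => F (p, q))) ∧
      CRWarped.IsMinimal ((𝓡 n₁).prod (𝓡 n₂)) S.g F) := by
  have h := fun x => hF.le_secondFundamentalFormNormSq hS x
  simp only [finrank_euclideanSpace_fin] at h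
  refine ⟨fun x => (h x).1, fun heq => ?_, fun ⟨h₁, h₂, h₃⟩ x => ?_⟩
  · have h' := fun x => (h x).2.1 (heq x)
    exact ⟨fun q p X Y => (h' (p, q)).1 X Y, fun p q Z W => (h' (p, q)).2.1 Z W,
      fun x => (h' x).2.2⟩
  · exact (h x).2.2 ⟨h₁ x.2 x.1, h₂ x.1 x.2, h₃ x⟩
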